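/- Let $D$ be a non-principal ultrafilter on the set $P$ of prime numbers, and let ${}^*\mathbb Z=\mathbb Z^P/D$, ${}^*\mathbb R=\mathbb R^P/D$, ${}^*\mathbb C=\mathbb C^P/D$; the functions $\exp$ and $(a,n)\mapsto a^n$ are extended to these ultrapowers. For $N\le M$ in ${}^*\mathbb Z$ put ${}^*\mathbb Z[N:M]=\{z: N\le z\le M\}$. **Parameters.** Let $\mathfrak p>0$ be a prime element of ${}^*\mathbb Z$, $\mathrm F_{\mathfrak p}={}^*\mathbb Z/\mathfrak p$, and let $\epsilon\in{}^*\mathbb Z[0:\mathfrak p-1]\cong\mathrm F_{\mathfrak p}$ and $\mathbf i,\mathfrak l\in{}^*\mathbb Z$ be such that: (1) there are $\mathfrak m,\mathbf j\in{}^*\mathbb Z$ with $n\mid\mathfrak m$ for all standard $n\ge 1$, $\mathfrak m^2=\mathfrak l$, $\mathfrak m\mid\mathbf j$, $\mathbf j^2=\mathbf i$, $\mathbf i\mid\mathfrak p-1$, and moreover $\mathbf i\,\mathfrak l\mid\mathfrak p-1$; (2) for $\eta\in{}^*\mathbb Z$, $\epsilon^\eta=1$ in $\mathrm F_{\mathfrak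 p}$ if and only if $(\mathfrak p-1)\mid\eta$; (3) $\epsilon^{(\mathfrak p-1)/\mathbf i}$ is transcendental in $\mathrm F_{\mathfrak p}$ over the subring generated by the residue class of $\mathbf i$; (4) $\mathfrak l$ is finite-generic: every first-order formula $\Phi(x)$ in the language of rings with the parameters $\mathfrak p,\epsilon,\mathbf i$ that holds in ${}^*\mathbb Z$ at every $n\in\mathbb N$ holds at $\mathfrak l$. Put $\mathfrak u=\frac{\mathfrak p-1}{\mathbf i\mathfrak l}$, $\mathfrak v=\mathbf i\mathfrak u=\frac{\mathfrak p-1}{\mathfrak l}$, $\mathbb U={}^*\mathbb Z/(\mathfrak p-1)\mathfrak l$, and let $\exp_{\mathfrak p}:\mathbb U\to\mathrm F_{\mathfrak p}$ send the class of $\eta$ to $\epsilon^\eta$. Let $\pi'\in{}^*\mathbb R$ be represented by reals $\pi'_q$ ($q\in P$) with $\mathrm e^{\pi'_q}$ transcendental for $D$-almost all $q$ (that is, $\mathrm e^{\pi'}$ is transcendental in the sense of ${}^*\mathbb C$; e.g. $\pi'=\pi$). **Domains.** Let $\mathcal F$ be the set of functions $f:{}^*\mathbb Z\to{}^*\mathbb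 Z$ that are definable in the ring ${}^*\mathbb Z$ with the parameters $\mathfrak p,\epsilon,\mathbf i$ and satisfy $f(\mathbb N)\subseteq\mathbb N$. Put $\mathrm O(\mathcal F)=\bigcup_{f\in\mathcal F}{}^*\mathbb Z[-f(\mathfrak l):f(\mathfrak l)]$ and $\mathrm O(\mathfrak l)=\bigcup_{m\in\mathbb N}{}^*\mathbb Z[-m\mathfrak l:m\mathfrak l]$, and $$\mathbb U(\mathfrak l)=\{\alpha\mathfrak u+\beta\mathfrak v:\alpha,\beta\in\mathrm O(\mathfrak l)\}\subseteq\mathbb U,\qquad {}^*\mathbb C(\mathfrak l)=\{\tfrac{2\pi'}{\mathfrak l}\alpha+\tfrac{2\pi\sqrt{-1}}{\mathfrak l}\beta:\alpha,\beta\in\mathrm O(\mathfrak l)\}\subseteq{}^*\mathbb C.$$ An internal sum is a sum $\sum_{k\in K}x_k$ where $K\subseteq{}^*\mathbb Z[0:\mathfrak l^m]$ for some $m\in\mathbb N$ and where $K$ and the family $x$ are internal, i.e. given by finite sets $K_q$ and functions $x_q$ ($q\in P$) modulo $D$ (families in $\mathbb U$ or $\mathrm F_{\mathfrak p}$ through internal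 families of representatives in ${}^*\mathbb Z$); its value is given by the sums $\sum_{k\in K_q}x_q(k)$. Let $\mathrm O(\mathrm F)\subseteq\mathrm F_{\mathfrak p}$ and $\mathrm O({}^*\mathbb C)\subseteq{}^*\mathbb C$ be the sets of all internal sums $$\sum_{k\in K}a_k\exp_{\mathfrak p}(r_k\mathfrak u)\exp_{\mathfrak p}(s_k\mathfrak v)\quad\text{and}\quad\sum_{k\in K}a_k\,\mathrm e^{-2r_k\pi'/\mathfrak l}\,\mathrm e^{-2s_k\pi\sqrt{-1}/\mathfrak l}$$ respectively, where $a,r,s$ are internal sequences in ${}^*\mathbb Z$ with $a_k\in\mathrm O(\mathcal F)$, $r_k,s_k\in\mathrm O(\mathfrak l)$ for $k\in K$. **Theorem.** The assignments $$\mathrm I_{\mathbb U}:\ \alpha\mathfrak u+\beta\mathfrak v\mapsto-\tfrac1{\mathfrak l}(2\pi'\alpha+2\pi\sqrt{-1}\,\beta),\qquad \mathrm I_{\mathrm F}:\ \sum_{k\in K}a_k\exp_{\mathfrak p}(r_k\mathfrak u)\exp_{\mathfrak p}(s_k\mathfrak v)\mapsto\sum_{k\in K}a_k\,\mathrm e^{-2r_k\pi'/\mathfrak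 l}\,\mathrm e^{-2s_k\pi\sqrt{-1}/\mathfrak l}$$ (with $\alpha,\beta\in\mathrm O(\mathfrak l)$ and $K,a,r,s$ as above) are well defined and are bijections $\mathrm I_{\mathbb U}:\mathbb U(\mathfrak l)\to{}^*\mathbb C(\mathfrak l)$ and $\mathrm I_{\mathrm F}:\mathrm O(\mathrm F)\to\mathrm O({}^*\mathbb C)$. Both preserve internal summation: (a) if $(x_k)_{k\in K}$ is an internal family of elements of $\mathrm O(\mathrm F)$, then $\sum_K x_k\in\mathrm O(\mathrm F)$, the family $(\mathrm I_{\mathrm F}(x_k))_{k\in K}$ is internal, and $\mathrm I_{\mathrm F}(\sum_K x_k)=\sum_K\mathrm I_{\mathrm F}(x_k)$; (b) if $(x_k)_{k\in K}$ is an internal family of elements of $\mathbb U(\mathfrak l)$, then $(\mathrm I_{\mathbb U}(x_k))_{k\in K}$ is internal, and if $\sum_K\mathrm I_{\mathbb U}(x_k)\in{}^*\mathbb C(\mathfrak l)$, or if all the partial sums $\sum_{k\in K,\,k\le j}x_k$ $(j\in{}^*\mathbb Z)$ lie in $\mathbb U(\mathfrak l)$, then $\sum_K x_k\in\mathbb U(\mathfrak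 l)$ and $\mathrm I_{\mathbb U}(\sum_K x_k)=\sum_K\mathrm I_{\mathbb U}(x_k)$. Moreover $\exp_{\mathfrak p}$ maps $\mathbb U(\mathfrak l)$ to $\mathrm O(\mathrm F)$, $\exp$ maps ${}^*\mathbb C(\mathfrak l)$ to $\mathrm O({}^*\mathbb C)$, and $\mathrm I_{\mathrm F}(\exp_{\mathfrak p}(x))=\exp(\mathrm I_{\mathbb U}(x))$ for all $x\in\mathbb U(\mathfrak l)$. -/

import Mathlib

open Filter

noncomputable section

namespace PseudoFinite

/-- The ultrapower `X^P / D`, where `P` is the set of prime numbers. -/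
abbrev NS (D : Ultrafilter Nat.Primes) (X : Type) : Type := (D : Filter Nat.Primes).Germ X

variable {D : Ultrafilter Nat.Primes}

/-! ### Internal functions, internal (hyper)finite sets and internal sums -/

/-- The value at `k ∈ *ℤ` of the internal function on `*ℤ` given by a germ of functions. -/
def iapp {X : Type} (f : NS D (ℤ → X)) (k : NS D ℤ) : NS D X :=
  Germ.map₂ (fun g n => g n) f k

/-- Membership in the internal hyperfinite subset of `*ℤ` given by a germ of finite sets. -/
def IMem (k : NS D ℤ) (K : NS D (Finset ℤ)) : Prop :=
  Germ.LiftRel (fun n s => n ∈ s) k K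

/-- The sum of an internal function over an internal hyperfinite set. -/
def isum {X : Type} [AddCommMonoid X] (K : NS D (Finset ℤ)) (f : NS D (ℤ → X)) : NS D X :=
  Germ.map₂ (fun s g => ∑ n ∈ s, g n) K f

/-- `K ∩ {k | k ≤ j}`. -/
def initial (K : NS D (Finset ℤ)) (j : NS D ℤ) : NS D (Finset ℤ) :=
  Germ.map₂ (fun s n => s.filter (fun t => t ≤ n)) K j

/-- `K ⊆ *ℤ[0 : l^m]`. -/
def IsIndexSet (l : NS D ℤ) (m : ℕ) (K : NS D (Finset ℤ)) : Prop :=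
  ∀ k, IMem k K → 0 ≤ k ∧ k ≤ l ^ m

/-- The quotient ring `*ℤ / N`. -/
abbrev Quo (N : NS D ℤ) : Type := NS D ℤ ⧸ Ideal.span {N}

/-- The residue class in `*ℤ / N`. -/
abbrev cls (N : NS D ℤ) (x : NS D ℤ) : Quo N := Ideal.Quotient.mk (Ideal.span {N}) x

/-- The family `(x k)_{k ∈ K}` of elements of `*ℤ / N` is internal, and `y` is its internal sum. -/
def HasSumMod {N : NS D ℤ} (K : NS D (Finset ℤ)) (x : NS D ℤ → Quo N) (y : Quo N) : Prop :=
  ∃ X : NS D (ℤ → ℤ), (∀ k, IMem k K → cls N (iapp X k) = x k) ∧ cls N (isum K X) = y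

/-- The family `(x k)_{k ∈ K}` of elements of `*ℂ` is internal, and `y` is its internal sum. -/
def HasSumC (K : NS D (Finset ℤ)) (x : NS D ℤ → NS D ℂ) (y : NS D ℂ) : Prop :=
  ∃ X : NS D (ℤ → ℂ), (∀ k, IMem k K → iapp X k = x k) ∧ isum K X = y

/-! ### Definability in `(*ℤ; +, ·, A)` -/

/-- `S ⊆ *ℤ` is first-order definable in the ring `*ℤ` with parameters from `A`. -/
def DefSet (A : Set (NS D ℤ)) (S : Set (NS D ℤ)) : Prop :=
  letI := FirstOrder.Ring.compatibleRingOfRing (NS D ℤ)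
  A.Definable₁ FirstOrder.Language.ring S

/-- `f : *ℤ → *ℤ` is first-order definable in the ring `*ℤ` with parameters from `A`. -/
def DefFun (A : Set (NS D ℤ)) (f : NS D ℤ → NS D ℤ) : Prop :=
  letI := FirstOrder.Ring.compatibleRingOfRing (NS D ℤ)
  A.Definable₂ FirstOrder.Language.ring {z : NS D ℤ × NS D ℤ | f z.1 = z.2}

/-- `l` is finite-generic over `A`: it satisfies every formula in one variable over `A` that holds
at all standard natural numbers. -/
def FiniteGeneric (A : Set (NS D ℤ)) (l : NS D ℤ) : Prop :=
  ∀ S : Set (NS D ℤ), DefSet A S → (∀ n : ℕ, (n : NS D ℤ) ∈ S) → l ∈ S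

/-- The definable functions that map `ℕ` to `ℕ`. -/
def DefFunNat (A : Set (NS D ℤ)) : Set (NS D ℤ → NS D ℤ) :=
  {f | DefFun A f ∧ ∀ n : ℕ, ∃ k : ℕ, f n = k}

/-- The union of the intervals `*ℤ[-f(l) : f(l)]` over definable `f` with `f(ℕ) ⊆ ℕ`. -/
def OFun (A : Set (NS D ℤ)) (l : NS D ℤ) : Set (NS D ℤ) :=
  {a | ∃ f ∈ DefFunNat A, -f l ≤ a ∧ a ≤ f l}

/-- The union of the intervals `*ℤ[-ml : ml]` over standard `m`. -/
def OLin (l : NS D ℤ) : Set (NS D ℤ) :=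
  {a | ∃ m : ℕ, -(m * l) ≤ a ∧ a ≤ m * l}

/-! ### Exponentiation in `F_p = *ℤ / p` -/

/-- Internal power in `*ℤ`; for a negative exponent the value is `1`. -/
def npow (e n : NS D ℤ) : NS D ℤ := Germ.map₂ (fun a k => a ^ k.toNat) e n

/-- `e ^ η` in `F_p` for `η ∈ *ℤ`, where `e` is invertible modulo `p`
(one of the two factors is always `1`). -/
def zpowF (p e η : NS D ℤ) : Quo p := cls p (npow e η) * Ring.inverse (cls p (npow e (-η)))

/-- `exp_p : U = *ℤ / (p-1)l → F_p`, sending the class of `η` to `e ^ η`. -/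
def expF (p e l : NS D ℤ) (x : Quo ((p - 1) * l)) : Quo p := zpowF p e (Quotient.out x)

/-- The standing assumptions on the parameters `p, ε, i, l`, and on `u = (p-1)/(i l)`. -/
structure IsScale (p e i l u : NS D ℤ) : Prop where
  pos : 0 < p
  prime : Prime p
  eps_nonneg : 0 ≤ e
  eps_lt : e < p
  /-- `u` is the quotient `(p - 1) / (i l)`. -/
  unit : i * l * u = p - 1
  divisible : ∃ m j : NS D ℤ, (∀ n : ℕ, 0 < n → (n : NS D ℤ) ∣ m) ∧ m ^ 2 = l ∧ m ∣ j ∧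
    j ^ 2 = i ∧ i ∣ p - 1
  order : ∀ η : NS D ℤ, zpowF p e η = 1 ↔ p - 1 ∣ η
  /-- `ε ^ ((p - 1) / i)` is transcendental over the image of `i` in `F_p`;
  note that `(p - 1) / i = l * u`. -/
  transcendental : Transcendental (Algebra.adjoin ℤ {cls p i}) (zpowF p e (l * u))
  generic : FiniteGeneric {p, e, i} l

/-! `expF` does not depend on the choice of representatives. -/

theorem npow_mul_npow (a b n : NS D ℤ) : npow a n * npow b n = npow (a * b) n := by
  induction a using Germ.inductionOn
  induction b using Germ.inductionOn
  induction n using Germ.inductionOn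
  exact congrArg Germ.ofFun (funext fun q => (mul_pow _ _ _).symm)

theorem sub_one_dvd_npow_sub_one (a n : NS D ℤ) : a - 1 ∣ npow a n - 1 := by
  induction a using Germ.inductionOn with | _ a
  induction n using Germ.inductionOn with | _ n
  have H : ∀ q, ∃ c, a q ^ (n q).toNat - 1 = (a q - 1) * c := fun q => by
    have := sub_dvd_pow_sub_pow (a q) 1 (n q).toNat
    rwa [one_pow] at this
  choose c hc using H
  exact ⟨(c : NS D ℤ), congrArg Germ.ofFun (funext hc)⟩

theorem npow_add_aux (e a b : NS D ℤ) :
    npow e (a + b) * (npow e (-a) * npow e (-b)) =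
      npow e (-(a + b)) * (npow e a * npow e b) := by
  induction e using Germ.inductionOn with | _ e
  induction a using Germ.inductionOn with | _ a
  induction b using Germ.inductionOn with | _ b
  refine congrArg Germ.ofFun (funext fun q => ?_)
  change e q ^ (a q + b q).toNat * (e q ^ (-a q).toNat * e q ^ (-b q).toNat) =
    e q ^ (-(a q + b q)).toNat * (e q ^ (a q).toNat * e q ^ (b q).toNat)
  rw [← pow_add, ← pow_add, ← pow_add, ← pow_add]
  congr 1
  omega

theorem npow_of_nonpos (e n : NS D ℤ) (hn : n ≤ 0) : npow e n = 1 := by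
  induction e using Germ.inductionOn with | _ e
  induction n using Germ.inductionOn with | _ n
  have hn' : ∀ᶠ q in (D : Filter Nat.Primes), n q ≤ 0 := hn
  refine Germ.coe_eq.2 (hn'.mono fun q hq => ?_)
  change e q ^ (n q).toNat = 1
  rw [Int.toNat_of_nonpos hq, pow_zero]

theorem npow_of_pos (e n : NS D ℤ) (hn : 0 < n) : npow e n = e * npow e (n - 1) := by
  induction e using Germ.inductionOn with | _ e
  induction n using Germ.inductionOn with | _ n
  have hn' : ∀ᶠ q in (D : Filter Nat.Primes), 0 < n q := Germ.coe_lt.1 hn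
  refine Germ.coe_eq.2 (hn'.mono fun q hq => ?_)
  change e q ^ (n q).toNat = e q * e q ^ (n q - 1).toNat
  rw [← pow_succ']
  congr 1
  omega

theorem expF_cls {p e i l u : NS D ℤ} (h : IsScale p e i l u) (η : NS D ℤ) :
    expF p e l (cls _ η) = zpowF p e η := by
  have hp1 : 0 < p - 1 := by
    have h1 : p ≠ 1 := fun h1 => h.prime.not_isUnit (h1 ▸ isUnit_one)
    have h2 : p - 1 ≠ 0 := sub_ne_zero.2 h1
    have h3 : (1 : NS D ℤ) ≤ p := by
      have := h.pos
      obtain ⟨p, rfl⟩ := Quotient.exists_rep p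
      exact (Germ.coe_lt.1 this).mono fun q hq => hq
    exact lt_of_le_of_ne (sub_nonneg.2 h3) h2.symm
  have hone : cls p (npow e (p - 1)) = 1 := by
    have := (h.order (p - 1)).2 dvd_rfl
    rwa [zpowF, npow_of_nonpos e (-(p - 1)) (by linarith),
      show cls p 1 = 1 from map_one _, Ring.inverse_one, mul_one] at this
  have hu : ∀ n, IsUnit (cls p (npow e n)) := by
    intro n
    rw [npow_of_pos e _ hp1, ← sub_eq_zero, ← map_one (Ideal.Quotient.mk _), ← map_sub,
      Ideal.Quotient.eq_zero_iff_mem, Ideal.mem_span_singleton] at hone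
    have h2 := hone.trans (sub_one_dvd_npow_sub_one _ n)
    rw [← npow_mul_npow, ← Ideal.mem_span_singleton, ← Ideal.Quotient.eq_zero_iff_mem, map_sub,
      map_one, sub_eq_zero, map_mul] at h2
    exact IsUnit.of_mul_eq_one _ h2
  have hadd : ∀ a b, zpowF p e (a + b) = zpowF p e a * zpowF p e b := by
    intro a b
    have h1 : cls p (npow e (a + b)) * (cls p (npow e (-a)) * cls p (npow e (-b))) =
        cls p (npow e (-(a + b))) * (cls p (npow e a) * cls p (npow e b)) := by
      simpa only [map_mul] using congrArg (cls p) (npow_add_aux e a b)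
    have e1 := Ring.mul_inverse_cancel _ (hu (-a))
    have e2 := Ring.mul_inverse_cancel _ (hu (-b))
    have e3 := Ring.mul_inverse_cancel _ (hu (-(a + b)))
    simp only [zpowF]
    generalize cls p (npow e (a + b)) = x at *
    generalize cls p (npow e (-(a + b))) = x' at *
    generalize cls p (npow e (-a)) = a' at *
    generalize cls p (npow e (-b)) = b' at *
    generalize cls p (npow e a) = a1 at *
    generalize cls p (npow e b) = b1 at *
    linear_combination (Ring.inverse x' * Ring.inverse a' * Ring.inverse b') * h1 +
      a1 * b1 * Ring.inverse a' * Ring.inverse b' * e3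
      - x * Ring.inverse x' * (e1 * b' * Ring.inverse b' + e2)
  have hmem : Quotient.out (cls ((p - 1) * l) η) - η ∈ Ideal.span {(p - 1) * l} := by
    rw [← Ideal.Quotient.eq]
    exact Quotient.out_eq _
  have h0 : zpowF p e (Quotient.out (cls ((p - 1) * l) η) - η) = 1 :=
    (h.order _).2 ((dvd_mul_right _ _).trans (Ideal.mem_span_singleton.1 hmem))
  have := hadd (Quotient.out (cls ((p - 1) * l) η) - η) η
  rwa [h0, one_mul, sub_add_cancel] at this

/-! ### The domains and the ranges of the two maps -/

/-- `*ℤ → *ℂ`. -/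
def toC (a : NS D ℤ) : NS D ℂ := Germ.map (fun n : ℤ => (n : ℂ)) a

/-- `*ℝ → *ℂ`. -/
def realToC (a : NS D ℝ) : NS D ℂ := Germ.map (fun t : ℝ => (t : ℂ)) a

/-- The complex exponential on `*ℂ`. -/
def expC (z : NS D ℂ) : NS D ℂ := Germ.map Complex.exp z

/-- `2πi / l` in `*ℂ`. -/
def periodIm (l : NS D ℤ) : NS D ℂ :=
  ((2 * Real.pi * Complex.I : ℂ) : NS D ℂ) / toC l

/-- `2π' / l` in `*ℂ`. -/
def periodRe (l : NS D ℤ) (π' : NS D ℝ) : NS D ℂ := 2 * realToC π' / toC l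

/-- `α u + β v` in `U`, where `v = i u`. -/
def combU (p i l u α β : NS D ℤ) : Quo ((p - 1) * l) := cls _ (α * u + β * (i * u))

/-- `U(l)`. -/
def UL (p i l u : NS D ℤ) : Set (Quo ((p - 1) * l)) :=
  {x | ∃ α ∈ OLin l, ∃ β ∈ OLin l, x = combU p i l u α β}

/-- `*ℂ(l)`. -/
def CL (l : NS D ℤ) (π' : NS D ℝ) : Set (NS D ℂ) :=
  {z | ∃ α ∈ OLin l, ∃ β ∈ OLin l, z = toC α * periodRe l π' + toC β * periodIm l}

/-- The term `a · exp_p(r u) · exp_p(s v)` of `F_p`. -/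
def termF (p e i l u a r s : NS D ℤ) : Quo p :=
  cls p a * expF p e l (cls _ (r * u)) * expF p e l (cls _ (s * (i * u)))

/-- The term `a · e^{-2rπ'/l} · e^{-2sπi/l}` of `*ℂ`. -/
def termC (l : NS D ℤ) (π' : NS D ℝ) (a r s : NS D ℤ) : NS D ℂ :=
  toC a * expC (-(toC r * periodRe l π')) * expC (-(toC s * periodIm l))

/-- Admissible data of an expression `∑_{k ∈ K} a_k exp(r_k u) exp(s_k v)`: `K ⊆ *ℤ[0 : l^m]` is
internal and `a`, `r`, `s` are internal sequences with `a_k ∈ O(ℱ)` and `r_k, s_k ∈ O(l)`. -/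
def IsExpr (A : Set (NS D ℤ)) (l : NS D ℤ) (K : NS D (Finset ℤ)) (a r s : NS D (ℤ → ℤ)) : Prop :=
  (∃ m : ℕ, IsIndexSet l m K) ∧
    ∀ k, IMem k K → iapp a k ∈ OFun A l ∧ iapp r k ∈ OLin l ∧ iapp s k ∈ OLin l

/-- The expression given by `(K, a, r, s)` has the value `y` in `F_p`. -/
def ValF (p e i l u : NS D ℤ) (K : NS D (Finset ℤ)) (a r s : NS D (ℤ → ℤ)) (y : Quo p) : Prop :=
  HasSumMod K (fun k => termF p e i l u (iapp a k) (iapp r k) (iapp s k)) y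

/-- The expression given by `(K, a, r, s)` has the value `z` in `*ℂ`. -/
def ValC (l : NS D ℤ) (π' : NS D ℝ) (K : NS D (Finset ℤ)) (a r s : NS D (ℤ → ℤ))
    (z : NS D ℂ) : Prop :=
  HasSumC K (fun k => termC l π' (iapp a k) (iapp r k) (iapp s k)) z

/-- `O(F)`. -/
def OF (p e i l u : NS D ℤ) : Set (Quo p) :=
  {y | ∃ K a r s, IsExpr {p, e, i} l K a r s ∧ ValF p e i l u K a r s y}

/-- `O(*ℂ)`. -/
def OC (p e i l : NS D ℤ) (π' : NS D ℝ) : Set (NS D ℂ) :=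
  {z | ∃ K a r s, IsExpr {p, e, i} l K a r s ∧ ValC l π' K a r s z}

end PseudoFinite

end

open Filter

noncomputable section

namespace PseudoFinite

variable {D : Ultrafilter Nat.Primes}

/-! ### Transfer of first-order relations from `ℤ` to the ultrapower -/

section Definability

open FirstOrder Set

attribute [local instance] FirstOrder.Ring.compatibleRingOfRing

variable {ι κ : Type} {A : Set (NS D ℤ)}

/-! At almost every index the parameters are ordinary integers: `p` is prime, `e` is a primitive
root modulo `p`, and `p - 1 = i * l * u` (`IsScale.eventually_localScale`). So `z = e ^ (i * u)` is
a primitive `l`-th root of unity modulo `p`, matching `ω = exp (-2πi/l)` in `ℂ`, while `x = e ^ u`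
matches the transcendental number `exp (-2π'/l)`. Grouping terms with equal `r` and with `s` equal
modulo `l` turns an exponential sum into a polynomial in `x` and `z` with integer coefficients, up
to a power of `x`; the same coefficients serve on both sides. The heart of the matter is that such a
polynomial vanishes modulo `p` exactly when it vanishes in `ℂ` (`LocalScale.dvd_valZ_nf_iff`).

If it vanishes in `ℂ`, transcendence makes every coefficient of a power of `exp (-2π'/l)` vanish.
Each such coefficient is an integer polynomial at `ω`, hence a multiple of the cyclotomic
polynomial, and so it vanishes at `z` too. If it does not vanish in `ℂ`, the resultant with the
cyclotomic polynomial eliminates the root of unity and leaves a nonzero integer polynomial in one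
variable with explicitly bounded degree and coefficients (`annihilated_of_sum_eq_zero`). Vanishing
modulo `p` would make `x` a root of it modulo `p`.

Genericity excludes this. For standard `n`, the element `e ^ ((p - 1) / (i * n))`, if it exists, has
the transcendental `n`-th power `e ^ ((p - 1) / i)`, so it is a root of no nonzero polynomial of
standard size. "No root of a nonzero polynomial of size `f x`" is a first-order condition on `x`, by
Gödel's beta function; it therefore passes from the standard `n` to `l`
(`IsScale.eventually_not_annihilated`). The resultant bound is itself of the form `f l`, because
`O(ℱ)` is closed under sums, products and powers.

Applied to the difference of two expressions, this makes the map on `O(F)` well defined and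
injective (`IsScale.valZ_congr_iff`). For internal sums, the summands are given a common index set
and common exponents, after which coefficients are simply added (`IsScale.exists_uniform_expr`).

For `U(l)`, genericity also gives `l ^ 2 < i`, so coordinates below `l ^ 2 / 2` are determined by
the class of `α * u + β * i * u` modulo `(p - 1) * l` (`IsScale.combU_injective`). Partial sums that
stay in `U(l)` cannot leap from coordinates of order `l` past the range of uniqueness, since each
step changes them by `O(l)` (`IsScale.sums_mem_OLin_of_partial_sums`). -/

theorem definable_exists {P : (ι → NS D ℤ) → NS D ℤ → Prop}
    (h : A.Definable Language.ring {w : Option ι → NS D ℤ | P (fun j => w (some j)) (w none)}) :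
    A.Definable Language.ring {v : ι → NS D ℤ | ∃ x, P v x} := by
  have h1 := (h.preimage_comp (fun o : Option ι => o.elim (Sum.inr ()) (Sum.inl : ι → ι ⊕ Unit)))
  convert h1.exists_of_finite using 1
  ext v
  constructor
  · rintro ⟨x, hx⟩
    exact ⟨fun _ => x, hx⟩
  · rintro ⟨x, hx⟩
    exact ⟨x (), hx⟩

theorem definableFun_comp₂ {F : NS D ℤ → NS D ℤ → NS D ℤ}
    (hF : A.DefinableFun Language.ring (fun v : Fin 2 → NS D ℤ => F (v 0) (v 1)))
    {f g : (ι → NS D ℤ) → NS D ℤ} (hf : A.DefinableFun Language.ring f)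
    (hg : A.DefinableFun Language.ring g) :
    A.DefinableFun Language.ring (fun v => F (f v) (g v)) := by
  have hm : A.DefinableMap Language.ring (fun v => ![f v, g v]) := by
    intro j
    fin_cases j
    · exact hf
    · exact hg
  exact DefinableFun.comp hm hF

theorem definableFun_add {f g : (ι → NS D ℤ) → NS D ℤ} (hf : A.DefinableFun Language.ring f)
    (hg : A.DefinableFun Language.ring g) :
    A.DefinableFun Language.ring (fun v => f v + g v) := by
  refine definableFun_comp₂ (F := (· + ·)) (Set.DefinableFun.of_empty ?_) hf hg
  convert (Language.var 0 + Language.var 1 :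
    Language.ring.Term (Fin 2)).definableFun_realize (M := NS D ℤ) using 2
  simp

theorem definableFun_mul {f g : (ι → NS D ℤ) → NS D ℤ} (hf : A.DefinableFun Language.ring f)
    (hg : A.DefinableFun Language.ring g) :
    A.DefinableFun Language.ring (fun v => f v * g v) := by
  refine definableFun_comp₂ (F := (· * ·)) (Set.DefinableFun.of_empty ?_) hf hg
  convert (Language.var 0 * Language.var 1 :
    Language.ring.Term (Fin 2)).definableFun_realize (M := NS D ℤ) using 2
  simp

theorem definableFun_intCast (n : ℤ) :
    A.DefinableFun Language.ring (fun _ : ι → NS D ℤ => (n : NS D ℤ)) := by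
  have hone : A.DefinableFun Language.ring (fun _ : ι → NS D ℤ => (1 : NS D ℤ)) := by
    refine Set.DefinableFun.of_empty ?_
    convert (1 : Language.ring.Term ι).definableFun_realize (M := NS D ℤ) using 2
    simp
  have hnegone : A.DefinableFun Language.ring (fun _ : ι → NS D ℤ => (-1 : NS D ℤ)) := by
    refine Set.DefinableFun.of_empty ?_
    convert (-1 : Language.ring.Term ι).definableFun_realize (M := NS D ℤ) using 2
    simp
  induction n using Int.induction_on with
  | zero =>
    refine Set.DefinableFun.of_empty ?_
    convert (0 : Language.ring.Term ι).definableFun_realize (M := NS D ℤ) using 2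
    simp
  | succ k ih => simpa using definableFun_add ih hone
  | pred k ih => simpa [sub_eq_add_neg] using definableFun_add ih hnegone

/-- A representative of an element of an ultrapower. -/
def rep {X : Type} (x : NS D X) : Nat.Primes → X := Quotient.out (s := germSetoid _ _) x

theorem coe_rep {X : Type} (x : NS D X) : ((rep x : Nat.Primes → X) : NS D X) = x :=
  Quotient.out_eq (s := germSetoid _ _) x

theorem rep_coe {X : Type} (f : Nat.Primes → X) :
    ∀ᶠ q in (D : Filter Nat.Primes), rep (f : NS D X) q = f q :=
  Germ.coe_eq.1 (coe_rep (f : NS D X))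

/-- The extension of a relation on `ℤ` to `*ℤ`. -/
def StarRel (R : (ι → ℤ) → Prop) (v : ι → NS D ℤ) : Prop :=
  ∀ᶠ q in (D : Filter Nat.Primes), R (fun j => rep (v j) q)

/-- The extension of a function on `ℤ` to `*ℤ`. -/
def starFun (f : (ι → ℤ) → ℤ) (v : ι → NS D ℤ) : NS D ℤ :=
  ((fun q => f (fun j => rep (v j) q) : Nat.Primes → ℤ) : NS D ℤ)

theorem starRel_coe [Finite ι] (R : (ι → ℤ) → Prop) (v : ι → Nat.Primes → ℤ) :
    StarRel R (fun j => (v j : NS D ℤ)) ↔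
      ∀ᶠ q in (D : Filter Nat.Primes), R (fun j => v j q) := by
  have h : ∀ᶠ q in (D : Filter Nat.Primes), ∀ j, rep (v j : NS D ℤ) q = v j q :=
    eventually_all.2 fun j => rep_coe (v j)
  exact eventually_congr (h.mono fun q hq => by simp only [hq])

theorem starFun_coe [Finite ι] (f : (ι → ℤ) → ℤ) (v : ι → Nat.Primes → ℤ) :
    starFun f (fun j => (v j : NS D ℤ)) =
      ((fun q => f (fun j => v j q) : Nat.Primes → ℤ) : NS D ℤ) := by
  have h : ∀ᶠ q in (D : Filter Nat.Primes), ∀ j, rep (v j : NS D ℤ) q = v j q :=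
    eventually_all.2 fun j => rep_coe (v j)
  exact Germ.coe_eq.2 (h.mono fun q hq => by simp only [hq])

variable (D) in
/-- The extension of the relation `R` to `*ℤ` is definable without parameters. -/
def StarDef (R : (ι → ℤ) → Prop) : Prop :=
  (∅ : Set (NS D ℤ)).Definable Language.ring {v : ι → NS D ℤ | StarRel R v}

variable (D) in
/-- The extension of the function `f` to `*ℤ` is definable without parameters. -/
def StarDefFun (f : (ι → ℤ) → ℤ) : Prop :=
  (∅ : Set (NS D ℤ)).DefinableFun Language.ring (starFun (D := D) f)

theorem StarDef.and {R S : (ι → ℤ) → Prop} (hR : StarDef D R) (hS : StarDef D S) :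
    StarDef D (fun v => R v ∧ S v) := by
  unfold StarDef
  convert Definable.inter hR hS using 1
  ext v
  exact eventually_and

theorem StarDef.not {R : (ι → ℤ) → Prop} (hR : StarDef D R) : StarDef D (fun v => ¬ R v) := by
  unfold StarDef
  convert Definable.compl hR using 1
  ext v
  exact Ultrafilter.eventually_not

theorem StarDef.or {R S : (ι → ℤ) → Prop} (hR : StarDef D R) (hS : StarDef D S) :
    StarDef D (fun v => R v ∨ S v) := by
  unfold StarDef
  convert Definable.union hR hS using 1
  ext v
  exact Ultrafilter.eventually_or

theorem StarDef.imp {R S : (ι → ℤ) → Prop} (hR : StarDef D R) (hS : StarDef D S) :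
    StarDef D (fun v => R v → S v) := by
  simpa only [imp_iff_not_or] using hR.not.or hS

/-- The quantifier step of Łoś's theorem: witnesses chosen index by index form one element of the
ultrapower. -/
theorem StarDef.exists {P : (ι → ℤ) → ℤ → Prop}
    (h : StarDef D (fun w : Option ι → ℤ => P (fun j => w (some j)) (w none))) :
    StarDef D (fun v => ∃ x, P v x) := by
  unfold StarDef
  convert definable_exists (P := fun v x => ∀ᶠ q in (D : Filter Nat.Primes),
    P (fun j => rep (v j) q) (rep x q)) h using 1
  ext v
  constructor
  · intro hv
    obtain ⟨x, hx⟩ := hv.choice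
    exact ⟨(x : NS D ℤ), hx.mp ((rep_coe x).mono fun q h1 h2 => by rwa [h1])⟩
  · rintro ⟨x, hx⟩
    exact hx.mono fun q hq => ⟨_, hq⟩

theorem StarDef.forall {P : (ι → ℤ) → ℤ → Prop}
    (h : StarDef D (fun w : Option ι → ℤ => P (fun j => w (some j)) (w none))) :
    StarDef D (fun v => ∀ x, P v x) := by
  simpa only [not_exists, not_not] using (StarDef.exists (P := fun v x => ¬ P v x) h.not).not

theorem StarDef.comp [Finite κ] {R : (κ → ℤ) → Prop} (hR : StarDef D R)
    {f : κ → (ι → ℤ) → ℤ} (hf : ∀ j, StarDefFun D (f j)) :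
    StarDef D (fun v => R (fun j => f j v)) := by
  unfold StarDef
  convert Definable.preimage_map (F := fun v j => starFun (f j) v) hf hR using 1
  ext v
  exact (starRel_coe R _).symm

theorem StarDefFun.var (j : ι) : StarDefFun D (fun v => v j) := by
  unfold StarDefFun
  convert Language.definableFun_var Language.ring (M := NS D ℤ) j using 2 with v
  exact coe_rep (v j)

theorem StarDefFun.const (n : ℤ) : StarDefFun D (fun _ : ι → ℤ => n) :=
  definableFun_intCast (D := D) (A := ∅) (ι := ι) n

theorem StarDefFun.add {f g : (ι → ℤ) → ℤ} (hf : StarDefFun D f) (hg : StarDefFun D g) :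
    StarDefFun D (fun v => f v + g v) := definableFun_add hf hg

theorem StarDefFun.mul {f g : (ι → ℤ) → ℤ} (hf : StarDefFun D f) (hg : StarDefFun D g) :
    StarDefFun D (fun v => f v * g v) := definableFun_mul hf hg

theorem StarDefFun.neg {f : (ι → ℤ) → ℤ} (hf : StarDefFun D f) :
    StarDefFun D (fun v => - f v) := by
  simpa using (StarDefFun.const (-1)).mul hf

theorem StarDefFun.sub {f g : (ι → ℤ) → ℤ} (hf : StarDefFun D f) (hg : StarDefFun D g) :
    StarDefFun D (fun v => f v - g v) := by
  simpa only [sub_eq_add_neg] using hf.add hg.neg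

theorem StarDef.eq {f g : (ι → ℤ) → ℤ} (hf : StarDefFun D f) (hg : StarDefFun D g) :
    StarDef D (fun v => f v = g v) := by
  unfold StarDef
  convert DefinableFun.ofPred_eq hf hg using 1
  ext v
  exact Germ.coe_eq.symm

theorem StarDefFun.of_graph {f : (ι → ℤ) → ℤ}
    (h : StarDef D (fun w : Option ι → ℤ => f (fun j => w (some j)) = w none)) :
    StarDefFun D f := by
  unfold StarDefFun DefinableFun
  unfold StarDef at h
  convert h using 1
  ext w
  change ((_ : Nat.Primes → ℤ) : NS D ℤ) = w none ↔ _
  conv_lhs => rw [← coe_rep (w none)]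
  exact Germ.coe_eq

/-- The ring language has no order symbol; by Lagrange's theorem the nonnegative integers are the
sums of four squares. -/
theorem StarDef.le {f g : (ι → ℤ) → ℤ} (hf : StarDefFun D f) (hg : StarDefFun D g) :
    StarDef D (fun v => f v ≤ g v) := by
  have h : StarDef D (fun v : Fin 2 → ℤ => v 0 ≤ v 1) := by
    have : (fun v : Fin 2 → ℤ => v 0 ≤ v 1) =
        fun v => ∃ a b c d, v 0 + (a * a + b * b + (c * c + d * d)) = v 1 := by
      funext v
      refine propext ⟨fun hv => ?_, ?_⟩
      · obtain ⟨a, b, c, d, h⟩ := Nat.sum_four_squares (v 1 - v 0).toNat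
        refine ⟨a, b, c, d, ?_⟩
        zify at h
        rw [Int.toNat_of_nonneg (by omega)] at h
        linarith
      · rintro ⟨a, b, c, d, h⟩
        nlinarith
    rw [this]
    have hv : ∀ j : Option (Option (Option (Option (Fin 2)))),
        StarDefFun D (fun v : Option (Option (Option (Option (Fin 2)))) → ℤ => v j) :=
      StarDefFun.var
    exact .exists <| .exists <| .exists <| .exists <| .eq
      ((hv _).add ((((hv _).mul (hv _)).add ((hv _).mul (hv _))).add
        (((hv _).mul (hv _)).add ((hv _).mul (hv _))))) (hv _)
  exact h.comp (f := ![f, g]) fun j => by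
    fin_cases j
    · exact hf
    · exact hg

theorem StarDef.lt {f g : (ι → ℤ) → ℤ} (hf : StarDefFun D f) (hg : StarDefFun D g) :
    StarDef D (fun v => f v < g v) := by
  simpa only [not_le] using (StarDef.le hg hf).not

theorem StarDef.dvd {f g : (ι → ℤ) → ℤ} (hf : StarDefFun D f) (hg : StarDefFun D g) :
    StarDef D (fun v => f v ∣ g v) := by
  have h : StarDef D (fun v : Fin 2 → ℤ => ∃ c, v 1 = v 0 * c) :=
    .exists (.eq (.var _) (.mul (.var (some 0)) (.var _)))
  exact h.comp (f := ![f, g]) fun j => by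
    fin_cases j
    · exact hf
    · exact hg

theorem StarDefFun.comp [Finite κ] {F : (κ → ℤ) → ℤ} (hF : StarDefFun D F)
    {f : κ → (ι → ℤ) → ℤ} (hf : ∀ j, StarDefFun D (f j)) :
    StarDefFun D (fun v => F (fun j => f j v)) := by
  unfold StarDefFun
  convert DefinableFun.comp (g := fun v j => starFun (f j) v) hf hF using 2 with v
  exact (starFun_coe F _).symm

theorem StarDefFun.emod {f g : (ι → ℤ) → ℤ} (hf : StarDefFun D f) (hg : StarDefFun D g) :
    StarDefFun D (fun v => f v % g v) := by
  have h : StarDefFun D (fun v : Fin 2 → ℤ => v 0 % v 1) := by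
    refine .of_graph ?_
    -- For a zero modulus the convention is `a % 0 = a`, which is what divisibility of the
    -- difference by `0` says. The final disjunction expresses that the remainder is below the
    -- absolute value of the modulus.
    have : (fun w : Option (Fin 2) → ℤ => w (some 0) % w (some 1) = w none) =
        fun w => w (some 1) ∣ w (some 0) - w none ∧ ((w (some 1) = 0 ∨
          (0 ≤ w none ∧ (w none < w (some 1) ∨ w none < - w (some 1))))) := by
      funext w
      generalize w (some 0) = a
      generalize w (some 1) = b
      generalize w none = c
      refine propext ⟨?_, ?_⟩
      · rintro rfl
        refine ⟨Int.dvd_self_sub_emod, ?_⟩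
        by_cases hb : b = 0
        · exact Or.inl hb
        · have h1 := Int.emod_nonneg a hb
          have h2 := Int.emod_lt_abs a hb
          rcases abs_choice b with h | h <;> rw [h] at h2 <;> tauto
      · rintro ⟨⟨k, hk⟩, hb | ⟨h0, hb⟩⟩
        · subst hb
          simp only [Int.emod_zero]
          linarith
        · have : a = c + b * k := by linarith
          rw [this, Int.add_mul_emod_self_left]
          rcases hb with hb | hb
          · exact Int.emod_eq_of_lt h0 hb
          · rw [← Int.emod_neg]
            exact Int.emod_eq_of_lt h0 hb
    rw [this]
    exact (StarDef.dvd (.var _) (.sub (.var _) (.var _))).and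
      ((StarDef.eq (.var _) (.const 0)).or ((StarDef.le (.const 0) (.var _)).and
        ((StarDef.lt (.var _) (.var _)).or (StarDef.lt (.var _) (.neg (.var _))))))
  exact h.comp (f := ![f, g]) fun j => by
    fin_cases j
    · exact hf
    · exact hg

end Definability

/-! ### Coding of powers and of polynomial relations by Gödel's beta function -/

section Arithmetic

open Polynomial

/-- Every finite sequence of natural numbers is coded by a pair of integers. -/
theorem exists_beta (h : ℕ → ℕ) (d : ℕ) :
    ∃ a b : ℤ, ∀ j : ℕ, j ≤ d → a % (((j : ℤ) + 1) * b + 1) = h j := by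
  set L : List ℕ := (List.range (d + 1)).map h with hL
  refine ⟨(Nat.unbeta L).unpair.1, (Nat.unbeta L).unpair.2, fun j hj => ?_⟩
  have hlen : j < L.length := by simp [hL]; omega
  have := Nat.beta_unbeta_coe L ⟨j, hlen⟩
  simp only [Nat.beta, hL, Fin.getElem_fin, List.getElem_map, List.getElem_range] at this
  rw [← hL] at this
  exact_mod_cast this

/-- The sequence of successive powers is coded by one pair `a, b`, and the formula checks its
initial value, its recursion and its last entry. -/
theorem starDef_pow : StarDef D
    (fun v : Fin 3 → ℤ => 0 ≤ v 0 ∧ 0 ≤ v 1 ∧ v 0 ^ (v 1).toNat = v 2) := by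
  have : (fun v : Fin 3 → ℤ => 0 ≤ v 0 ∧ 0 ≤ v 1 ∧ v 0 ^ (v 1).toNat = v 2) =
      fun v => 0 ≤ v 0 ∧ 0 ≤ v 1 ∧ ∃ a b, a % ((0 + 1) * b + 1) = 1 ∧
        (∀ j, 0 ≤ j → j < v 1 →
          a % ((j + 1 + 1) * b + 1) = v 0 * (a % ((j + 1) * b + 1))) ∧
        a % ((v 1 + 1) * b + 1) = v 2 := by
    funext v
    generalize v 0 = x
    generalize v 1 = y
    generalize v 2 = z
    refine propext (and_congr_right fun hx => and_congr_right fun hy => ?_)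
    lift x to ℕ using hx
    lift y to ℕ using hy
    rw [Int.toNat_natCast]
    constructor
    · rintro rfl
      obtain ⟨a, b, hab⟩ := exists_beta (fun j => x ^ j) y
      refine ⟨a, b, by simpa using hab 0 (Nat.zero_le _), fun j hj0 hj => ?_, by
        simpa using hab y le_rfl⟩
      lift j to ℕ using hj0
      have h1 := hab j (by omega)
      have h2 := hab (j + 1) (by omega)
      push_cast at h1 h2
      rw [h1, h2, pow_succ']
    · rintro ⟨a, b, h0, hs, hy⟩
      have key : ∀ j : ℕ, j ≤ y → a % (((j : ℤ) + 1) * b + 1) = (x : ℤ) ^ j := by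
        intro j
        induction j with
        | zero => intro _; simpa using h0
        | succ j ih =>
          intro hj
          have := hs j (by omega) (by omega)
          rw [ih (by omega)] at this
          push_cast
          rw [this, pow_succ']
      rw [← hy, key y le_rfl]
  rw [this]
  refine (StarDef.le (.const 0) (.var _)).and ((StarDef.le (.const 0) (.var _)).and ?_)
  refine .exists <| .exists <| .and ?_ (.and ?_ ?_)
  · exact .eq (.emod (.var _) (.add (.mul (.const _) (.var _)) (.const 1))) (.const 1)
  · refine .forall <| .imp (.le (.const 0) (.var _)) (.imp (.lt (.var _) (.var _)) (.eq ?_ ?_))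
    · exact .emod (.var _)
        (.add (.mul (.add (.add (.var _) (.const 1)) (.const 1)) (.var _)) (.const 1))
    · exact .mul (.var _) (.emod (.var _)
        (.add (.mul (.add (.var _) (.const 1)) (.var _)) (.const 1)))
  · exact .eq (.emod (.var _)
        (.add (.mul (.add (.var _) (.const 1)) (.var _)) (.const 1))) (.var _)

/-- Modulo `p`, the integer `y` is a root of a nonzero polynomial whose degree and coefficients
are bounded by `B`. -/
def Annihilated (p y B : ℤ) : Prop :=
  ∃ Q : ℤ[X], Q ≠ 0 ∧ (Q.natDegree : ℤ) ≤ B ∧ (∀ j, |Q.coeff j| ≤ B) ∧ p ∣ Q.eval y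

/-- The Horner scheme of a polynomial modulo `p`. -/
theorem exists_horner {p y B : ℤ} (hp : 0 < p) (d : ℕ) :
    ∀ Q : ℤ[X], Q.natDegree = d → 0 < Q.leadingCoeff → (∀ j, |Q.coeff j| ≤ B) →
      ∃ h : ℕ → ℕ, 1 ≤ h 0 ∧ (h 0 : ℤ) ≤ B ∧
        (∀ j < d, ∃ c, -B ≤ c ∧ c ≤ B ∧ p ∣ (h (j + 1) : ℤ) - y * h j - c) ∧
        p ∣ Q.eval y - h d := by
  induction d with
  | zero =>
    intro Q hd hl hB
    have hQ := eq_C_of_natDegree_eq_zero hd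
    rw [leadingCoeff, hd] at hl
    refine ⟨fun _ => (Q.coeff 0).toNat, by dsimp only; omega, ?_, by simp, ?_⟩
    · have := (abs_le.1 (hB 0)).2
      dsimp only
      omega
    · rw [hQ]
      simp only [eval_C, coeff_C_zero]
      rw [Int.toNat_of_nonneg hl.le, sub_self]
      exact dvd_zero _
  | succ d ih =>
    intro Q hd hl hB
    have hdd : Q.divX.natDegree = d := by rw [natDegree_divX_eq_natDegree_tsub_one, hd]; rfl
    obtain ⟨h, h0, h0B, hs, he⟩ := ih Q.divX hdd
      (by rw [leadingCoeff, hdd, coeff_divX, ← hd]; exact hl)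
      (fun j => by rw [coeff_divX]; exact hB _)
    -- Only the class modulo `p` matters, so a nonnegative residue is stored; the beta function
    -- codes natural numbers only.
    refine ⟨Function.update h (d + 1) ((y * h d + Q.coeff 0) % p).toNat, ?_, ?_, ?_, ?_⟩
    · rwa [Function.update_of_ne (by omega)]
    · rwa [Function.update_of_ne (by omega)]
    · intro j hj
      rcases Nat.lt_succ_iff_lt_or_eq.1 hj with hj | rfl
      · rw [Function.update_of_ne (by omega), Function.update_of_ne (by omega)]
        exact hs j hj
      · rw [Function.update_self, Function.update_of_ne (by omega),
          Int.toNat_of_nonneg (Int.emod_nonneg _ hp.ne')]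
        refine ⟨Q.coeff 0, (abs_le.1 (hB 0)).1, (abs_le.1 (hB 0)).2, ?_⟩
        have := Int.dvd_self_sub_emod (x := y * h j + Q.coeff 0) (m := p)
        rw [← dvd_neg, show -((y * h j + Q.coeff 0) % p - y * h j - Q.coeff 0) =
          y * h j + Q.coeff 0 - (y * h j + Q.coeff 0) % p by ring]
        exact this
    · rw [Function.update_self, Int.toNat_of_nonneg (Int.emod_nonneg _ hp.ne')]
      have h1 := Int.dvd_self_sub_emod (x := y * h d + Q.coeff 0) (m := p)
      have h2 : Q.eval y = Q.divX.eval y * y + Q.coeff 0 := by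
        conv_lhs => rw [← divX_mul_X_add Q]
        simp
      have h3 := dvd_add (he.mul_right y) h1
      rwa [show (Q.divX.eval y - h d) * y + (y * h d + Q.coeff 0 - (y * h d + Q.coeff 0) % p) =
        Q.divX.eval y * y + Q.coeff 0 - (y * h d + Q.coeff 0) % p by ring, ← h2] at h3

/-- Converse of `exists_horner`: each step replaces `Q` by `Q * X + c`. The positive initial value
is the leading coefficient, so `Q` is nonzero. -/
theorem exists_polynomial_of_horner {p y B : ℤ} (h : ℕ → ℤ) (h0 : 1 ≤ h 0) (h0B : h 0 ≤ B)
    (d : ℕ) (hs : ∀ j < d, ∃ c, -B ≤ c ∧ c ≤ B ∧ p ∣ h (j + 1) - y * h j - c) :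
    ∃ Q : ℤ[X], Q ≠ 0 ∧ Q.natDegree = d ∧ (∀ j, |Q.coeff j| ≤ B) ∧ p ∣ Q.eval y - h d := by
  induction d with
  | zero =>
    refine ⟨C (h 0), by simpa using (by omega : h 0 ≠ 0), natDegree_C _, fun j => ?_, by simp⟩
    rw [coeff_C]
    split_ifs
    · rw [abs_le]; omega
    · rw [abs_zero]; omega
  | succ d ih =>
    obtain ⟨Q, hQ0, hQd, hQB, hQ⟩ := ih fun j hj => hs j (by omega)
    obtain ⟨c, hc1, hc2, hc⟩ := hs d (by omega)
    have hd : (Q * X + C c).natDegree = d + 1 := by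
      rw [natDegree_add_C, natDegree_mul_X hQ0, hQd]
    refine ⟨Q * X + C c, fun h => by rw [h] at hd; simp at hd, hd, fun j => ?_, ?_⟩
    · cases j with
      | zero => simpa [abs_le] using ⟨hc1, hc2⟩
      | succ j => rw [coeff_add, coeff_mul_X, coeff_C_succ, add_zero]; exact hQB j
    · simp only [eval_add, eval_mul, eval_X, eval_C]
      have := dvd_sub (hQ.mul_right y) hc
      rwa [show (Q.eval y - h d) * y - (h (d + 1) - y * h d - c) = Q.eval y * y + c - h (d + 1) by
        ring] at this

/-- A polynomial is quantified over through its Horner values at `y`. A single coded sequence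
suffices: the coefficients are recovered one at a time as the bounded defects `c` of the recursion.
-/
theorem starDef_annihilated : StarDef D
    (fun v : Fin 3 → ℤ => 0 < v 0 ∧ Annihilated (v 0) (v 1) (v 2)) := by
  have : (fun v : Fin 3 → ℤ => 0 < v 0 ∧ Annihilated (v 0) (v 1) (v 2)) =
      fun v => 0 < v 0 ∧ ∃ d a b, 0 ≤ d ∧ d ≤ v 2 ∧ 1 ≤ a % ((0 + 1) * b + 1) ∧
        a % ((0 + 1) * b + 1) ≤ v 2 ∧
        (∀ j, 0 ≤ j → j < d → ∃ c, -v 2 ≤ c ∧ c ≤ v 2 ∧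
          v 0 ∣ a % ((j + 1 + 1) * b + 1) - v 1 * (a % ((j + 1) * b + 1)) - c) ∧
        v 0 ∣ a % ((d + 1) * b + 1) := by
    funext v
    generalize v 0 = p
    generalize v 1 = y
    generalize v 2 = B
    refine propext (and_congr_right fun hp => ?_)
    constructor
    · rintro ⟨Q, hQ, hd, hB, hQp⟩
      -- The Horner sequence starts with the leading coefficient, which has to be a natural number;
      -- passing to `-Q` arranges this.
      wlog hl : 0 < Q.leadingCoeff generalizing Q
      · refine this (-Q) (neg_ne_zero.2 hQ) (by rwa [natDegree_neg]) (fun j => by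
          rw [coeff_neg, abs_neg]; exact hB j) (by rwa [eval_neg, dvd_neg]) ?_
        rw [leadingCoeff_neg]
        have := leadingCoeff_ne_zero.2 hQ
        omega
      obtain ⟨h, h0, h0B, hs, he⟩ := exists_horner (y := y) hp _ Q rfl hl hB
      obtain ⟨a, b, hab⟩ := exists_beta h Q.natDegree
      have hab0 := hab 0 (Nat.zero_le _)
      rw [Nat.cast_zero] at hab0
      refine ⟨Q.natDegree, a, b, by omega, hd, ?_, ?_, ?_, ?_⟩
      · rw [hab0]; exact_mod_cast h0
      · rwa [hab0]
      · intro j hj0 hj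
        lift j to ℕ using hj0
        have h1 := hab j (by omega)
        have h2 := hab (j + 1) (by omega)
        push_cast at h1 h2
        rw [h1, h2]
        exact hs j (by omega)
      · rw [hab _ le_rfl]
        exact (dvd_sub_right hQp).1 he
    · rintro ⟨d, a, b, hd0, hdB, h0, h0B, hs, he⟩
      lift d to ℕ using hd0
      obtain ⟨Q, hQ, hQd, hQB, hQe⟩ := exists_polynomial_of_horner (p := p) (y := y) (B := B)
        (fun j : ℕ => a % (((j : ℤ) + 1) * b + 1)) (by simpa using h0) (by simpa using h0B) d
        (fun j hj => by
          have := hs j (by omega) (by omega)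
          push_cast
          exact this)
      exact ⟨Q, hQ, by rwa [hQd], hQB, (dvd_sub_left he).1 hQe⟩
  rw [this]
  refine (StarDef.lt (.const 0) (.var _)).and ?_
  refine .exists <| .exists <| .exists <| .and ?_ <| .and ?_ <| .and ?_ <| .and ?_ <| .and ?_ ?_
  · exact .le (.const 0) (.var _)
  · exact .le (.var _) (.var _)
  · exact .le (.const 1) (.emod (.var _) (.add (.mul (.const _) (.var _)) (.const 1)))
  · exact .le (.emod (.var _) (.add (.mul (.const _) (.var _)) (.const 1))) (.var _)
  · refine .forall <| .imp (.le (.const 0) (.var _)) (.imp (.lt (.var _) (.var _)) ?_)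
    refine .exists <| .and (.le (.neg (.var _)) (.var _)) <| .and (.le (.var _) (.var _)) ?_
    refine .dvd (.var _) (.sub (.sub ?_ (.mul (.var _) ?_)) (.var _))
    · exact .emod (.var _)
        (.add (.mul (.add (.add (.var _) (.const 1)) (.const 1)) (.var _)) (.const 1))
    · exact .emod (.var _)
        (.add (.mul (.add (.var _) (.const 1)) (.var _)) (.const 1))
  · exact .dvd (.var _) (.emod (.var _)
        (.add (.mul (.add (.var _) (.const 1)) (.var _)) (.const 1)))

/-- The value `0` outside the nonnegative quadrant makes the power a total function, as needed to
compose it with definable bounds. -/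
theorem starDefFun_pow : StarDefFun D
    (fun v : Fin 2 → ℤ => if 0 ≤ v 0 ∧ 0 ≤ v 1 then v 0 ^ (v 1).toNat else 0) := by
  refine .of_graph ?_
  have : (fun w : Option (Fin 2) → ℤ =>
      (if 0 ≤ w (some 0) ∧ 0 ≤ w (some 1) then w (some 0) ^ (w (some 1)).toNat else 0) = w none) =
      fun w => (0 ≤ w (some 0) ∧ 0 ≤ w (some 1) ∧ w (some 0) ^ (w (some 1)).toNat = w none) ∨
        (¬ (0 ≤ w (some 0) ∧ 0 ≤ w (some 1)) ∧ 0 = w none) := by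
    funext w
    split_ifs with h <;> simp [h]
    tauto
  rw [this]
  refine .or ?_ (.and (.not (.and (.le (.const 0) (.var _)) (.le (.const 0) (.var _))))
    (.eq (.const 0) (.var _)))
  exact (starDef_pow (D := D)).comp
    (f := ![fun w => w (some 0), fun w => w (some 1), fun w => w none])
    fun j => by fin_cases j <;> exact .var _

end Arithmetic

/-! ### Closure properties of `O(ℱ)` -/

section Bounds

open FirstOrder Set

attribute [local instance] FirstOrder.Ring.compatibleRingOfRing

variable {ι : Type} {A : Set (NS D ℤ)} {l : NS D ℤ}

theorem DefFun.definableFun {f : NS D ℤ → NS D ℤ} (hf : DefFun A f) (j : ι) :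
    A.DefinableFun Language.ring (fun v => f (v j)) :=
  Definable.preimage_comp (![some j, none] : Fin 2 → Option ι) hf

theorem DefFun.of_definableFun {f : NS D ℤ → NS D ℤ}
    (hf : A.DefinableFun Language.ring (fun v : Fin 1 → NS D ℤ => f (v 0))) : DefFun A f :=
  Definable.preimage_comp (fun o : Option (Fin 1) => o.elim (1 : Fin 2) (fun _ => 0)) hf

theorem starFun_fin_two (F : ℤ → ℤ → ℤ) (w : Fin 2 → NS D ℤ) :
    starFun (fun v => F (v 0) (v 1)) w = Germ.map₂ F (w 0) (w 1) := by
  rw [← coe_rep (w 0), ← coe_rep (w 1)]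
  rfl

/-- The common source of the closure of `O(ℱ)` under sums, products and powers: bounding functions
are combined by the operation itself. -/
theorem defFunNat_comp₂ {F : ℤ → ℤ → ℤ}
    (hF : StarDefFun D (fun v : Fin 2 → ℤ => F (v 0) (v 1))) (hF0 : ∀ a b : ℕ, 0 ≤ F a b)
    {f g : NS D ℤ → NS D ℤ} (hf : f ∈ DefFunNat A) (hg : g ∈ DefFunNat A) :
    (fun x => Germ.map₂ F (f x) (g x)) ∈ DefFunNat A := by
  constructor
  · refine .of_definableFun (definableFun_comp₂ (F := Germ.map₂ F) ?_ (hf.1.definableFun 0)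
      (hg.1.definableFun 0))
    have := DefinableFun.of_empty (A := A) hF
    simpa only [funext (starFun_fin_two F)] using this
  · intro n
    obtain ⟨a, ha⟩ := hf.2 n
    obtain ⟨b, hb⟩ := hg.2 n
    refine ⟨(F a b).toNat, ?_⟩
    simp only [ha, hb]
    have : ((F a b).toNat : ℤ) = F a b := Int.toNat_of_nonneg (hF0 a b)
    change ((F a b : ℤ) : NS D ℤ) = ((((F a b).toNat : ℕ) : ℤ) : NS D ℤ)
    rw [this]

theorem mem_OFun_of_le {a b : NS D ℤ} (hb : b ∈ OFun A l) (h1 : -b ≤ a) (h2 : a ≤ b) :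
    a ∈ OFun A l := by
  obtain ⟨f, hf, h3, h4⟩ := hb
  exact ⟨f, hf, by linarith, by linarith⟩

theorem natCast_mem_OFun (n : ℕ) : (n : NS D ℤ) ∈ OFun A l :=
  ⟨fun _ => n, ⟨.of_definableFun (by simpa using definableFun_intCast (D := D) n),
    fun _ => ⟨n, rfl⟩⟩, by have : (0 : NS D ℤ) ≤ n := Nat.cast_nonneg n; linarith, le_rfl⟩

theorem self_mem_OFun (hl : 0 ≤ l) : l ∈ OFun A l :=
  ⟨fun x => x, ⟨.of_definableFun (DefinableFun.proj Language.ring), fun n => ⟨n, rfl⟩⟩,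
    by linarith, le_rfl⟩

theorem add_mem_OFun {a b : NS D ℤ} (ha : a ∈ OFun A l) (hb : b ∈ OFun A l) :
    a + b ∈ OFun A l := by
  obtain ⟨f, hf, h1, h2⟩ := ha
  obtain ⟨g, hg, h3, h4⟩ := hb
  refine ⟨_, defFunNat_comp₂ (F := (· + ·)) (.add (.var 0) (.var 1))
    (fun a b => by positivity) hf hg, ?_⟩
  change -(f l + g l) ≤ a + b ∧ a + b ≤ f l + g l
  constructor <;> linarith

theorem mul_mem_OFun {a b : NS D ℤ} (ha : a ∈ OFun A l) (hb : b ∈ OFun A l) :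
    a * b ∈ OFun A l := by
  obtain ⟨f, hf, h1, h2⟩ := ha
  obtain ⟨g, hg, h3, h4⟩ := hb
  refine ⟨_, defFunNat_comp₂ (F := (· * ·)) (.mul (.var 0) (.var 1))
    (fun a b => by positivity) hf hg, ?_⟩
  change -(f l * g l) ≤ a * b ∧ a * b ≤ f l * g l
  rw [← abs_le, abs_mul]
  exact mul_le_mul (abs_le.2 ⟨h1, h2⟩) (abs_le.2 ⟨h3, h4⟩) (abs_nonneg _) (by linarith)

theorem pow_mem_OFun {a : NS D ℤ} (ha : a ∈ OFun A l) (n : ℕ) : a ^ n ∈ OFun A l := by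
  induction n with
  | zero => simpa using natCast_mem_OFun 1
  | succ n ih => rw [pow_succ]; exact mul_mem_OFun ih ha

theorem npow_mem_OFun {a b : NS D ℤ} (ha0 : 0 ≤ a) (ha : a ∈ OFun A l) (hb : b ∈ OFun A l) :
    npow a b ∈ OFun A l := by
  -- A bound for `a + 1` is at least `1`, so its powers are monotone in the exponent.
  have ha' : a + 1 ∈ OFun A l := add_mem_OFun ha (by simpa using natCast_mem_OFun 1)
  obtain ⟨f, hf, h1, h2⟩ := ha'
  obtain ⟨g, hg, h3, h4⟩ := hb
  refine ⟨_, defFunNat_comp₂ (F := fun x y => if 0 ≤ x ∧ 0 ≤ y then x ^ y.toNat else 0)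
    starDefFun_pow (fun a b => by positivity) hf hg, ?_⟩
  generalize f l = x at h1 h2
  generalize g l = y at h3 h4
  induction a using Germ.inductionOn with | _ a
  induction b using Germ.inductionOn with | _ b
  induction x using Germ.inductionOn with | _ x
  induction y using Germ.inductionOn with | _ y
  have e0 : ∀ᶠ q in (D : Filter Nat.Primes), 0 ≤ a q := ha0
  have e2 : ∀ᶠ q in (D : Filter Nat.Primes), a q + 1 ≤ x q := h2
  have e3 : ∀ᶠ q in (D : Filter Nat.Primes), -y q ≤ b q := h3
  have e4 : ∀ᶠ q in (D : Filter Nat.Primes), b q ≤ y q := h4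
  have key : ∀ᶠ q in (D : Filter Nat.Primes), 0 ≤ a q ^ (b q).toNat ∧
      a q ^ (b q).toNat ≤ if 0 ≤ x q ∧ 0 ≤ y q then x q ^ (y q).toNat else 0 := by
    filter_upwards [e0, e2, e3, e4] with q e0 e2 e3 e4
    rw [if_pos ⟨by omega, by omega⟩]
    refine ⟨by positivity, ?_⟩
    calc a q ^ (b q).toNat ≤ x q ^ (b q).toNat := pow_le_pow_left₀ e0 (by omega) _
      _ ≤ x q ^ (y q).toNat := pow_le_pow_right₀ (by omega) (by omega)
  constructor
  · exact key.mono fun q hq => by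
      dsimp only [Function.comp, Pi.neg_apply]
      linarith [hq.1, hq.2]
  · exact key.mono fun q hq => hq.2

end Bounds

/-! ### From the nonstandard parameters to ordinary integers at almost every index -/

section Scale

theorem coe_dvd_coe {a b : Nat.Primes → ℤ} :
    (a : NS D ℤ) ∣ (b : NS D ℤ) ↔ ∀ᶠ q in (D : Filter Nat.Primes), a q ∣ b q := by
  constructor
  · rintro ⟨c, hc⟩
    induction c using Germ.inductionOn with | _ c
    exact (Germ.coe_eq.1 hc).mono fun q hq => ⟨c q, hq⟩
  · intro h
    obtain ⟨c, hc⟩ := h.choice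
    exact ⟨(c : NS D ℤ), Germ.coe_eq.2 hc⟩

theorem cls_eq_cls_iff {N a b : Nat.Primes → ℤ} :
    cls (N : NS D ℤ) (a : NS D ℤ) = cls (N : NS D ℤ) (b : NS D ℤ) ↔
      ∀ᶠ q in (D : Filter Nat.Primes), N q ∣ a q - b q := by
  rw [Ideal.Quotient.eq, Ideal.mem_span_singleton, ← Germ.coe_sub, coe_dvd_coe]
  rfl

/-- The facts about the parameters that hold at almost every index. -/
structure LocalScale (p e i l u : ℤ) : Prop where
  prime : p.natAbs.Prime
  pos : 0 < p
  eps_nonneg : 0 ≤ e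
  not_dvd : ¬ p ∣ e
  i_pos : 0 < i
  l_pos : 0 < l
  u_pos : 0 < u
  unit : i * l * u = p - 1
  order : ∀ n : ℕ, p ∣ e ^ n - 1 → p - 1 ∣ n

variable {p e i l u : Nat.Primes → ℤ}

theorem eventually_pos_of_isScale (h : IsScale (p : NS D ℤ) e i l u) :
    ∀ᶠ q in (D : Filter Nat.Primes), 0 < p q ∧ 0 < p q - 1 ∧ 0 < i q ∧ 0 < l q ∧ 0 < u q ∧
      i q * l q * u q = p q - 1 := by
  obtain ⟨m, j, -, hm, -, hj, -⟩ := h.divisible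
  have h1 : ∀ᶠ q in (D : Filter Nat.Primes), 0 < p q := Germ.coe_lt.1 h.pos
  have h2 : ∀ᶠ q in (D : Filter Nat.Primes), p q ≠ 1 := by
    refine Ultrafilter.eventually_not.2 fun h1 => h.prime.not_isUnit ?_
    have : (p : NS D ℤ) = 1 := Germ.coe_eq.2 h1
    rw [this]
    exact isUnit_one
  have hl : ∀ᶠ q in (D : Filter Nat.Primes), 0 ≤ l q := by
    have : (0 : NS D ℤ) ≤ l := hm ▸ sq_nonneg m
    exact this
  have hi : ∀ᶠ q in (D : Filter Nat.Primes), 0 ≤ i q := by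
    have : (0 : NS D ℤ) ≤ i := hj ▸ sq_nonneg j
    exact this
  have hu : ∀ᶠ q in (D : Filter Nat.Primes), i q * l q * u q = p q - 1 := Germ.coe_eq.1 h.unit
  filter_upwards [h1, h2, hl, hi, hu] with q h1 h2 hl hi hu
  have hpos : 0 < i q * l q * u q := by omega
  have hil : 0 ≤ i q * l q := mul_nonneg hi hl
  have hu0 : 0 < u q := pos_of_mul_pos_right hpos hil
  have hil0 : 0 < i q * l q := pos_of_mul_pos_left hpos hu0.le
  exact ⟨h1, by omega, pos_of_mul_pos_left hil0 hl, pos_of_mul_pos_right hil0 hi, hu0, hu⟩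

/-- Otherwise proper factorisations at almost every index would combine into a factorisation of `p`
in `*ℤ`, contradicting primality there. -/
theorem eventually_prime_of_isScale (h : IsScale (p : NS D ℤ) e i l u) :
    ∀ᶠ q in (D : Filter Nat.Primes), (p q).natAbs.Prime := by
  by_contra hcon
  have hcon := Ultrafilter.eventually_not.2 hcon
  have hex : ∀ᶠ q in (D : Filter Nat.Primes), ∃ a : ℤ, a ∣ p q ∧ 1 < a ∧ a < p q := by
    filter_upwards [hcon, eventually_pos_of_isScale h] with q h1 h2
    obtain ⟨a, ha, h3, h4⟩ := Nat.exists_dvd_of_not_prime2 (n := (p q).natAbs) (by omega) h1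
    exact ⟨a, Int.natCast_dvd.2 ha, by omega, by omega⟩
  obtain ⟨a, ha⟩ := hex.choice
  obtain ⟨b, hb⟩ := (ha.mono fun q hq => hq.1).choice
  have hab : (p : NS D ℤ) ∣ (a : NS D ℤ) * (b : NS D ℤ) :=
    coe_dvd_coe.2 (hb.mono fun q hq => ⟨1, by rw [mul_one]; exact hq.symm⟩)
  rcases h.prime.dvd_or_dvd hab with hd | hd
  · obtain ⟨q, h1, h2⟩ := ((coe_dvd_coe.1 hd).and ha).exists
    have := Int.le_of_dvd (by omega) h1
    omega
  · obtain ⟨q, h1, h2, h3, h4⟩ := ((coe_dvd_coe.1 hd).and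
      (ha.and (hb.and (eventually_pos_of_isScale h)))).exists
    have hb0 : 0 < b q := by
      have : 0 < a q * b q := by rw [← h3]; exact h4.1
      exact pos_of_mul_pos_right this (by omega)
    have := Int.le_of_dvd hb0 h1
    nlinarith

theorem npow_coe (a n : Nat.Primes → ℤ) :
    npow (a : NS D ℤ) n = ((fun q => a q ^ (n q).toNat : Nat.Primes → ℤ) : NS D ℤ) := rfl

theorem zpowF_of_nonneg (p e : NS D ℤ) {η : NS D ℤ} (hη : 0 ≤ η) :
    zpowF p e η = cls p (npow e η) := by
  rw [zpowF, npow_of_nonpos e (-η) (by linarith), show cls p 1 = 1 from map_one _,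
    Ring.inverse_one, mul_one]

theorem cls_eq_one_iff {N a : Nat.Primes → ℤ} :
    cls (N : NS D ℤ) (a : NS D ℤ) = 1 ↔ ∀ᶠ q in (D : Filter Nat.Primes), N q ∣ a q - 1 := by
  rw [← map_one (Ideal.Quotient.mk _), ← Germ.coe_one]
  exact cls_eq_cls_iff

theorem IsScale.eventually_localScale (h : IsScale (p : NS D ℤ) e i l u) :
    ∀ᶠ q in (D : Filter Nat.Primes), LocalScale (p q) (e q) (i q) (l q) (u q) := by
  have hpos := eventually_pos_of_isScale h
  have hprime := eventually_prime_of_isScale h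
  have he0 : ∀ᶠ q in (D : Filter Nat.Primes), 0 ≤ e q := h.eps_nonneg
  have hp1 : (0 : NS D ℤ) ≤ (p : NS D ℤ) - 1 := hpos.mono fun q hq => hq.2.1.le
  have hpow : ∀ᶠ q in (D : Filter Nat.Primes), p q ∣ e q ^ (p q - 1).toNat - 1 := by
    have h1 := (h.order (p - 1)).2 dvd_rfl
    rw [zpowF_of_nonneg _ _ hp1] at h1
    exact cls_eq_one_iff.1 h1
  -- Exponents violating the claim at almost every index would form a nonstandard exponent violating
  -- `h.order`.
  have hord : ∀ᶠ q in (D : Filter Nat.Primes), ∀ n : ℕ, p q ∣ e q ^ n - 1 → p q - 1 ∣ n := by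
    by_contra hcon
    have hcon := Ultrafilter.eventually_not.2 hcon
    simp only [not_forall] at hcon
    obtain ⟨n, hn⟩ := hcon.choice
    have h1 : zpowF (p : NS D ℤ) e ((fun q => (n q : ℤ) : Nat.Primes → ℤ) : NS D ℤ) = 1 := by
      rw [zpowF_of_nonneg, npow_coe]
      · refine cls_eq_one_iff.2 (hn.mono fun q hq => ?_)
        rw [Int.toNat_natCast]
        exact hq.1
      · exact Eventually.of_forall fun q => Int.natCast_nonneg _
    have h2 := (h.order _).1 h1
    obtain ⟨q, h3, h4⟩ := ((coe_dvd_coe (a := p - 1)).1 h2 |>.and hn).exists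
    exact h4.2 h3
  filter_upwards [hpos, hprime, he0, hpow, hord] with q h1 h2 h3 h4 h5
  refine ⟨h2, h1.1, h3, fun hd => ?_, h1.2.2.1, h1.2.2.2.1, h1.2.2.2.2.1, h1.2.2.2.2.2, h5⟩
  have h6 : p q ∣ e q ^ (p q - 1).toNat := hd.trans (dvd_pow_self _ (by omega))
  have h7 : p q ∣ 1 := (dvd_sub_right h6).1 h4
  have := Int.le_of_dvd one_pos h7
  omega

/-- `l` is infinite, being the square of a nonzero element divisible by every positive standard
integer. -/
theorem IsScale.eventually_natCast_le (h : IsScale (p : NS D ℤ) e i l u) (n : ℕ) :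
    ∀ᶠ q in (D : Filter Nat.Primes), (n : ℤ) ≤ l q := by
  obtain ⟨m, j, hn, hm, -⟩ := h.divisible
  induction m using Germ.inductionOn with | _ m
  have h1 : ∀ᶠ q in (D : Filter Nat.Primes), ((n : ℤ) + 1) ∣ m q := by
    have := hn (n + 1) (Nat.succ_pos _)
    exact (coe_dvd_coe (a := fun _ => ((n + 1 : ℕ) : ℤ))).1 this |>.mono fun q hq => by
      exact_mod_cast hq
  have h2 : ∀ᶠ q in (D : Filter Nat.Primes), m q ^ 2 = l q := Germ.coe_eq.1 hm
  filter_upwards [h1, h2, h.eventually_localScale] with q h1 h2 h3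
  have hm0 : m q ≠ 0 := fun h0 => by
    have := h3.l_pos
    rw [h0] at h2
    simp at h2
    omega
  have h4 := Int.le_of_dvd (abs_pos.2 hm0) ((dvd_abs _ _).2 h1)
  rw [← h2, ← sq_abs]
  nlinarith

theorem IsScale.infinite_le_p (h : IsScale (p : NS D ℤ) e i l u) (n : ℕ) :
    ∀ᶠ q in (D : Filter Nat.Primes), (n : ℤ) < p q := by
  filter_upwards [h.eventually_natCast_le n, h.eventually_localScale] with q h1 h2
  have := h2.unit
  have h3 : l q ≤ i q * l q * u q := by
    have h4 := h2.i_pos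
    have h5 := h2.u_pos
    have h6 := h2.l_pos
    have : 1 ≤ i q * u q := by nlinarith
    nlinarith
  omega

/-! ### Consequences of genericity -/

section Genericity

open FirstOrder Set

attribute [local instance] FirstOrder.Ring.compatibleRingOfRing

/-- `l = m ^ 2` divides `i = j ^ 2`, so `i` is infinite and exceeds `n * k ^ 2` for every standard
`k`; genericity then allows `k` to be replaced by `l`. -/
theorem IsScale.eventually_mul_sq_lt (h : IsScale (p : NS D ℤ) e i l u) (n : ℕ) :
    ∀ᶠ q in (D : Filter Nat.Primes), n * l q ^ 2 < i q := by
  have hil : ∀ᶠ q in (D : Filter Nat.Primes), l q ≤ i q := by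
    obtain ⟨m, j, -, hm, ⟨c, hc⟩, hj, -⟩ := h.divisible
    have : (i : NS D ℤ) = l * c ^ 2 := by rw [← hj, ← hm, hc]; ring
    have h1 := coe_dvd_coe.1 (Dvd.intro _ this.symm)
    filter_upwards [h1, h.eventually_localScale] with q h1 h2
    exact Int.le_of_dvd h2.i_pos h1
  have hR : StarDef D (fun v : Fin 2 → ℤ => n * (v 0 * v 0) < v 1) :=
    .lt (.mul (.const n) (.mul (.var _) (.var _))) (.var _)
  have hS : DefSet {(p : NS D ℤ), (e : NS D ℤ), (i : NS D ℤ)}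
      {x | StarRel (fun v : Fin 2 → ℤ => n * (v 0 * v 0) < v 1) ![x, (i : NS D ℤ)]} := by
    refine Definable.preimage_map (F := fun v : Fin 1 → NS D ℤ => ![v 0, (i : NS D ℤ)]) ?_
      (Definable.mono hR (empty_subset _))
    intro j
    fin_cases j
    · exact DefinableFun.proj _
    · exact Language.definableFun_const _ _ (by simp)
  have key : ∀ x : Nat.Primes → ℤ, StarRel (fun v : Fin 2 → ℤ => n * (v 0 * v 0) < v 1)
      ![(x : NS D ℤ), (i : NS D ℤ)] ↔
      ∀ᶠ q in (D : Filter Nat.Primes), n * (x q * x q) < i q := by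
    intro x
    have h0 := starRel_coe (D := D) (fun v : Fin 2 → ℤ => n * (v 0 * v 0) < v 1) ![x, i]
    have h1 : (fun j => ((![x, i] j : Nat.Primes → ℤ) : NS D ℤ)) =
        ![(x : NS D ℤ), (i : NS D ℤ)] := by
      funext j
      fin_cases j <;> rfl
    rw [h1] at h0
    exact h0
  have hl := h.generic _ hS fun k => by
    refine (key fun _ => (k : ℤ)).2 ?_
    filter_upwards [hil, h.eventually_natCast_le (n * (k * k) + 1)] with q h1 h2
    push_cast at h2
    linarith
  exact ((key l).1 hl).mono fun q hq => by rwa [sq]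

open Polynomial in
theorem aeval_coe (f : Nat.Primes → ℤ) (Q : ℤ[X]) :
    aeval (f : NS D ℤ) Q = ((fun q => Q.eval (f q) : Nat.Primes → ℤ) : NS D ℤ) := by
  refine (aeval_algHom_apply (Germ.coeRingHom (D : Filter Nat.Primes)).toIntAlgHom f Q).trans ?_
  refine congrArg (Germ.ofFun) (funext fun q => ?_)
  exact (aeval_algHom_apply (Pi.evalRingHom (fun _ : Nat.Primes => ℤ) q).toIntAlgHom f Q).symm

open Polynomial in
-- A standard bound leaves finitely many polynomials, so the ultrafilter selects one that works at
-- almost every index. Then `e ^ w` is algebraic over `ℤ` in `F_p`, and so is its `n`-th power `e ^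
-- (l * u)`, contrary to hypothesis.
theorem eventually_not_annihilated_of_natCast (h : IsScale (p : NS D ℤ) e i l u) (n B : ℕ)
    {w : Nat.Primes → ℤ} (hw : ∀ᶠ q in (D : Filter Nat.Primes), 0 ≤ w q ∧
      i q * n * w q = p q - 1 ∧ Annihilated (p q) (e q ^ (w q).toNat) B) : False := by
  have hfin : {Q : ℤ[X] | Q.natDegree ≤ B ∧ ∀ j, |Q.coeff j| ≤ B}.Finite := by
    refine ((Set.Finite.pi' fun _ : Fin (B + 1) => Set.finite_Icc (-(B : ℤ)) B).image
      fun c => ∑ j : Fin (B + 1), C (c j) * X ^ (j : ℕ)).subset ?_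
    rintro Q ⟨h1, h2⟩
    refine ⟨fun j => Q.coeff j, fun j => abs_le.1 (h2 j), ?_⟩
    conv_rhs => rw [Q.as_sum_range_C_mul_X_pow' (n := B + 1) (by omega)]
    exact (Finset.sum_range fun j => C (Q.coeff j) * X ^ j).symm
  have hex : ∀ᶠ q in (D : Filter Nat.Primes),
      ∃ Q ∈ {Q : ℤ[X] | Q.natDegree ≤ B ∧ ∀ j, |Q.coeff j| ≤ B},
        Q ≠ 0 ∧ p q ∣ Q.eval (e q ^ (w q).toNat) := by
    filter_upwards [hw] with q hq
    obtain ⟨Q, h1, h2, h3, h4⟩ := hq.2.2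
    exact ⟨Q, ⟨by exact_mod_cast h2, h3⟩, h1, h4⟩
  obtain ⟨Q, -, hQ⟩ := (Ultrafilter.eventually_exists_mem_iff hfin).1 hex
  have hQ0 : Q ≠ 0 := hQ.exists.choose_spec.1
  set y : NS D ℤ := npow (e : NS D ℤ) w with hy
  have hroot : aeval (cls (p : NS D ℤ) y) Q = 0 := by
    have h1 : aeval (cls (p : NS D ℤ) y) Q = cls (p : NS D ℤ) (aeval y Q) :=
      aeval_algebraMap_apply (A := NS D ℤ) (B := Quo (p : NS D ℤ)) y Q
    rw [h1, Ideal.Quotient.eq_zero_iff_mem, Ideal.mem_span_singleton]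
    rw [hy, npow_coe, aeval_coe, coe_dvd_coe]
    exact hQ.mono fun q hq => hq.2
  have halg : IsAlgebraic ℤ (cls (p : NS D ℤ) y) := ⟨Q, hQ0, hroot⟩
  have hpow := halg.pow n
  -- `F_p` has characteristic zero since `p` is infinite; algebraicity over `ℤ` thus implies
  -- algebraicity over the subring generated by `i`.
  have hinj : Function.Injective
      (algebraMap ℤ (Algebra.adjoin ℤ {cls (p : NS D ℤ) (i : NS D ℤ)})) := by
    rw [injective_iff_map_eq_zero]
    intro k hk
    have h1 : cls (p : NS D ℤ) ((k : ℤ) : NS D ℤ) = 0 := by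
      have := congrArg (Subtype.val) hk
      simpa using this
    rw [Ideal.Quotient.eq_zero_iff_mem, Ideal.mem_span_singleton] at h1
    have h2 := (coe_dvd_coe (b := fun _ => k)).1 h1
    obtain ⟨q, h3, h4⟩ := (h2.and (h.infinite_le_p k.natAbs)).exists
    by_contra hk0
    have := Int.le_of_dvd (abs_pos.2 hk0) ((dvd_abs _ _).2 h3)
    rw [Int.abs_eq_natAbs] at this
    omega
  have hlu : zpowF (p : NS D ℤ) e (l * u) = cls (p : NS D ℤ) y ^ n := by
    have h0 : (0 : NS D ℤ) ≤ l * u :=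
      h.eventually_localScale.mono fun q hq => (mul_pos hq.l_pos hq.u_pos).le
    rw [zpowF_of_nonneg _ _ h0, ← map_pow]
    refine congrArg _ (Germ.coe_eq.2 ?_)
    filter_upwards [hw, h.eventually_localScale] with q h1 h2
    change e q ^ (l q * u q).toNat = (e q ^ (w q).toNat) ^ n
    rw [← pow_mul]
    congr 1
    have h3 : i q * (l q * u q) = i q * (n * w q) := by
      have := h2.unit
      linarith [h1.2.1]
    have h4 : l q * u q = n * w q := mul_left_cancel₀ h2.i_pos.ne' h3
    rw [h4]
    have h5 := Int.toNat_of_nonneg h1.1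
    have h6 : (((w q).toNat * n : ℕ) : ℤ) = n * w q := by push_cast; rw [h5]; ring
    rw [← h6, Int.toNat_natCast]
  refine h.transcendental ?_
  rw [hlu]
  exact hpow.extendScalars hinj

/-- `e ^ ((p - 1) / (i x))` satisfies modulo `p` no polynomial equation of size `B`. -/
def Avoids (v : Fin 5 → ℤ) : Prop :=
  ∀ w y, v 2 * v 3 * w = v 0 - 1 → (0 ≤ v 1 ∧ 0 ≤ w ∧ v 1 ^ w.toNat = y) →
    ¬ (0 < v 0 ∧ Annihilated (v 0) y (v 4))

theorem starDef_avoids : StarDef D Avoids := by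
  unfold Avoids
  refine .forall <| .forall <| .imp ?_ (.imp ?_ (.not ?_))
  · exact .eq (.mul (.mul (.var _) (.var _)) (.var _)) (.sub (.var _) (.const 1))
  · exact (starDef_pow (D := D)).comp
      (f := ![fun w => w (some (some 1)), fun w => w (some none), fun w => w none])
      fun j => by fin_cases j <;> exact .var _
  · exact (starDef_annihilated (D := D)).comp
      (f := ![fun w => w (some (some 0)), fun w => w none, fun w => w (some (some 4))])
      fun j => by fin_cases j <;> exact .var _

theorem starRel_avoids_iff (x B : Nat.Primes → ℤ) :
    StarRel Avoids ![(p : NS D ℤ), (e : NS D ℤ), (i : NS D ℤ), (x : NS D ℤ), (B : NS D ℤ)] ↔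
      ∀ᶠ q in (D : Filter Nat.Primes), Avoids ![p q, e q, i q, x q, B q] := by
  have h := starRel_coe (D := D) Avoids ![p, e, i, x, B]
  have h1 : (fun j => ((![p, e, i, x, B] j : Nat.Primes → ℤ) : NS D ℤ)) =
      ![(p : NS D ℤ), (e : NS D ℤ), (i : NS D ℤ), (x : NS D ℤ), (B : NS D ℤ)] := by
    funext j
    fin_cases j <;> rfl
  have h2 : ∀ q, (fun j => ![p, e, i, x, B] j q) = ![p q, e q, i q, x q, B q] := by
    intro q
    funext j
    fin_cases j <;> rfl
  rw [h1] at h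
  simpa only [h2] using h

theorem Annihilated.mono {p y B B' : ℤ} (h : Annihilated p y B) (hB : B ≤ B') :
    Annihilated p y B' := by
  obtain ⟨Q, h1, h2, h3, h4⟩ := h
  exact ⟨Q, h1, h2.trans hB, fun j => (h3 j).trans hB, h4⟩

/-- With `B ≤ f l`, the condition `Avoids` for `x` and `f x` is definable in `x`. At a standard `n`
the bound `f n` is standard, so the preceding case applies; at `l` the exponent is `(p - 1) / (i *
l) = u`. -/
theorem IsScale.eventually_not_annihilated (h : IsScale (p : NS D ℤ) e i l u)
    {B : Nat.Primes → ℤ} (hB : (B : NS D ℤ) ∈ OFun {(p : NS D ℤ), (e : NS D ℤ), (i : NS D ℤ)} l) :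
    ∀ᶠ q in (D : Filter Nat.Primes), ¬ Annihilated (p q) (e q ^ (u q).toNat) (B q) := by
  obtain ⟨f, hf, -, hBf⟩ := hB
  have hS : DefSet {(p : NS D ℤ), (e : NS D ℤ), (i : NS D ℤ)}
      {x | StarRel Avoids ![(p : NS D ℤ), (e : NS D ℤ), (i : NS D ℤ), x, f x]} := by
    refine Definable.preimage_map
      (F := fun v : Fin 1 → NS D ℤ => ![(p : NS D ℤ), (e : NS D ℤ), (i : NS D ℤ), v 0, f (v 0)]) ?_
      (Definable.mono (starDef_avoids (D := D)) (empty_subset _))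
    intro j
    fin_cases j
    · exact Language.definableFun_const _ _ (by simp)
    · exact Language.definableFun_const _ _ (by simp)
    · exact Language.definableFun_const _ _ (by simp)
    · exact DefinableFun.proj _
    · exact hf.1.definableFun 0
  have hl := h.generic _ hS fun n => by
    obtain ⟨k, hk⟩ := hf.2 n
    change StarRel Avoids ![(p : NS D ℤ), (e : NS D ℤ), (i : NS D ℤ), (n : NS D ℤ), f n]
    rw [hk]
    refine (starRel_avoids_iff (fun _ => (n : ℤ)) (fun _ => (k : ℤ))).2 ?_
    by_contra hcon
    have hcon := Ultrafilter.eventually_not.2 hcon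
    simp only [Avoids, not_forall, not_not] at hcon
    obtain ⟨w, hw⟩ := hcon.choice
    refine eventually_not_annihilated_of_natCast h n k (w := w) (hw.mono fun q hq => ?_)
    obtain ⟨y, h1, ⟨-, h2, rfl⟩, -, h3⟩ := hq
    exact ⟨h2, h1, h3⟩
  obtain ⟨F, hF⟩ : ∃ F : Nat.Primes → ℤ, (F : NS D ℤ) = f l := ⟨rep (f l), coe_rep _⟩
  have hl' : StarRel Avoids ![(p : NS D ℤ), (e : NS D ℤ), (i : NS D ℤ), (l : NS D ℤ),
    (F : NS D ℤ)] := by rw [hF]; exact hl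
  rw [starRel_avoids_iff] at hl'
  rw [← hF] at hBf
  have hBf' : ∀ᶠ q in (D : Filter Nat.Primes), B q ≤ F q := hBf
  filter_upwards [hl', hBf', h.eventually_localScale] with q h1 h2 h3 h4
  exact h1 (u q) _ h3.unit ⟨h3.eps_nonneg, h3.u_pos.le, rfl⟩ ⟨h3.pos, h4.mono h2⟩

end Genericity

end Scale

/-! ### Elimination of the root of unity by an effective resultant -/

section Resultant

open Polynomial

/-- The sum of the absolute values of the coefficients of an integer polynomial. -/
def len (f : ℤ[X]) : ℤ := f.sum fun _ a => |a|

theorem len_eq_sum_range (f : ℤ[X]) (n : ℕ) (h : f.natDegree < n) :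
    len f = ∑ j ∈ Finset.range n, |f.coeff j| :=
  f.sum_over_range' (fun _ => abs_zero) n h

theorem len_nonneg (f : ℤ[X]) : 0 ≤ len f :=
  Finset.sum_nonneg fun _ _ => abs_nonneg _

theorem abs_coeff_le_len (f : ℤ[X]) (j : ℕ) : |f.coeff j| ≤ len f := by
  rw [len_eq_sum_range f (max f.natDegree j + 1) (by omega)]
  exact Finset.single_le_sum (f := fun j => |f.coeff j|) (fun _ _ => abs_nonneg _)
    (Finset.mem_range.2 (by omega))

theorem len_zero : len 0 = 0 := by simp [len]

theorem len_add_le (f g : ℤ[X]) : len (f + g) ≤ len f + len g := by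
  set n := max f.natDegree g.natDegree + 1
  rw [len_eq_sum_range f n (by omega), len_eq_sum_range g n (by omega),
    len_eq_sum_range (f + g) n ((natDegree_add_le f g).trans_lt (by omega)),
    ← Finset.sum_add_distrib]
  exact Finset.sum_le_sum fun j _ => by rw [coeff_add]; exact abs_add_le _ _

theorem len_sum_le {ι : Type*} (s : Finset ι) (f : ι → ℤ[X]) :
    len (∑ j ∈ s, f j) ≤ ∑ j ∈ s, len (f j) := by
  classical
  induction s using Finset.induction_on with
  | empty => simp [len_zero]
  | insert a s ha ih =>
    rw [Finset.sum_insert ha, Finset.sum_insert ha]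
    exact (len_add_le _ _).trans (by linarith)

theorem len_C_mul_X_pow_mul (a : ℤ) (j : ℕ) (g : ℤ[X]) :
    len (C a * X ^ j * g) ≤ |a| * len g := by
  have hd : (C a * X ^ j * g).natDegree < j + (g.natDegree + 1) := by
    refine (natDegree_mul_le_of_le (natDegree_C_mul_X_pow_le a j) le_rfl).trans_lt ?_
    omega
  rw [len_eq_sum_range _ _ hd, Finset.sum_range_add, len_eq_sum_range g _ (Nat.lt_succ_self _),
    Finset.mul_sum]
  have h0 : ∑ k ∈ Finset.range j, |(C a * X ^ j * g).coeff k| = 0 := by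
    refine Finset.sum_eq_zero fun k hk => ?_
    rw [mul_assoc, coeff_C_mul, coeff_X_pow_mul', if_neg (by simpa using hk), mul_zero, abs_zero]
  rw [h0, zero_add]
  refine Finset.sum_le_sum fun k _ => ?_
  rw [mul_assoc, coeff_C_mul, add_comm, coeff_X_pow_mul, abs_mul]

theorem len_mul_le (f g : ℤ[X]) : len (f * g) ≤ len f * len g := by
  conv_lhs => rw [f.as_sum_range_C_mul_X_pow, Finset.sum_mul]
  refine (len_sum_le _ _).trans ?_
  rw [len_eq_sum_range f _ (Nat.lt_succ_self _), Finset.sum_mul]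
  exact Finset.sum_le_sum fun j _ => len_C_mul_X_pow_mul _ _ _

theorem len_one : len 1 = 1 := by
  rw [len_eq_sum_range 1 1 (by simp)]
  simp

theorem len_prod_le {ι : Type*} (s : Finset ι) (f : ι → ℤ[X]) {H : ℤ}
    (hf : ∀ j ∈ s, len (f j) ≤ H) : len (∏ j ∈ s, f j) ≤ H ^ s.card := by
  classical
  induction s using Finset.induction_on with
  | empty => simp [len_one]
  | insert a s ha ih =>
    rw [Finset.prod_insert ha, Finset.card_insert_of_notMem ha, pow_succ']
    refine (len_mul_le _ _).trans (mul_le_mul (hf a (Finset.mem_insert_self _ _))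
      (ih fun j hj => hf j (Finset.mem_insert_of_mem hj)) (len_nonneg _)
      ((len_nonneg _).trans (hf a (Finset.mem_insert_self _ _))))

theorem len_neg (f : ℤ[X]) : len (-f) = len f := by
  rw [len_eq_sum_range f _ (Nat.lt_succ_self _),
    len_eq_sum_range (-f) (f.natDegree + 1) (by rw [natDegree_neg]; omega)]
  simp

theorem len_units_smul (ε : ℤˣ) (f : ℤ[X]) : len (ε • f) = len f := by
  rcases Int.units_eq_one_or ε with rfl | rfl
  · simp
  · rw [Units.neg_smul, one_smul, len_neg]

/-- Leibniz expansion: `n!` signed products of `n` entries, and `len` is subadditive and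
submultiplicative. -/
theorem len_det_le {n : ℕ} (M : Matrix (Fin n) (Fin n) ℤ[X]) {H : ℤ}
    (hM : ∀ a b, len (M a b) ≤ H) : len M.det ≤ n.factorial * H ^ n := by
  rw [Matrix.det_apply]
  refine (len_sum_le _ _).trans ?_
  calc ∑ σ : Equiv.Perm (Fin n), len (Equiv.Perm.sign σ • ∏ a, M (σ a) a)
      ≤ ∑ σ : Equiv.Perm (Fin n), H ^ n := Finset.sum_le_sum fun σ _ => by
        rw [len_units_smul]
        simpa using len_prod_le Finset.univ (fun a => M (σ a) a) fun a _ => hM _ _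
    _ = n.factorial * H ^ n := by simp [Fintype.card_perm]

theorem natDegree_det_le {n d : ℕ} (M : Matrix (Fin n) (Fin n) ℤ[X])
    (hM : ∀ a b, (M a b).natDegree ≤ d) : M.det.natDegree ≤ n * d := by
  rw [Matrix.det_apply]
  refine natDegree_sum_le_of_forall_le _ _ fun σ _ => ?_
  have h1 : (Equiv.Perm.sign σ • ∏ a, M (σ a) a).natDegree ≤ (∏ a, M (σ a) a).natDegree := by
    rcases Int.units_eq_one_or (Equiv.Perm.sign σ) with h | h <;> rw [h]
    · simp
    · rw [Units.neg_smul, one_smul, natDegree_neg]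
  refine h1.trans ((natDegree_prod_le _ _).trans ?_)
  simpa using Finset.sum_le_sum fun a (_ : a ∈ Finset.univ) => hM (σ a) a

/-- All roots lie on the unit circle, so the coefficients are at most the binomial coefficients of
the degree, which is at most `L`. -/
theorem abs_coeff_cyclotomic_le (L j : ℕ) : |(cyclotomic L ℤ).coeff j| ≤ 2 ^ L := by
  rcases Nat.eq_zero_or_pos L with rfl | hL
  · rw [cyclotomic_zero, coeff_one]
    split_ifs <;> simp
  have h := coeff_le_of_roots_le (p := cyclotomic L ℤ) (f := Int.castRingHom ℂ) (B := 1) j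
    (cyclotomic.monic L ℤ) (IsAlgClosed.splits _) (fun z hz => by
      rw [map_cyclotomic] at hz
      have hz' := isRoot_of_mem_roots hz
      have : NeZero (L : ℂ) := ⟨by exact_mod_cast hL.ne'⟩
      rw [isRoot_cyclotomic_iff] at hz'
      exact (hz'.norm'_eq_one hL.ne').le)
  rw [coeff_map, one_pow, one_mul] at h
  have h1 : ‖(Int.castRingHom ℂ) ((cyclotomic L ℤ).coeff j)‖ =
      ((|(cyclotomic L ℤ).coeff j| : ℤ) : ℝ) := by simp
  rw [h1] at h
  have h2 : (cyclotomic L ℤ).natDegree.choose j ≤ 2 ^ L := by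
    refine (Nat.choose_le_two_pow _ _).trans (Nat.pow_le_pow_right two_pos ?_)
    rw [natDegree_cyclotomic]
    exact Nat.totient_le L
  have h3 : ((|(cyclotomic L ℤ).coeff j| : ℤ) : ℝ) ≤ ((2 ^ L : ℤ) : ℝ) :=
    h.trans (by exact_mod_cast h2)
  exact_mod_cast h3

/-- If a polynomial in a transcendental number and an integral element vanishes, then all its
coefficients with respect to the transcendental number vanish. -/
theorem sum_coeff_eq_zero_of_transcendental {t ω : ℂ} (ht : Transcendental ℤ t)
    (hω : IsIntegral ℤ ω) {N L : ℕ} {c : ℕ → ℕ → ℤ}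
    (h : ∑ r ∈ Finset.range N, (∑ s ∈ Finset.range L, (c r s : ℂ) * ω ^ s) * t ^ r = 0) :
    ∀ r < N, ∑ s ∈ Finset.range L, (c r s : ℂ) * ω ^ s = 0 := by
  intro r hr
  -- A number transcendental over `ℤ` remains so over the ring of algebraic integers, where the
  -- inner sums lie.
  have ht' := ht.integralClosure
  let w : integralClosure ℤ ℂ := ⟨ω, hω⟩
  let b : ℕ → integralClosure ℤ ℂ := fun r =>
    ∑ s ∈ Finset.range L, (c r s : integralClosure ℤ ℂ) * w ^ s
  have hb : ∀ r, (b r : ℂ) = ∑ s ∈ Finset.range L, (c r s : ℂ) * ω ^ s := by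
    intro r
    simp [b, w]
  let F : (integralClosure ℤ ℂ)[X] := ∑ r ∈ Finset.range N, C (b r) * X ^ r
  have hF : aeval t F = 0 := by
    rw [← h, map_sum]
    refine Finset.sum_congr rfl fun r _ => ?_
    rw [← hb]
    simp [Algebra.algebraMap_eq_smul_one, Subalgebra.smul_def]
  have hF0 : F = 0 := by
    by_contra hne
    exact ht' ⟨F, hne, hF⟩
  have hcoeff : F.coeff r = b r := by
    simp only [F, finsetSum_coeff, coeff_C_mul, coeff_X_pow]
    simp [hr]
  rw [← hb, ← hcoeff, hF0]
  simp

/-- The cyclotomic polynomial is the minimal polynomial of `ω`. As the divisibility does not mention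
`ω`, a relation passes to every other primitive root, in `ℂ` or modulo `p`. -/
theorem sum_eq_zero_iff_cyclotomic_dvd {ω : ℂ} {L : ℕ} (hL : 0 < L) (hω : IsPrimitiveRoot ω L)
    (c : ℕ → ℤ) : ∑ s ∈ Finset.range L, (c s : ℂ) * ω ^ s = 0 ↔
      cyclotomic L ℤ ∣ ∑ s ∈ Finset.range L, C (c s) * X ^ s := by
  rw [cyclotomic_eq_minpoly hω hL, ← minpoly.isIntegrallyClosed_dvd_iff (hω.isIntegral hL)]
  simp

theorem sum_eq_zero_of_cyclotomic_dvd {p L : ℕ} [Fact p.Prime] (hL : 0 < L) {z : ZMod p}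
    (hz : IsPrimitiveRoot z L) {c : ℕ → ℤ}
    (h : cyclotomic L ℤ ∣ ∑ s ∈ Finset.range L, C (c s) * X ^ s) :
    ∑ s ∈ Finset.range L, (c s : ZMod p) * z ^ s = 0 := by
  obtain ⟨g, hg⟩ := h
  have h1 := congrArg (aeval z) hg
  have h2 : aeval z (cyclotomic L ℤ) = 0 := by
    have := hz.isRoot_cyclotomic hL
    rwa [IsRoot, ← map_cyclotomic_int, eval_map, ← algebraMap_int_eq, ← aeval_def] at this
  rw [map_mul, h2, zero_mul] at h1
  simpa using h1

/-- In `ℂ` only the relations forced by the cyclotomic polynomial occur, separately for each power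
of `t`; these hold modulo `p` for every `x`. -/
theorem sum_eq_zero_of_sum_eq_zero {p L N : ℕ} [Fact p.Prime] (hL : 0 < L) {z : ZMod p}
    (hz : IsPrimitiveRoot z L) (x : ZMod p) {t ω : ℂ} (ht : Transcendental ℤ t)
    (hω : IsPrimitiveRoot ω L) {c : ℕ → ℕ → ℤ}
    (h : ∑ r ∈ Finset.range N, (∑ s ∈ Finset.range L, (c r s : ℂ) * ω ^ s) * t ^ r = 0) :
    ∑ r ∈ Finset.range N, (∑ s ∈ Finset.range L, (c r s : ZMod p) * z ^ s) * x ^ r = 0 := by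
  refine Finset.sum_eq_zero fun r hr => ?_
  have h1 := sum_coeff_eq_zero_of_transcendental ht (hω.isIntegral hL) h r (Finset.mem_range.1 hr)
  rw [sum_eq_zero_of_cyclotomic_dvd hL hz ((sum_eq_zero_iff_cyclotomic_dvd hL hω _).1 h1),
    zero_mul]

/-- A bound for the degree and the coefficients of the resultant of the `L`-th cyclotomic
polynomial and a polynomial with `N * L` coefficients bounded by `H`. -/
def resultantBound (L N H : ℤ) : ℤ :=
  (2 * L * (2 ^ L.toNat + N * H + 1)) ^ (2 * L).toNat + 2 * L * N

/-- Regard the sum as a polynomial `P` in the root of unity with coefficients in `ℤ[X]`. Its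
resultant with the cyclotomic polynomial is nonzero because of the complex value, and vanishes at
`x` modulo `p` because of the value there. The Sylvester determinant bounds its size. -/
theorem annihilated_of_sum_eq_zero {p L N : ℕ} [Fact p.Prime] (hL : 0 < L) {z : ZMod p}
    (hz : IsPrimitiveRoot z L) (x : ℤ) {t ω : ℂ} (ht : Transcendental ℤ t)
    (hω : IsPrimitiveRoot ω L) {c : ℕ → ℕ → ℤ} {H : ℤ} (hH : 0 ≤ H)
    (hc : ∀ r < N, ∀ s < L, |c r s| ≤ H)
    (hne : ∑ r ∈ Finset.range N, (∑ s ∈ Finset.range L, (c r s : ℂ) * ω ^ s) * t ^ r ≠ 0)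
    (h : ∑ r ∈ Finset.range N, (∑ s ∈ Finset.range L, (c r s : ZMod p) * z ^ s) * (x : ZMod p) ^ r
      = 0) : Annihilated p x (resultantBound L N H) := by
  let g : ℕ → ℤ[X] := fun s => ∑ r ∈ Finset.range N, C (c r s) * X ^ r
  let P : ℤ[X][X] := ∑ s ∈ Finset.range L, C (g s) * X ^ s
  let Φ : ℤ[X][X] := (cyclotomic L ℤ).map C
  have hΦd : Φ.natDegree = L.totient := by
    rw [← natDegree_cyclotomic L ℤ]
    exact natDegree_map_eq_of_injective C_injective _
  have hPd : P.natDegree ≤ L := by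
    refine natDegree_sum_le_of_forall_le _ _ fun s hs => ?_
    exact (natDegree_C_mul_X_pow_le _ _).trans (Finset.mem_range.1 hs).le
  have heval : ∀ {S : Type} [CommRing S] (a b : S),
      eval₂ (aeval a : ℤ[X] →ₐ[ℤ] S).toRingHom b P =
        ∑ r ∈ Finset.range N, (∑ s ∈ Finset.range L, (c r s : S) * b ^ s) * a ^ r := by
    intro S _ a b
    simp only [P, g, eval₂_finsetSum, eval₂_mul, eval₂_C, eval₂_pow, eval₂_X, Finset.sum_mul]
    rw [Finset.sum_comm]
    refine Finset.sum_congr rfl fun s _ => ?_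
    simp only [AlgHom.toRingHom_eq_coe, RingHom.coe_coe, map_sum, Finset.sum_mul]
    refine Finset.sum_congr rfl fun r _ => ?_
    simp
    ring
  have hΦmap : ∀ {S : Type} [CommRing S] (a : S),
      Φ.map (aeval a : ℤ[X] →ₐ[ℤ] S).toRingHom = cyclotomic L S := by
    intro S _ a
    simp only [Φ]
    rw [map_cyclotomic, map_cyclotomic]
  -- The formal degree `L` of `P` fixes the size of the Sylvester matrix whatever the true degree
  -- is; this is harmless because the cyclotomic polynomial is monic.
  set Q : ℤ[X] := resultant Φ P L.totient L with hQ
  -- `Q` at `t` is the product of the values of `P` at all primitive roots `w`. If one factor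
  -- vanished, its relations would carry over from `w` to `ω`, contradicting `hne`.
  have hQ0 : Q ≠ 0 := by
    intro h0
    have h1 := resultant_map_map Φ P L.totient L (aeval t : ℤ[X] →ₐ[ℤ] ℂ).toRingHom
    rw [← hQ, h0, map_zero, hΦmap, ← natDegree_cyclotomic L ℂ,
      resultant_eq_prod_eval _ _ _ (natDegree_map_le.trans hPd) (IsAlgClosed.splits _),
      (cyclotomic.monic L ℂ).leadingCoeff, one_pow, one_mul, Multiset.prod_eq_zero_iff,
      Multiset.mem_map] at h1
    obtain ⟨w, hw, h2⟩ := h1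
    have : NeZero (L : ℂ) := ⟨by exact_mod_cast hL.ne'⟩
    have hw' := isRoot_of_mem_roots hw
    rw [isRoot_cyclotomic_iff] at hw'
    rw [eval_map, heval] at h2
    refine hne (Finset.sum_eq_zero fun r hr => ?_)
    have h3 := sum_coeff_eq_zero_of_transcendental ht (hw'.isIntegral hL) h2 r
      (Finset.mem_range.1 hr)
    rw [(sum_eq_zero_iff_cyclotomic_dvd hL hω _).2
      ((sum_eq_zero_iff_cyclotomic_dvd hL hw' _).1 h3), zero_mul]
  -- The resultant is a combination of the two polynomials, both of which vanish at `z` modulo `p`.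
  have hQx : (p : ℤ) ∣ Q.eval x := by
    rw [← ZMod.intCast_zmod_eq_zero_iff_dvd]
    obtain ⟨A, B, -, -, hAB⟩ := exists_mul_add_mul_eq_C_resultant Φ P hΦd.le hPd
      (Or.inr hL.ne')
    have h1 := congrArg (eval₂ (aeval (x : ZMod p) : ℤ[X] →ₐ[ℤ] ZMod p).toRingHom z) hAB
    rw [eval₂_add, eval₂_mul, eval₂_mul, heval, h, zero_mul, add_zero, ← eval_map, hΦmap,
      hz.isRoot_cyclotomic hL, zero_mul, eval₂_C, ← hQ] at h1
    have h2 : ((Q.eval x : ℤ) : ZMod p) = aeval (x : ZMod p) Q := by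
      have := aeval_algebraMap_apply (R := ℤ) (A := ℤ) (ZMod p) x Q
      simpa using this.symm
    rw [h2]
    exact h1.symm
  have hgcoeff : ∀ k, P.coeff k = if k < L then g k else 0 := by
    intro k
    simp only [P, finsetSum_coeff, coeff_C_mul, coeff_X_pow]
    simp
  have hglen : ∀ s < L, len (g s) ≤ N * H := by
    intro s hs
    refine (len_sum_le _ _).trans ?_
    calc ∑ r ∈ Finset.range N, len (C (c r s) * X ^ r)
        ≤ ∑ r ∈ Finset.range N, H := Finset.sum_le_sum fun r hr => by
          have := len_C_mul_X_pow_mul (c r s) r 1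
          rw [mul_one, len_one, mul_one] at this
          exact this.trans (hc r (Finset.mem_range.1 hr) s hs)
      _ = N * H := by simp
  have hgdeg : ∀ s, (g s).natDegree ≤ N := fun s =>
    natDegree_sum_le_of_forall_le _ _ fun r hr =>
      (natDegree_C_mul_X_pow_le _ _).trans (Finset.mem_range.1 hr).le
  -- `2 ^ L` bounds the cyclotomic entries of the Sylvester matrix and `N * H` those from `P`; the
  -- `1` ensures that powers of `T` increase.
  set T : ℤ := 2 ^ L + N * H + 1 with hT
  have hNH : 0 ≤ N * H := by positivity
  have h2L : (0 : ℤ) ≤ 2 ^ L := by positivity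
  have hT1 : 1 ≤ T := by linarith
  have hPlen : ∀ k, len (P.coeff k) ≤ T := by
    intro k
    rw [hgcoeff]
    split_ifs with hk
    · have := hglen k hk
      linarith
    · rw [len_zero]; linarith
  have hΦlen : ∀ k, len (Φ.coeff k) ≤ T := by
    intro k
    have h1 := abs_coeff_cyclotomic_le L k
    have h2 := len_C_mul_X_pow_mul ((cyclotomic L ℤ).coeff k) 0 1
    rw [len_one, mul_one, pow_zero, mul_one, mul_one] at h2
    rw [coeff_map]
    linarith
  have hsylv : ∀ a b, len (sylvester Φ P L.totient L a b) ≤ T := by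
    intro a b
    induction b using Fin.addCases <;> simp only [sylvester, Matrix.of_apply, Fin.addCases_left,
      Fin.addCases_right] <;> split_ifs
    · exact hPlen _
    · rw [len_zero]; linarith
    · exact hΦlen _
    · rw [len_zero]; linarith
  have hsylvd : ∀ a b, (sylvester Φ P L.totient L a b).natDegree ≤ N := by
    intro a b
    induction b using Fin.addCases <;> simp only [sylvester, Matrix.of_apply, Fin.addCases_left,
      Fin.addCases_right] <;> split_ifs
    · rw [hgcoeff]
      split_ifs
      · exact hgdeg _
      · simp
    · simp
    · rw [coeff_map, natDegree_C]
      exact Nat.zero_le _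
    · simp
  have htot := Nat.totient_le L
  have hdeg : (Q.natDegree : ℤ) ≤ 2 * L * N := by
    have h1 := natDegree_det_le _ hsylvd
    have h2 : (L.totient + L) * N ≤ 2 * L * N := Nat.mul_le_mul_right _ (by omega)
    exact_mod_cast h1.trans h2
  have hlen : len Q ≤ (2 * L * T) ^ (2 * L) := by
    have h1 := len_det_le _ hsylv
    have h2 : ((L.totient + L).factorial : ℤ) ≤ (2 * L) ^ (2 * L) := by
      have h3 : (L.totient + L).factorial ≤ (2 * L) ^ (2 * L) :=
        (Nat.factorial_le (by omega)).trans (Nat.factorial_le_pow _)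
      exact_mod_cast h3
    have h4 : T ^ (L.totient + L) ≤ T ^ (2 * L) := pow_le_pow_right₀ hT1 (by omega)
    rw [mul_pow]
    exact h1.trans (mul_le_mul h2 h4 (by positivity) (by positivity))
  have hB : resultantBound L N H = (2 * L * T) ^ (2 * L) + 2 * L * N := by
    rw [resultantBound, Int.toNat_natCast, ← hT, show (2 * (L : ℤ)).toNat = 2 * L by omega]
  have hp1 : 0 ≤ (2 * (L : ℤ) * T) ^ (2 * L) := by positivity
  have hp2 : 0 ≤ 2 * (L : ℤ) * N := by positivity
  exact ⟨Q, hQ0, by rw [hB]; linarith, fun j => by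
    have := abs_coeff_le_len Q j
    rw [hB]
    linarith, hQx⟩

end Resultant

/-! ### Normal forms of exponential sums at a single index -/

section Local

open Finset

/-- A representative of `e ^ n` modulo the prime `p`. -/
def epow (p e n : ℤ) : ℤ := e ^ (n % (p - 1)).toNat

/-- The value modulo `p` of an exponential sum. -/
def valZ (p e i u : ℤ) (K : Finset ℤ) (a r s : ℤ → ℤ) : ℤ :=
  ∑ k ∈ K, a k * epow p e (r k * u + s k * (i * u))

/-- The complex value of an exponential sum. -/
def valP (l : ℤ) (t : ℝ) (K : Finset ℤ) (a r s : ℤ → ℤ) : ℂ :=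
  ∑ k ∈ K, (a k : ℂ) * Complex.exp (-(r k * (2 * t / l))) *
    Complex.exp (-(s k * (2 * Real.pi * Complex.I / l)))

/-- The index set of a normal form. -/
def nfIdx (R l : ℤ) : Finset ℤ := Ico 0 ((2 * R + 1) * l)

/-- The first exponents of a normal form. -/
def nfR (R l k : ℤ) : ℤ := k / l - R

/-- The second exponents of a normal form. -/
def nfS (l k : ℤ) : ℤ := k % l

/-- The coefficients of the normal form of an exponential sum. -/
def nfCoeff (R l : ℤ) (K : Finset ℤ) (a r s : ℤ → ℤ) (k : ℤ) : ℤ :=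
  ∑ n ∈ K with (r n + R) * l + s n % l = k, a n

/-- Pairs with first entry in `[-R, R]` and second in `[0, l)` are numbered by `(r + R) * l + s`,
and terms are collected by number. Only periodicity in `s` is used, so both values get the same
coefficients. -/
theorem sum_eq_sum_nfCoeff {S : Type*} [CommRing S] {R l : ℤ} (hl : 0 < l) {K : Finset ℤ}
    {a r s : ℤ → ℤ} (hr : ∀ n ∈ K, |r n| ≤ R) (G : ℤ → ℤ → S) (hG : ∀ x y, G x (y % l) = G x y) :
    ∑ n ∈ K, (a n : S) * G (r n) (s n) =
      ∑ k ∈ nfIdx R l, (nfCoeff R l K a r s k : S) * G (nfR R l k) (nfS l k) := by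
  have hmaps : ∀ n ∈ K, (r n + R) * l + s n % l ∈ nfIdx R l := by
    intro n hn
    have h1 := abs_le.1 (hr n hn)
    have h2 := Int.emod_nonneg (s n) hl.ne'
    have h3 := Int.emod_lt_of_pos (s n) hl
    rw [nfIdx, mem_Ico]
    constructor
    · have : 0 ≤ (r n + R) * l := mul_nonneg (by linarith) hl.le
      linarith
    · have : (r n + R) * l ≤ (2 * R) * l := mul_le_mul_of_nonneg_right (by linarith) hl.le
      linarith
  rw [← sum_fiberwise_of_maps_to hmaps]
  refine sum_congr rfl fun k _ => ?_
  rw [nfCoeff, Int.cast_sum, sum_mul]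
  refine sum_congr rfl fun n hn => ?_
  obtain ⟨-, rfl⟩ := mem_filter.1 hn
  have h2 := Int.emod_nonneg (s n) hl.ne'
  have h3 := Int.emod_lt_of_pos (s n) hl
  rw [nfR, nfS, Int.add_comm, Int.add_mul_ediv_right _ _ hl.ne', Int.ediv_eq_zero_of_lt h2 h3,
    Int.add_mul_emod_self_right, Int.emod_emod, hG]
  congr 2
  ring

theorem abs_nfCoeff_le {R l A : ℤ} {K : Finset ℤ} {a r s : ℤ → ℤ} (ha : ∀ n ∈ K, |a n| ≤ A)
    (hA : 0 ≤ A) (k : ℤ) : |nfCoeff R l K a r s k| ≤ #K * A := by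
  refine (abs_sum_le_sum_abs _ _).trans ?_
  refine (sum_le_card_nsmul _ _ A fun n hn => ha n (mem_filter.1 hn).1).trans ?_
  rw [nsmul_eq_mul]
  exact mul_le_mul_of_nonneg_right (by exact_mod_cast card_filter_le _ _) hA

/-- A nonzero coefficient comes from an actual term, so enlarging the window `R` does not enlarge
the support. -/
theorem abs_nfR_le_of_nfCoeff_ne_zero {R l B : ℤ} (hl : 0 < l) {K : Finset ℤ} {a r s : ℤ → ℤ}
    (hr : ∀ n ∈ K, |r n| ≤ B) {k : ℤ} (hk : nfCoeff R l K a r s k ≠ 0) : |nfR R l k| ≤ B := by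
  obtain ⟨n, hn, -⟩ := exists_ne_zero_of_sum_ne_zero hk
  obtain ⟨hnK, rfl⟩ := mem_filter.1 hn
  have h2 := Int.emod_nonneg (s n) hl.ne'
  have h3 := Int.emod_lt_of_pos (s n) hl
  rw [nfR, Int.add_comm, Int.add_mul_ediv_right _ _ hl.ne', Int.ediv_eq_zero_of_lt h2 h3]
  convert hr n hnK using 2
  ring

variable {p e i l u : ℤ}

theorem epow_congr {a b : ℤ} (h : p - 1 ∣ a - b) : epow p e a = epow p e b := by
  rw [epow, epow, show a % (p - 1) = b % (p - 1) from (Int.modEq_iff_dvd.2 h).symm]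

/-- Reducing `s` modulo `l` changes the exponent by a multiple of `l * i * u = p - 1`. The equality
holds in `ℤ` because `epow` reduces exponents first. -/
theorem LocalScale.valZ_eq (hs : LocalScale p e i l u) {R : ℤ} {K : Finset ℤ} {a r s : ℤ → ℤ}
    (hr : ∀ n ∈ K, |r n| ≤ R) : valZ p e i u K a r s =
      valZ p e i u (nfIdx R l) (nfCoeff R l K a r s) (nfR R l) (nfS l) := by
  have := sum_eq_sum_nfCoeff (S := ℤ) (a := a) (s := s) hs.l_pos hr
    (fun x y => epow p e (x * u + y * (i * u))) fun x y => epow_congr ⟨-(y / l), ?_⟩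
  · simpa [valZ] using this
  · have h1 := Int.emod_add_mul_ediv y l
    rw [← hs.unit]
    linear_combination (i * u) * h1

theorem valP_eq (hl : 0 < l) (t : ℝ) {R : ℤ} {K : Finset ℤ} {a r s : ℤ → ℤ}
    (hr : ∀ n ∈ K, |r n| ≤ R) : valP l t K a r s =
      valP l t (nfIdx R l) (nfCoeff R l K a r s) (nfR R l) (nfS l) := by
  have hl' : (l : ℂ) ≠ 0 := by exact_mod_cast hl.ne'
  have := sum_eq_sum_nfCoeff (S := ℂ) (a := a) (s := s) hl hr
    (fun x y => Complex.exp (-(x * (2 * t / l))) *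
      Complex.exp (-(y * (2 * Real.pi * Complex.I / l)))) fun x y => ?_
  · simpa [valP, mul_assoc] using this
  · congr 1
    rw [Complex.exp_eq_exp_iff_exists_int]
    refine ⟨y / l, ?_⟩
    have h1 : ((y % l : ℤ) : ℂ) + l * ((y / l : ℤ) : ℂ) = y := by
      exact_mod_cast Int.emod_add_mul_ediv y l
    rw [← h1]
    field_simp
    ring

theorem sum_Ico_mul_eq {S : Type*} [AddCommMonoid S] (N L : ℕ) (hL : 0 < L) (F : ℤ → S) :
    ∑ k ∈ Ico (0 : ℤ) (N * L), F k = ∑ r ∈ range N, ∑ s ∈ range L, F (r * L + s) := by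
  rw [← sum_product']
  symm
  refine sum_nbij' (fun x => (x.1 * L + x.2 : ℤ)) (fun k => ((k / L).toNat, (k % L).toNat))
    ?_ ?_ ?_ ?_ (fun _ _ => rfl)
  · rintro ⟨r, s⟩ h
    simp only [mem_product, mem_range] at h
    simp only [mem_Ico]
    refine ⟨by positivity, ?_⟩
    have : r * L + s < N * L := by nlinarith
    exact_mod_cast this
  · intro k hk
    rw [mem_Ico] at hk
    lift k to ℕ using hk.1
    have h1 : k < N * L := by exact_mod_cast hk.2
    simp only [mem_product, mem_range]
    constructor
    · have : k / L < N := Nat.div_lt_of_lt_mul (by rwa [mul_comm])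
      exact_mod_cast this
    · exact_mod_cast Nat.mod_lt k hL
  · rintro ⟨r, s⟩ h
    simp only [mem_product, mem_range] at h
    have h1 : ((r : ℤ) * L + s) / L = r := by
      rw [add_comm, Int.add_mul_ediv_right _ _ (by omega), Int.ediv_eq_zero_of_lt (by omega)
        (by omega), zero_add]
    have h2 : ((r : ℤ) * L + s) % L = s := by
      rw [add_comm, Int.add_mul_emod_self_right, Int.emod_eq_of_lt (by omega) (by omega)]
    simp [h1, h2]
  · intro k hk
    rw [mem_Ico] at hk
    have h1 : 0 ≤ k / L := Int.ediv_nonneg hk.1 (by omega)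
    have h2 := Int.emod_nonneg k (b := L) (by omega)
    simp only [Int.toNat_of_nonneg h1, Int.toNat_of_nonneg h2]
    have := Int.emod_add_mul_ediv k L
    linarith

/-- The coefficient of a normal form, an element of the `l`-th cyclotomic field. -/
def block (l : ℤ) (c : ℤ → ℤ) (r : ℕ) : ℂ :=
  ∑ s ∈ range l.toNat, (c (r * l + s) : ℂ) * Complex.exp (-(2 * Real.pi * Complex.I / l)) ^ s

theorem nf_index {l : ℤ} (r s : ℕ) (hs : s < l.toNat) (R : ℤ) :
    nfR R l (r * l + s) = r - R ∧ nfS l (r * l + s) = s := by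
  have hl : 0 < l := by omega
  rw [nfR, nfS, add_comm, Int.add_mul_ediv_right _ _ hl.ne', Int.ediv_eq_zero_of_lt (by omega)
    (by omega), zero_add, Int.add_mul_emod_self_right, Int.emod_eq_of_lt (by omega) (by omega)]
  exact ⟨rfl, rfl⟩

theorem sum_nfIdx {S : Type*} [AddCommMonoid S] {R : ℤ} (hR : 0 ≤ R) (hl : 0 < l) (F : ℤ → S) :
    ∑ k ∈ nfIdx R l, F k =
      ∑ r ∈ range (2 * R + 1).toNat, ∑ s ∈ range l.toNat, F (r * l + s) := by
  have := sum_Ico_mul_eq (2 * R + 1).toNat l.toNat (by omega) F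
  rwa [Int.toNat_of_nonneg (by omega), Int.toNat_of_nonneg hl.le] at this

/-- Splitting off an invertible factor turns a Laurent polynomial into a polynomial;
`LocalScale.cast_valZ_nf` is the counterpart modulo `p`. -/
theorem valP_nf (hl : 0 < l) (t : ℝ) {R : ℤ} (hR : 0 ≤ R) (c : ℤ → ℤ) :
    valP l t (nfIdx R l) c (nfR R l) (nfS l) = Complex.exp (R * (2 * t / l)) *
      ∑ r ∈ range (2 * R + 1).toNat, block l c r * Complex.exp (-(2 * t / l)) ^ r := by
  rw [valP, sum_nfIdx hR hl, mul_sum]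
  refine sum_congr rfl fun r _ => ?_
  rw [block, sum_mul, mul_sum]
  refine sum_congr rfl fun s hs => ?_
  obtain ⟨h1, h2⟩ := nf_index r s (mem_range.1 hs) R
  rw [h1, h2, ← Complex.exp_nat_mul, ← Complex.exp_nat_mul]
  have h3 : Complex.exp (-(((r - R : ℤ) : ℂ) * (2 * t / l))) =
      Complex.exp (R * (2 * t / l)) * Complex.exp (r * -(2 * t / l)) := by
    rw [← Complex.exp_add]
    congr 1
    push_cast
    ring
  rw [h3]
  push_cast
  rw [mul_neg (s : ℂ)]
  ring

/-- The inverse of its `l`-th power is the square of `exp t`, and algebraicity passes through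
powers, inverses and roots. -/
theorem transcendental_exp_div (hl : 0 < l) {t : ℝ} (ht : Transcendental ℚ (Real.exp t)) :
    Transcendental ℤ (Complex.exp (-(2 * t / l))) := by
  intro halg
  have h0 : IsAlgebraic ℚ (Complex.exp (-(2 * t / l))) :=
    halg.extendScalars (R := ℤ) (S := ℚ) (algebraMap ℤ ℚ).injective_int
  have h1 := ((h0.pow l.toNat).inv)
  have h2 : (Complex.exp (-(2 * t / l)) ^ l.toNat)⁻¹ = (Complex.exp t) ^ 2 := by
    rw [← Complex.exp_nat_mul, ← Complex.exp_neg, ← Complex.exp_nat_mul]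
    congr 1
    have hl' : (l : ℂ) ≠ 0 := by exact_mod_cast hl.ne'
    have h3 : ((l.toNat : ℕ) : ℂ) = l := by
      have := Int.toNat_of_nonneg hl.le
      exact_mod_cast congrArg (Int.cast : ℤ → ℂ) this
    rw [h3]
    push_cast
    field_simp
  rw [h2] at h1
  have h3 := IsAlgebraic.of_pow two_pos h1
  rw [← Complex.ofReal_exp] at h3
  exact ht ((isAlgebraic_algebraMap_iff (R := ℚ) (A := ℂ) Complex.ofReal_injective).1 h3)

theorem isPrimitiveRoot_exp_neg (hl : 0 < l) :
    IsPrimitiveRoot (Complex.exp (-(2 * Real.pi * Complex.I / l))) l.toNat := by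
  have h := (Complex.isPrimitiveRoot_exp l.toNat (by omega)).inv
  have h3 : ((l.toNat : ℕ) : ℂ) = l := by
    have := Int.toNat_of_nonneg hl.le
    exact_mod_cast congrArg (Int.cast : ℤ → ℂ) this
  rwa [← Complex.exp_neg, h3] at h

/-- The complex value determines each block of the normal form; this is what later detects which
first exponents really occur. -/
theorem valP_nf_eq_zero_iff (hl : 0 < l) {t : ℝ} (ht : Transcendental ℚ (Real.exp t)) {R : ℤ}
    (hR : 0 ≤ R) (c : ℤ → ℤ) :
    valP l t (nfIdx R l) c (nfR R l) (nfS l) = 0 ↔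
      ∀ r < (2 * R + 1).toNat, block l c r = 0 := by
  rw [valP_nf hl t hR, mul_eq_zero, or_iff_right (Complex.exp_ne_zero _)]
  constructor
  · intro h
    exact sum_coeff_eq_zero_of_transcendental (c := fun r s => c (r * l + s))
      (transcendental_exp_div hl ht) ((isPrimitiveRoot_exp_neg hl).isIntegral (by omega)) h
  · intro h
    exact sum_eq_zero fun r hr => by rw [h r (mem_range.1 hr), zero_mul]

theorem LocalScale.cast_ne_zero (hs : LocalScale p e i l u) : (e : ZMod p.natAbs) ≠ 0 := by
  have h := hs.not_dvd
  contrapose! h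
  rw [ZMod.intCast_zmod_eq_zero_iff_dvd, Int.natAbs_of_nonneg hs.pos.le] at h
  exact h

theorem LocalScale.cast_eq_zero_iff (hs : LocalScale p e i l u) (a : ℤ) :
    (a : ZMod p.natAbs) = 0 ↔ p ∣ a := by
  rw [ZMod.intCast_zmod_eq_zero_iff_dvd, Int.natAbs_of_nonneg hs.pos.le]

theorem LocalScale.cast_epow [Fact p.natAbs.Prime] (hs : LocalScale p e i l u) (n : ℤ) :
    (epow p e n : ZMod p.natAbs) = (e : ZMod p.natAbs) ^ n := by
  have h0 := hs.cast_ne_zero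
  have hp := hs.prime.two_le
  have h1 : (e : ZMod p.natAbs) ^ (p - 1) = 1 := by
    have h2 := ZMod.pow_card_sub_one_eq_one h0
    have h3 : p - 1 = ((p.natAbs - 1 : ℕ) : ℤ) := by
      have := hs.pos
      omega
    rw [h3, zpow_natCast, h2]
  have h4 := Int.emod_nonneg n (b := p - 1) (by have := hs.pos; omega)
  rw [epow, Int.cast_pow, ← zpow_natCast, Int.toNat_of_nonneg h4]
  conv_rhs => rw [← Int.emod_add_mul_ediv n (p - 1), zpow_add₀ h0, zpow_mul, h1, one_zpow, mul_one]

theorem LocalScale.isPrimitiveRoot [Fact p.natAbs.Prime] (hs : LocalScale p e i l u) :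
    IsPrimitiveRoot ((e : ZMod p.natAbs) ^ (i * u)) l.toNat := by
  have h0 := hs.cast_ne_zero
  have hi := hs.i_pos
  have hu := hs.u_pos
  have hl := hs.l_pos
  have hiu : 0 < i * u := mul_pos hi hu
  have hnat : (e : ZMod p.natAbs) ^ (i * u) = ((e ^ (i * u).toNat : ℤ) : ZMod p.natAbs) := by
    rw [Int.cast_pow, ← zpow_natCast, Int.toNat_of_nonneg hiu.le]
  have hpow : ∀ k : ℕ, ((e : ZMod p.natAbs) ^ (i * u)) ^ k = 1 ↔
      p ∣ e ^ ((i * u).toNat * k) - 1 := by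
    intro k
    rw [hnat, ← Int.cast_pow, ← pow_mul, ← hs.cast_eq_zero_iff, Int.cast_sub, Int.cast_one,
      sub_eq_zero]
  constructor
  · have h1 := hs.cast_epow (p - 1)
    rw [← zpow_natCast, ← zpow_mul, Int.toNat_of_nonneg hl.le,
      show i * u * l = p - 1 by rw [← hs.unit]; ring, ← h1, epow, Int.emod_self]
    simp
  · intro k hk
    have h1 := hs.order _ ((hpow k).1 hk)
    rw [Nat.cast_mul, Int.toNat_of_nonneg hiu.le, ← hs.unit,
      show i * l * u = i * u * l by ring] at h1
    have h2 := Int.dvd_of_mul_dvd_mul_left hiu.ne' h1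
    rw [← Int.toNat_of_nonneg hl.le] at h2
    exact_mod_cast h2

theorem LocalScale.cast_valZ_nf [Fact p.natAbs.Prime] (hs : LocalScale p e i l u) {R : ℤ}
    (hR : 0 ≤ R) (c : ℤ → ℤ) :
    (valZ p e i u (nfIdx R l) c (nfR R l) (nfS l) : ZMod p.natAbs) =
      (e : ZMod p.natAbs) ^ (-R * u) * ∑ r ∈ range (2 * R + 1).toNat,
        (∑ s ∈ range l.toNat, (c (r * l + s) : ZMod p.natAbs) *
          ((e : ZMod p.natAbs) ^ (i * u)) ^ s) * ((e ^ u.toNat : ℤ) : ZMod p.natAbs) ^ r := by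
  have h0 := hs.cast_ne_zero
  rw [valZ, sum_nfIdx hR hs.l_pos, Int.cast_sum, mul_sum]
  refine sum_congr rfl fun r _ => ?_
  rw [Int.cast_sum, sum_mul, mul_sum]
  refine sum_congr rfl fun s hs' => ?_
  obtain ⟨h1, h2⟩ := nf_index r s (mem_range.1 hs') R
  rw [h1, h2, Int.cast_mul, hs.cast_epow, Int.cast_pow, ← zpow_natCast _ u.toNat,
    Int.toNat_of_nonneg hs.u_pos.le, ← zpow_natCast _ s, ← zpow_natCast _ r, ← zpow_mul, ← zpow_mul,
    show ((r : ℤ) - R) * u + s * (i * u) = -R * u + (i * u * s + u * r) by ring,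
    zpow_add₀ h0, zpow_add₀ h0]
  ring

/-- The two values of a normal form with small coefficients vanish simultaneously. -/
theorem LocalScale.dvd_valZ_nf_iff (hs : LocalScale p e i l u) {t : ℝ}
    (ht : Transcendental ℚ (Real.exp t)) {R H : ℤ} (hR : 0 ≤ R) (hH : 0 ≤ H) {c : ℤ → ℤ}
    (hc : ∀ k, |c k| ≤ H)
    (hna : ¬ Annihilated p (e ^ u.toNat) (resultantBound l (2 * R + 1) H)) :
    p ∣ valZ p e i u (nfIdx R l) c (nfR R l) (nfS l) ↔
      valP l t (nfIdx R l) c (nfR R l) (nfS l) = 0 := by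
  have : Fact p.natAbs.Prime := ⟨hs.prime⟩
  have hl := hs.l_pos
  have hne : (e : ZMod p.natAbs) ^ (-R * u) ≠ 0 := zpow_ne_zero _ hs.cast_ne_zero
  rw [← hs.cast_eq_zero_iff, hs.cast_valZ_nf hR, mul_eq_zero, or_iff_right hne, valP_nf hl t hR,
    mul_eq_zero, or_iff_right (Complex.exp_ne_zero _)]
  have hL : 0 < l.toNat := by omega
  constructor
  · intro h
    by_contra hne'
    apply hna
    have := annihilated_of_sum_eq_zero (c := fun r s => c (r * l + s)) hL hs.isPrimitiveRoot
      (e ^ u.toNat) (transcendental_exp_div hl ht) (isPrimitiveRoot_exp_neg hl) hH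
      (fun _ _ _ _ => hc _) hne' h
    rwa [Int.natAbs_of_nonneg hs.pos.le, Int.toNat_of_nonneg hl.le,
      Int.toNat_of_nonneg (by omega)] at this
  · intro h
    exact sum_eq_zero_of_sum_eq_zero (c := fun r s => c (r * l + s)) hL hs.isPrimitiveRoot _
      (transcendental_exp_div hl ht) (isPrimitiveRoot_exp_neg hl) h

theorem valZ_sub (K : Finset ℤ) (a b r s : ℤ → ℤ) :
    valZ p e i u K (fun k => a k - b k) r s = valZ p e i u K a r s - valZ p e i u K b r s := by
  simp only [valZ, sub_mul, sum_sub_distrib]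

theorem valP_sub (t : ℝ) (K : Finset ℤ) (a b r s : ℤ → ℤ) :
    valP l t K (fun k => a k - b k) r s = valP l t K a r s - valP l t K b r s := by
  simp only [valP, Int.cast_sub, sub_mul, sum_sub_distrib]

theorem valZ_sum (J K : Finset ℤ) (a : ℤ → ℤ → ℤ) (r s : ℤ → ℤ) :
    valZ p e i u K (fun k => ∑ n ∈ J, a n k) r s = ∑ n ∈ J, valZ p e i u K (a n) r s := by
  simp only [valZ, sum_mul]
  exact sum_comm

theorem valP_sum (t : ℝ) (J K : Finset ℤ) (a : ℤ → ℤ → ℤ) (r s : ℤ → ℤ) :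
    valP l t K (fun k => ∑ n ∈ J, a n k) r s = ∑ n ∈ J, valP l t K (a n) r s := by
  simp only [valP, Int.cast_sum, sum_mul]
  exact sum_comm

theorem block_sub (a b : ℤ → ℤ) (r : ℕ) :
    block l (fun k => a k - b k) r = block l a r - block l b r := by
  simp only [block, Int.cast_sub, sub_mul, sum_sub_distrib]

end Local

/-! ### Internal families, internal sums and uniform bounds -/

section Internal

/-- Counterexamples chosen at almost every index would form an internal element of the set for which
the hypothesis fails. -/
theorem eventually_forall_mem {K : Nat.Primes → Finset ℤ} {P : Nat.Primes → ℤ → Prop}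
    (h : ∀ k : Nat.Primes → ℤ, (∀ᶠ q in (D : Filter Nat.Primes), k q ∈ K q) →
      ∀ᶠ q in (D : Filter Nat.Primes), P q (k q)) :
    ∀ᶠ q in (D : Filter Nat.Primes), ∀ n ∈ K q, P q n := by
  by_contra hcon
  have hcon := Ultrafilter.eventually_not.2 hcon
  simp only [not_forall] at hcon
  obtain ⟨k, hk⟩ := hcon.choice
  obtain ⟨q, h1, h2⟩ := ((h k (hk.mono fun q hq => hq.1)).and hk).exists
  exact h2.2 h1

/-- Two internal families of representatives agree modulo `N` on all of `K q` at almost every index,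
so the internal sum is independent of the representatives. -/
theorem hasSumMod_iff {N : Nat.Primes → ℤ} {K : Nat.Primes → Finset ℤ}
    {x : NS D ℤ → Quo (N : NS D ℤ)} (X : Nat.Primes → ℤ → ℤ)
    (hX : ∀ k : Nat.Primes → ℤ, (∀ᶠ q in (D : Filter Nat.Primes), k q ∈ K q) →
      x k = cls (N : NS D ℤ) ((fun q => X q (k q) : Nat.Primes → ℤ) : NS D ℤ))
    {y : Quo (N : NS D ℤ)} : HasSumMod (K : NS D (Finset ℤ)) x y ↔
      y = cls (N : NS D ℤ) ((fun q => ∑ n ∈ K q, X q n : Nat.Primes → ℤ) : NS D ℤ) := by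
  constructor
  · rintro ⟨Y, hY, rfl⟩
    induction Y using Germ.inductionOn with | _ Y
    have h : ∀ᶠ q in (D : Filter Nat.Primes), ∀ n ∈ K q, N q ∣ Y q n - X q n := by
      refine eventually_forall_mem fun k hk => ?_
      have h1 := (hY k hk).trans (hX k hk)
      exact cls_eq_cls_iff.1 h1
    refine cls_eq_cls_iff.2 (h.mono fun q hq => ?_)
    rw [← Finset.sum_sub_distrib]
    exact Finset.dvd_sum hq
  · rintro rfl
    refine ⟨(X : NS D (ℤ → ℤ)), fun k hk => ?_, rfl⟩
    induction k using Germ.inductionOn with | _ k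
    exact (hX k hk).symm

theorem hasSumC_iff {K : Nat.Primes → Finset ℤ} {x : NS D ℤ → NS D ℂ} (X : Nat.Primes → ℤ → ℂ)
    (hX : ∀ k : Nat.Primes → ℤ, (∀ᶠ q in (D : Filter Nat.Primes), k q ∈ K q) →
      x k = ((fun q => X q (k q) : Nat.Primes → ℂ) : NS D ℂ))
    {y : NS D ℂ} : HasSumC (K : NS D (Finset ℤ)) x y ↔
      y = ((fun q => ∑ n ∈ K q, X q n : Nat.Primes → ℂ) : NS D ℂ) := by
  constructor
  · rintro ⟨Y, hY, rfl⟩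
    induction Y using Germ.inductionOn with | _ Y
    have h : ∀ᶠ q in (D : Filter Nat.Primes), ∀ n ∈ K q, Y q n = X q n := by
      refine eventually_forall_mem fun k hk => ?_
      have h1 := (hY k hk).trans (hX k hk)
      exact Germ.coe_eq.1 h1
    refine Germ.coe_eq.2 (h.mono fun q hq => ?_)
    exact Finset.sum_congr rfl hq
  · rintro rfl
    refine ⟨(X : NS D (ℤ → ℂ)), fun k hk => ?_, rfl⟩
    induction k using Germ.inductionOn with | _ k
    exact (hX k hk).symm

/-- A bound for each element of a hyperfinite set by elements of an initial segment of `*ℕ` is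
uniform. -/
theorem exists_uniform_bound {S : Set (NS D ℤ)} (h0 : (0 : NS D ℤ) ∈ S)
    (hS : ∀ a b : NS D ℤ, 0 ≤ a → a ≤ b → b ∈ S → a ∈ S) {K : Nat.Primes → Finset ℤ}
    {P : Nat.Primes → ℤ → ℕ → Prop} (hP : ∀ q n a b, a ≤ b → P q n a → P q n b)
    (h : ∀ k : Nat.Primes → ℤ, (∀ᶠ q in (D : Filter Nat.Primes), k q ∈ K q) →
      ∃ H : Nat.Primes → ℕ, ((fun q => (H q : ℤ) : Nat.Primes → ℤ) : NS D ℤ) ∈ S ∧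
        ∀ᶠ q in (D : Filter Nat.Primes), P q (k q) (H q)) :
    ∃ H : Nat.Primes → ℕ, ((fun q => (H q : ℤ) : Nat.Primes → ℤ) : NS D ℤ) ∈ S ∧
      ∀ᶠ q in (D : Filter Nat.Primes), ∀ n ∈ K q, P q n (H q) := by
  classical
  have hex : ∀ᶠ q in (D : Filter Nat.Primes), ∀ n ∈ K q, ∃ H, P q n H :=
    eventually_forall_mem fun k hk => by
      obtain ⟨H, -, hH⟩ := h k hk
      exact hH.mono fun q hq => ⟨_, hq⟩
  let b : Nat.Primes → ℤ → ℕ := fun q n => if hn : ∃ H, P q n H then Nat.find hn else 0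
  have hb : ∀ q n H, P q n H → P q n (b q n) ∧ b q n ≤ H := by
    intro q n H hH
    have hn : ∃ H, P q n H := ⟨H, hH⟩
    simp only [b, dif_pos hn]
    exact ⟨Nat.find_spec hn, Nat.find_min' hn hH⟩
  -- The supremum of the least bounds is attained, at an internal element when the sets are
  -- nonempty; the bound belonging to that element lies in `S` and dominates it. For empty sets the
  -- supremum is `0`, whence `h0`.
  refine ⟨fun q => (K q).sup (b q), ?_, hex.mono fun q hq n hn => ?_⟩
  · by_cases hne : ∀ᶠ q in (D : Filter Nat.Primes), (K q).Nonempty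
    · have h1 : ∀ᶠ q in (D : Filter Nat.Primes), ∃ n, n ∈ K q ∧ (K q).sup (b q) = b q n :=
        hne.mono fun q hq => Finset.exists_mem_eq_sup _ hq _
      obtain ⟨k, hk⟩ := h1.choice
      obtain ⟨H, hHS, hH⟩ := h k (hk.mono fun q hq => hq.1)
      refine hS _ _ (Eventually.of_forall fun q => Int.natCast_nonneg _) ?_ hHS
      change ∀ᶠ q in (D : Filter Nat.Primes), (((K q).sup (b q) : ℕ) : ℤ) ≤ H q
      filter_upwards [hk, hH] with q h1 h2
      rw [h1.2]
      exact_mod_cast (hb _ _ _ h2).2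
    · have hne := Ultrafilter.eventually_not.2 hne
      convert h0
      refine Germ.coe_eq.2 (hne.mono fun q hq => ?_)
      rw [Finset.not_nonempty_iff_eq_empty] at hq
      dsimp only
      rw [hq]
      rfl
  · obtain ⟨H, hH⟩ := hq n hn
    exact hP q n _ _ (Finset.le_sup hn) (hb q n H hH).1

theorem coe_mem_OLin_iff {a l : Nat.Primes → ℤ} : (a : NS D ℤ) ∈ OLin (l : NS D ℤ) ↔
    ∃ m : ℕ, ∀ᶠ q in (D : Filter Nat.Primes), |a q| ≤ m * l q := by
  refine exists_congr fun m => ?_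
  constructor
  · rintro ⟨h1, h2⟩
    have e1 : ∀ᶠ q in (D : Filter Nat.Primes), -(m * l q) ≤ a q := h1
    have e2 : ∀ᶠ q in (D : Filter Nat.Primes), a q ≤ m * l q := h2
    filter_upwards [e1, e2] with q e1 e2
    exact abs_le.2 ⟨e1, e2⟩
  · intro h
    exact ⟨h.mono fun _ hq => (abs_le.1 hq).1, h.mono fun _ hq => (abs_le.1 hq).2⟩

theorem coe_mem_OFun_of_abs_le {A : Set (NS D ℤ)} {l : NS D ℤ} {a b : Nat.Primes → ℤ}
    (hb : (b : NS D ℤ) ∈ OFun A l) (h : ∀ᶠ q in (D : Filter Nat.Primes), |a q| ≤ b q) :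
    (a : NS D ℤ) ∈ OFun A l :=
  mem_OFun_of_le hb (h.mono fun _ hq => (abs_le.1 hq).1) (h.mono fun _ hq => (abs_le.1 hq).2)

theorem natAbs_mem_OFun {A : Set (NS D ℤ)} {l : NS D ℤ} {a : Nat.Primes → ℤ}
    (ha : (a : NS D ℤ) ∈ OFun A l) :
    ((fun q => ((a q).natAbs : ℤ) : Nat.Primes → ℤ) : NS D ℤ) ∈ OFun A l := by
  obtain ⟨f, hf, h1, h2⟩ := ha
  have h3 : |(a : NS D ℤ)| ≤ f l := abs_le.2 ⟨h1, h2⟩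
  have h4 : ((fun q => ((a q).natAbs : ℤ) : Nat.Primes → ℤ) : NS D ℤ) = |(a : NS D ℤ)| := by
    rw [Germ.abs_def]
    exact congrArg Germ.ofFun (funext fun q => (Int.abs_eq_natAbs _).symm)
  rw [h4]
  exact ⟨f, hf, by linarith [abs_nonneg (a : NS D ℤ)], h3⟩

theorem zero_mem_OFun {A : Set (NS D ℤ)} {l : NS D ℤ} : (0 : NS D ℤ) ∈ OFun A l := by
  simpa using natCast_mem_OFun (A := A) (l := l) 0

theorem mem_OFun_of_nonneg_of_le {A : Set (NS D ℤ)} {l a b : NS D ℤ} (h0 : 0 ≤ a) (hab : a ≤ b)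
    (hb : b ∈ OFun A l) : a ∈ OFun A l :=
  mem_OFun_of_le hb (by linarith) hab

theorem mem_OLin_of_nonneg_of_le {l a b : NS D ℤ} (h0 : 0 ≤ a) (hab : a ≤ b)
    (hb : b ∈ OLin l) : a ∈ OLin l := by
  obtain ⟨m, h1, h2⟩ := hb
  exact ⟨m, by linarith, by linarith⟩

theorem zero_mem_OLin {l : NS D ℤ} : (0 : NS D ℤ) ∈ OLin l := ⟨0, by simp, by simp⟩

end Internal

/-! ### The values of expressions in `F_p` and in `*ℂ`, index by index -/

section Values

variable {p e i l u : Nat.Primes → ℤ}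

/-- The set of parameters. -/
abbrev params (p e i : Nat.Primes → ℤ) : Set (NS D ℤ) :=
  {(p : NS D ℤ), (e : NS D ℤ), (i : NS D ℤ)}

theorem IsScale.zpowF_coe (h : IsScale (p : NS D ℤ) e i l u) (η : Nat.Primes → ℤ) :
    zpowF (p : NS D ℤ) e η =
      cls (p : NS D ℤ) ((fun q => epow (p q) (e q) (η q) : Nat.Primes → ℤ) : NS D ℤ) := by
  have hmul : ∀ a b c : Nat.Primes → ℤ, (∀ᶠ q in (D : Filter Nat.Primes),
      p q ∣ a q * b q - c q) → cls (p : NS D ℤ) (a : NS D ℤ) * cls (p : NS D ℤ) (b : NS D ℤ) =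
      cls (p : NS D ℤ) (c : NS D ℤ) := fun a b c habc => by
    rw [← map_mul, ← Germ.coe_mul]
    exact cls_eq_cls_iff.2 habc
  have hunit : IsUnit (cls (p : NS D ℤ) (npow (e : NS D ℤ) (-η : NS D ℤ))) := by
    refine IsUnit.of_mul_eq_one
      (cls (p : NS D ℤ)
        ((fun q => epow (p q) (e q) (-((-η q).toNat)) : Nat.Primes → ℤ) : NS D ℤ)) ?_
    rw [← Germ.coe_neg, npow_coe, ← map_one (Ideal.Quotient.mk _), ← Germ.coe_one]
    refine hmul _ _ _ ?_
    filter_upwards [h.eventually_localScale] with q hs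
    have : Fact (p q).natAbs.Prime := ⟨hs.prime⟩
    rw [← hs.cast_eq_zero_iff]
    push_cast
    rw [hs.cast_epow, ← zpow_natCast, ← zpow_add₀ hs.cast_ne_zero]
    simp
  rw [zpowF]
  refine ((Ring.eq_mul_inverse_iff_mul_eq _ _ _ hunit).2 ?_).symm
  rw [← Germ.coe_neg, npow_coe, npow_coe]
  refine hmul _ _ _ ?_
  filter_upwards [h.eventually_localScale] with q hs
  have : Fact (p q).natAbs.Prime := ⟨hs.prime⟩
  rw [← hs.cast_eq_zero_iff]
  push_cast
  rw [hs.cast_epow, ← zpow_natCast, ← zpow_natCast, ← zpow_add₀ hs.cast_ne_zero, sub_eq_zero]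
  congr 1
  simp only [Pi.neg_apply]
  omega

theorem IsScale.termF_coe (h : IsScale (p : NS D ℤ) e i l u) (a r s : Nat.Primes → ℤ) :
    termF (p : NS D ℤ) e i l u a r s = cls (p : NS D ℤ)
      ((fun q => a q * epow (p q) (e q) (r q * u q + s q * (i q * u q)) : Nat.Primes → ℤ) :
        NS D ℤ) := by
  rw [termF, expF_cls h, expF_cls h, ← Germ.coe_mul, ← Germ.coe_mul, ← Germ.coe_mul,
    h.zpowF_coe, h.zpowF_coe, ← map_mul, ← map_mul, ← Germ.coe_mul, ← Germ.coe_mul]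
  refine cls_eq_cls_iff.2 ?_
  filter_upwards [h.eventually_localScale] with q hs
  have : Fact (p q).natAbs.Prime := ⟨hs.prime⟩
  rw [← hs.cast_eq_zero_iff]
  simp only [Pi.mul_apply, Int.cast_sub, Int.cast_mul, hs.cast_epow, zpow_add₀ hs.cast_ne_zero]
  ring

theorem IsScale.valF_iff (h : IsScale (p : NS D ℤ) e i l u) (K : Nat.Primes → Finset ℤ)
    (a r s : Nat.Primes → ℤ → ℤ) (y : Quo (p : NS D ℤ)) :
    ValF (p : NS D ℤ) e i l u K (a : NS D (ℤ → ℤ)) (r : NS D (ℤ → ℤ)) (s : NS D (ℤ → ℤ)) y ↔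
      y = cls (p : NS D ℤ) ((fun q => valZ (p q) (e q) (i q) (u q) (K q) (a q) (r q) (s q) :
        Nat.Primes → ℤ) : NS D ℤ) :=
  hasSumMod_iff (fun q k => a q k * epow (p q) (e q) (r q k * u q + s q k * (i q * u q)))
    fun k _ => h.termF_coe (fun q => a q (k q)) (fun q => r q (k q)) (fun q => s q (k q))

theorem termC_coe (t : Nat.Primes → ℝ) (a r s : Nat.Primes → ℤ) :
    termC (l : NS D ℤ) (t : NS D ℝ) a r s =
      ((fun q => (a q : ℂ) * Complex.exp (-(r q * (2 * t q / l q))) *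
        Complex.exp (-(s q * (2 * Real.pi * Complex.I / l q))) : Nat.Primes → ℂ) : NS D ℂ) := rfl

theorem valC_iff (t : Nat.Primes → ℝ) (K : Nat.Primes → Finset ℤ)
    (a r s : Nat.Primes → ℤ → ℤ) (z : NS D ℂ) :
    ValC (l : NS D ℤ) (t : NS D ℝ) K (a : NS D (ℤ → ℤ)) (r : NS D (ℤ → ℤ)) (s : NS D (ℤ → ℤ)) z ↔
      z = ((fun q => valP (l q) (t q) (K q) (a q) (r q) (s q) : Nat.Primes → ℂ) : NS D ℂ) :=
  hasSumC_iff (fun q k => (a q k : ℂ) * Complex.exp (-(r q k * (2 * t q / l q))) *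
        Complex.exp (-(s q k * (2 * Real.pi * Complex.I / l q))))
    fun k _ => termC_coe t (fun q => a q (k q)) (fun q => r q (k q)) (fun q => s q (k q))

theorem IsScale.nonneg (h : IsScale (p : NS D ℤ) e i l u) : (0 : NS D ℤ) ≤ l :=
  h.eventually_localScale.mono fun _ hq => hq.l_pos.le

/-- The bound is exponential in `l`; this is where closure of `O(ℱ)` under powers is needed. -/
theorem IsScale.resultantBound_mem_OFun (h : IsScale (p : NS D ℤ) e i l u)
    {A : Set (NS D ℤ)} {N H : Nat.Primes → ℤ}
    (hN : (N : NS D ℤ) ∈ OFun A l) (hH : (H : NS D ℤ) ∈ OFun A l)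
    (hN0 : ∀ᶠ q in (D : Filter Nat.Primes), 0 ≤ N q)
    (hH0 : ∀ᶠ q in (D : Filter Nat.Primes), 0 ≤ H q) :
    ((fun q => resultantBound (l q) (N q) (H q) : Nat.Primes → ℤ) : NS D ℤ) ∈ OFun A l := by
  have hl := self_mem_OFun (A := A) h.nonneg
  have h2 : (2 : NS D ℤ) ∈ OFun A l := by simpa using natCast_mem_OFun (A := A) (l := l) 2
  have h1 : (1 : NS D ℤ) ∈ OFun A l := by simpa using natCast_mem_OFun (A := A) (l := l) 1
  have h2l := mul_mem_OFun h2 hl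
  have hb := mul_mem_OFun h2l (add_mem_OFun (add_mem_OFun
    (npow_mem_OFun (by norm_num) h2 hl) (mul_mem_OFun hN hH)) h1)
  refine add_mem_OFun (npow_mem_OFun ?_ hb h2l) (mul_mem_OFun h2l hN)
  change ∀ᶠ q in (D : Filter Nat.Primes), 0 ≤ 2 * l q * (2 ^ (l q).toNat + N q * H q + 1)
  filter_upwards [h.eventually_localScale, hN0, hH0] with q h3 h4 h5
  have := h3.l_pos
  positivity

/-- The two values of normal forms with coefficients in `O(ℱ)` vanish simultaneously. -/
theorem IsScale.eventually_dvd_valZ_nf_iff (h : IsScale (p : NS D ℤ) e i l u)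
    {t : Nat.Primes → ℝ}
    (ht : ∀ᶠ q in (D : Filter Nat.Primes), Transcendental ℚ (Real.exp (t q)))
    {R H : Nat.Primes → ℤ} (hR : (R : NS D ℤ) ∈ OFun (params p e i) l)
    (hH : (H : NS D ℤ) ∈ OFun (params p e i) l)
    (hR0 : ∀ᶠ q in (D : Filter Nat.Primes), 0 ≤ R q)
    (hH0 : ∀ᶠ q in (D : Filter Nat.Primes), 0 ≤ H q) :
    ∀ᶠ q in (D : Filter Nat.Primes), ∀ c : ℤ → ℤ, (∀ k, |c k| ≤ H q) →
      (p q ∣ valZ (p q) (e q) (i q) (u q) (nfIdx (R q) (l q)) c (nfR (R q) (l q)) (nfS (l q)) ↔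
        valP (l q) (t q) (nfIdx (R q) (l q)) c (nfR (R q) (l q)) (nfS (l q)) = 0) := by
  have h2 : (2 : NS D ℤ) ∈ OFun (params p e i) l := by
    simpa using natCast_mem_OFun (A := params p e i) (l := l) 2
  have h1 : (1 : NS D ℤ) ∈ OFun (params p e i) l := by
    simpa using natCast_mem_OFun (A := params p e i) (l := l) 1
  have hB := h.resultantBound_mem_OFun (N := fun q => 2 * R q + 1) (H := H)
    (add_mem_OFun (mul_mem_OFun h2 hR) h1) hH (hR0.mono fun q hq => by omega) hH0
  filter_upwards [h.eventually_localScale, ht, hR0, hH0, h.eventually_not_annihilated hB] with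
    q h3 h4 h5 h6 h7 c hc
  exact h3.dvd_valZ_nf_iff h4 h5 h6 hc h7

end Values

/-! ### Comparison of expressions and internal sums of them -/

section Expressions

variable {p e i l u : Nat.Primes → ℤ}

theorem IsIndexSet.eventually {m : ℕ} {K : Nat.Primes → Finset ℤ}
    (hK : IsIndexSet (l : NS D ℤ) m (K : NS D (Finset ℤ))) :
    ∀ᶠ q in (D : Filter Nat.Primes), ∀ n ∈ K q, 0 ≤ n ∧ n ≤ l q ^ m := by
  refine eventually_forall_mem fun k hk => ?_
  obtain ⟨h1, h2⟩ := hK k hk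
  have e1 : ∀ᶠ q in (D : Filter Nat.Primes), 0 ≤ k q := h1
  have e2 : ∀ᶠ q in (D : Filter Nat.Primes), k q ≤ l q ^ m := h2
  exact e1.and e2

theorem card_le_of_forall_mem {K : Finset ℤ} {N : ℤ} (hN : 0 ≤ N)
    (hK : ∀ n ∈ K, 0 ≤ n ∧ n ≤ N) : (K.card : ℤ) ≤ N + 1 := by
  have h1 : K ⊆ Finset.Icc 0 N := fun n hn => Finset.mem_Icc.2 (hK n hn)
  have h2 := Finset.card_le_card h1
  rw [Int.card_Icc] at h2
  omega

theorem isExpr_of_eventually {A : Set (NS D ℤ)} {K : Nat.Primes → Finset ℤ}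
    {a r s : Nat.Primes → ℤ → ℤ} {m M M' : ℕ} {H : Nat.Primes → ℤ}
    (hK : ∀ᶠ q in (D : Filter Nat.Primes), ∀ n ∈ K q, 0 ≤ n ∧ n ≤ l q ^ m)
    (hH : (H : NS D ℤ) ∈ OFun A l)
    (ha : ∀ᶠ q in (D : Filter Nat.Primes), ∀ n ∈ K q, |a q n| ≤ H q)
    (hr : ∀ᶠ q in (D : Filter Nat.Primes), ∀ n ∈ K q, |r q n| ≤ M * l q)
    (hs : ∀ᶠ q in (D : Filter Nat.Primes), ∀ n ∈ K q, |s q n| ≤ M' * l q) :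
    IsExpr A (l : NS D ℤ) (K : NS D (Finset ℤ)) (a : NS D (ℤ → ℤ)) (r : NS D (ℤ → ℤ))
      (s : NS D (ℤ → ℤ)) := by
  refine ⟨⟨m, fun k hk => ?_⟩, fun k hk => ?_⟩
  · induction k using Germ.inductionOn with | _ k
    have hk' : ∀ᶠ q in (D : Filter Nat.Primes), k q ∈ K q := hk
    have h1 := hk'.mp (hK.mono fun q h1 h2 => h1 _ h2)
    exact ⟨h1.mono fun q hq => hq.1, h1.mono fun q hq => hq.2⟩
  · induction k using Germ.inductionOn with | _ k
    have hk' : ∀ᶠ q in (D : Filter Nat.Primes), k q ∈ K q := hk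
    refine ⟨coe_mem_OFun_of_abs_le (a := fun q => a q (k q)) hH
        (hk'.mp (ha.mono fun q h1 h2 => h1 _ h2)),
      coe_mem_OLin_iff (a := fun q => r q (k q)).2 ⟨M, hk'.mp (hr.mono fun q h1 h2 => h1 _ h2)⟩,
      coe_mem_OLin_iff (a := fun q => s q (k q)).2 ⟨M', hk'.mp (hs.mono fun q h1 h2 => h1 _ h2)⟩⟩

theorem exists_natCast_mul_bound {l : Nat.Primes → ℤ} {B : Nat.Primes → ℕ}
    (hB : ((fun q => (B q : ℤ) : Nat.Primes → ℤ) : NS D ℤ) ∈ OLin (l : NS D ℤ)) :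
    ∃ M : ℕ, ∀ᶠ q in (D : Filter Nat.Primes), (B q : ℤ) ≤ M * l q := by
  obtain ⟨M, hM⟩ := coe_mem_OLin_iff.1 hB
  exact ⟨M, hM.mono fun q hq => (le_abs_self _).trans hq⟩

/-- `M` and `H` depend only on the expression, while the window `R` is free; different expressions
can thus be written over one window. -/
theorem IsScale.exists_normalForm (h : IsScale (p : NS D ℤ) e i l u) {A : Set (NS D ℤ)}
    {K : Nat.Primes → Finset ℤ} {a r s : Nat.Primes → ℤ → ℤ}
    (hE : IsExpr A (l : NS D ℤ) (K : NS D (Finset ℤ)) (a : NS D (ℤ → ℤ))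
      (r : NS D (ℤ → ℤ)) (s : NS D (ℤ → ℤ))) :
    ∃ (M : ℕ) (H : Nat.Primes → ℤ), (H : NS D ℤ) ∈ OFun A l ∧
      (∀ᶠ q in (D : Filter Nat.Primes), 0 ≤ H q) ∧
      ∀ R : Nat.Primes → ℤ, (∀ᶠ q in (D : Filter Nat.Primes), M * l q ≤ R q) →
        ∃ c : Nat.Primes → ℤ → ℤ, ∀ᶠ q in (D : Filter Nat.Primes), (∀ k, |c q k| ≤ H q) ∧
          (∀ k, c q k ≠ 0 → |nfR (R q) (l q) k| ≤ M * l q) ∧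
          valZ (p q) (e q) (i q) (u q) (K q) (a q) (r q) (s q) =
            valZ (p q) (e q) (i q) (u q) (nfIdx (R q) (l q)) (c q) (nfR (R q) (l q)) (nfS (l q)) ∧
          ∀ t : ℝ, valP (l q) t (K q) (a q) (r q) (s q) =
            valP (l q) t (nfIdx (R q) (l q)) (c q) (nfR (R q) (l q)) (nfS (l q)) := by
  obtain ⟨⟨m, hK⟩, hE⟩ := hE
  have hK := hK.eventually
  obtain ⟨H, hH, haH⟩ := exists_uniform_bound (D := D) (S := OFun A l) (K := K)
    (P := fun q n B => |a q n| ≤ B) zero_mem_OFun (fun a b => mem_OFun_of_nonneg_of_le)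
    (fun q n a b hab h1 => h1.trans (by exact_mod_cast hab)) fun k hk =>
      ⟨_, natAbs_mem_OFun (a := fun q => a q (k q)) (hE k hk).1,
        Eventually.of_forall fun q => (Int.abs_eq_natAbs _).le⟩
  obtain ⟨B, hB, hrB⟩ := exists_uniform_bound (D := D) (S := OLin (l : NS D ℤ)) (K := K)
    (P := fun q n B => |r q n| ≤ B) zero_mem_OLin (fun a b => mem_OLin_of_nonneg_of_le)
    (fun q n a b hab h1 => h1.trans (by exact_mod_cast hab)) fun k hk =>
      ⟨fun q => (r q (k q)).natAbs, by
        obtain ⟨M, hM⟩ := coe_mem_OLin_iff (a := fun q => r q (k q)).1 (hE k hk).2.1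
        refine coe_mem_OLin_iff.2 ⟨M, hM.mono fun q hq => ?_⟩
        rwa [← Int.abs_eq_natAbs, abs_abs],
        Eventually.of_forall fun q => (Int.abs_eq_natAbs _).le⟩
  obtain ⟨M, hM⟩ := exists_natCast_mul_bound hB
  have hl := self_mem_OFun (A := A) h.nonneg
  have h1 : (1 : NS D ℤ) ∈ OFun A l := by simpa using natCast_mem_OFun (A := A) (l := l) 1
  -- A normal-form coefficient adds up at most `l ^ m + 1` original ones.
  refine ⟨M, fun q => (l q ^ m + 1) * H q, mul_mem_OFun (add_mem_OFun (pow_mem_OFun hl m) h1) hH,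
    ?_, fun R hR => ⟨fun q => nfCoeff (R q) (l q) (K q) (a q) (r q) (s q), ?_⟩⟩
  · filter_upwards [h.eventually_localScale] with q hs
    have := hs.l_pos
    positivity
  · filter_upwards [h.eventually_localScale, hK, haH, hrB, hM, hR] with q hs hK haH hrB hM hR
    have hl0 := hs.l_pos
    have hr : ∀ n ∈ K q, |r q n| ≤ R q := fun n hn => (hrB n hn).trans (hM.trans hR)
    refine ⟨fun k => ?_, fun k hk => ?_, hs.valZ_eq hr, fun t => valP_eq hl0 t hr⟩
    · refine (abs_nfCoeff_le haH (by positivity) k).trans ?_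
      exact mul_le_mul_of_nonneg_right (card_le_of_forall_mem (by positivity) hK) (by positivity)
    · exact abs_nfR_le_of_nfCoeff_ne_zero hl0 (fun n hn => (hrB n hn).trans hM) hk

/-- Over a common window the difference is again a normal form with coefficients in `O(ℱ)`. One
direction gives well-definedness of the map on `O(F)`, the other its injectivity. -/
theorem IsScale.valZ_congr_iff (h : IsScale (p : NS D ℤ) e i l u) {t : Nat.Primes → ℝ}
    (ht : ∀ᶠ q in (D : Filter Nat.Primes), Transcendental ℚ (Real.exp (t q)))
    {K K' : Nat.Primes → Finset ℤ} {a r s a' r' s' : Nat.Primes → ℤ → ℤ}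
    (hE : IsExpr (params p e i) (l : NS D ℤ) (K : NS D (Finset ℤ)) (a : NS D (ℤ → ℤ))
      (r : NS D (ℤ → ℤ)) (s : NS D (ℤ → ℤ)))
    (hE' : IsExpr (params p e i) (l : NS D ℤ) (K' : NS D (Finset ℤ)) (a' : NS D (ℤ → ℤ))
      (r' : NS D (ℤ → ℤ)) (s' : NS D (ℤ → ℤ))) :
    ∀ᶠ q in (D : Filter Nat.Primes),
      (p q ∣ valZ (p q) (e q) (i q) (u q) (K q) (a q) (r q) (s q) -
        valZ (p q) (e q) (i q) (u q) (K' q) (a' q) (r' q) (s' q) ↔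
      valP (l q) (t q) (K q) (a q) (r q) (s q) = valP (l q) (t q) (K' q) (a' q) (r' q) (s' q)) := by
  obtain ⟨M, H, hH, hH0, hnf⟩ := h.exists_normalForm hE
  obtain ⟨M', H', hH', hH0', hnf'⟩ := h.exists_normalForm hE'
  have hl := self_mem_OFun (A := params p e i) h.nonneg
  set R : Nat.Primes → ℤ := fun q => (M + M' : ℕ) * l q with hRdef
  have hRO : (R : NS D ℤ) ∈ OFun (params p e i) l := mul_mem_OFun (natCast_mem_OFun (M + M')) hl
  have hl0 : ∀ᶠ q in (D : Filter Nat.Primes), 0 < l q :=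
    h.eventually_localScale.mono fun q hq => hq.l_pos
  have hR0 : ∀ᶠ q in (D : Filter Nat.Primes), 0 ≤ R q :=
    hl0.mono fun q hq => by simp only [hRdef]; positivity
  obtain ⟨c, hc⟩ := hnf R (hl0.mono fun q hq => by simp only [hRdef]; push_cast; nlinarith)
  obtain ⟨c', hc'⟩ := hnf' R (hl0.mono fun q hq => by simp only [hRdef]; push_cast; nlinarith)
  have hcore := h.eventually_dvd_valZ_nf_iff ht hRO (H := fun q => H q + H' q)
    (add_mem_OFun hH hH') hR0 (by filter_upwards [hH0, hH0'] with q h1 h2; omega)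
  filter_upwards [hc, hc', hcore] with q h1 h2 h3
  rw [h1.2.2.1, h2.2.2.1, h1.2.2.2, h2.2.2.2, ← valZ_sub, ← sub_eq_zero (a := valP _ _ _ _ _ _),
    ← valP_sub]
  exact h3 _ fun k => (abs_sub _ _).trans (add_le_add (h1.1 k) (h2.1 k))

/-- Each member has its own expression, not chosen internally. Coefficients are rechosen index by
index over the window `l ^ 2`, which may spoil the linear bound on exponents. Comparison with the
original normal form shows that blocks outside a linear range vanish in `ℂ`, so they can be cut off
without changing the value modulo `p`. -/
theorem IsScale.exists_uniform_expr (h : IsScale (p : NS D ℤ) e i l u) {t : Nat.Primes → ℝ}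
    (ht : ∀ᶠ q in (D : Filter Nat.Primes), Transcendental ℚ (Real.exp (t q)))
    {m : ℕ} {K : Nat.Primes → Finset ℤ}
    (hK : IsIndexSet (l : NS D ℤ) m (K : NS D (Finset ℤ))) {X : Nat.Primes → ℤ → ℤ}
    (hX : ∀ k : Nat.Primes → ℤ, (∀ᶠ q in (D : Filter Nat.Primes), k q ∈ K q) →
      cls (p : NS D ℤ) ((fun q => X q (k q) : Nat.Primes → ℤ) : NS D ℤ) ∈
        OF (p : NS D ℤ) e i l u) :
    ∃ (J : Nat.Primes → Finset ℤ) (c : Nat.Primes → ℤ → ℤ → ℤ) (r s : Nat.Primes → ℤ → ℤ),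
      (∀ k : Nat.Primes → ℤ, (∀ᶠ q in (D : Filter Nat.Primes), k q ∈ K q) →
        IsExpr (params p e i) (l : NS D ℤ) (J : NS D (Finset ℤ))
          ((fun q => c q (k q) : Nat.Primes → ℤ → ℤ) : NS D (ℤ → ℤ)) (r : NS D (ℤ → ℤ))
          (s : NS D (ℤ → ℤ))) ∧
      IsExpr (params p e i) (l : NS D ℤ) (J : NS D (Finset ℤ))
          ((fun q j => ∑ n ∈ K q, c q n j : Nat.Primes → ℤ → ℤ) : NS D (ℤ → ℤ))
          (r : NS D (ℤ → ℤ)) (s : NS D (ℤ → ℤ)) ∧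
      ∀ᶠ q in (D : Filter Nat.Primes), ∀ n ∈ K q,
        p q ∣ X q n - valZ (p q) (e q) (i q) (u q) (J q) (c q n) (r q) (s q) := by
  classical
  set A := params (D := D) p e i with hA
  have hl := self_mem_OFun (A := A) h.nonneg
  have hloc := h.eventually_localScale
  -- An internal window exceeding every `M * l` with `M` standard.
  set R : Nat.Primes → ℤ := fun q => l q ^ 2 with hRdef
  have hRO : (R : NS D ℤ) ∈ OFun A l := pow_mem_OFun hl 2
  have hR0 : ∀ᶠ q in (D : Filter Nat.Primes), 0 ≤ R q :=
    Eventually.of_forall fun q => sq_nonneg _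
  let V : Nat.Primes → (ℤ → ℤ) → ℤ := fun q c =>
    valZ (p q) (e q) (i q) (u q) (nfIdx (R q) (l q)) c (nfR (R q) (l q)) (nfS (l q))
  have hk : ∀ k : Nat.Primes → ℤ, (∀ᶠ q in (D : Filter Nat.Primes), k q ∈ K q) →
      ∃ (M : ℕ) (H : Nat.Primes → ℤ) (c : Nat.Primes → ℤ → ℤ), (H : NS D ℤ) ∈ OFun A l ∧
        ∀ᶠ q in (D : Filter Nat.Primes), (∀ k, |c q k| ≤ H q) ∧
          (∀ k, c q k ≠ 0 → |nfR (R q) (l q) k| ≤ M * l q) ∧ p q ∣ X q (k q) - V q (c q) := by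
    intro k hk
    obtain ⟨K', a, r, s, hE, hV⟩ := hX k hk
    induction K' using Germ.inductionOn with | _ K'
    induction a using Germ.inductionOn with | _ a
    induction r using Germ.inductionOn with | _ r
    induction s using Germ.inductionOn with | _ s
    rw [h.valF_iff, cls_eq_cls_iff] at hV
    obtain ⟨M, H, hH, -, hnf⟩ := h.exists_normalForm hE
    obtain ⟨c, hc⟩ := hnf R (by
      filter_upwards [hloc, h.eventually_natCast_le M] with q h1 h2
      have := h1.l_pos
      simp only [hRdef]
      nlinarith)
    refine ⟨M, H, c, hH, ?_⟩
    filter_upwards [hc, hV] with q h1 h2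
    refine ⟨h1.1, h1.2.1, ?_⟩
    simp only [V]
    rw [← h1.2.2.1]
    exact h2
  obtain ⟨H, hH, hHc⟩ := exists_uniform_bound (D := D) (S := OFun A l) (K := K)
    (P := fun q n B => ∃ c : ℤ → ℤ, (∀ k, |c k| ≤ B) ∧ p q ∣ X q n - V q c)
    zero_mem_OFun (fun a b => mem_OFun_of_nonneg_of_le)
    (fun q n a b hab ⟨c, h1, h2⟩ => ⟨c, fun k => (h1 k).trans (by exact_mod_cast hab), h2⟩)
    fun k hkK => by
      obtain ⟨M, H, c, hH, hc⟩ := hk k hkK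
      refine ⟨_, natAbs_mem_OFun hH, hc.mono fun q hq => ⟨c q, fun j => ?_, hq.2.2⟩⟩
      exact (hq.1 j).trans Int.le_natAbs
  let c : Nat.Primes → ℤ → ℤ → ℤ := fun q n =>
    if hn : ∃ c : ℤ → ℤ, (∀ k, |c k| ≤ H q) ∧ p q ∣ X q n - V q c then hn.choose else 0
  have hc : ∀ᶠ q in (D : Filter Nat.Primes), ∀ n ∈ K q,
      (∀ k, |c q n k| ≤ H q) ∧ p q ∣ X q n - V q (c q n) := by
    filter_upwards [hHc] with q hq n hn
    simp only [c, dif_pos (hq n hn)]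
    exact (hq n hn).choose_spec
  obtain ⟨B, hB, hBc⟩ := exists_uniform_bound (D := D) (S := OLin (l : NS D ℤ)) (K := K)
    (P := fun q n B => ∀ r < (2 * R q + 1).toNat, block (l q) (c q n) r ≠ 0 →
      |(r : ℤ) - R q| ≤ B) zero_mem_OLin (fun a b => mem_OLin_of_nonneg_of_le)
    (fun q n a b hab h1 r hr hne => (h1 r hr hne).trans (by exact_mod_cast hab))
    fun k hkK => by
      obtain ⟨M, H', c', hH', hc'⟩ := hk k hkK
      refine ⟨fun q => (M * l q).toNat, coe_mem_OLin_iff.2 ⟨M, ?_⟩, ?_⟩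
      · filter_upwards [hloc] with q hs
        have := hs.l_pos
        rw [Int.toNat_of_nonneg (by positivity), abs_of_nonneg (by positivity)]
      have hcore := h.eventually_dvd_valZ_nf_iff ht hRO (H := fun q => (H q : ℤ) + H' q)
        (add_mem_OFun hH hH') hR0 (hc'.mono fun q hq => by
          have := (abs_nonneg _).trans (hq.1 0)
          positivity)
      filter_upwards [hloc, hkK, hc, hc', hcore, hR0, ht]
        with q hs hkq hc hc' hcore hR0 htq r hr hne
      obtain ⟨hc1, hc2⟩ := hc (k q) hkq
      obtain ⟨hc'1, hc'2, hc'3⟩ := hc'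
      -- The rechosen and the original coefficients have the same value modulo `p`, hence the same
      -- complex blocks; the latter are supported within `M * l`.
      have h1 := (hcore (fun j => c q (k q) j - c' q j)
        fun j => (abs_sub _ _).trans (add_le_add (hc1 j) (hc'1 j))).1 (by
          rw [valZ_sub]
          have := dvd_sub hc'3 hc2
          rwa [sub_sub_sub_cancel_left] at this)
      have h2 := (valP_nf_eq_zero_iff hs.l_pos htq hR0 _).1 h1 r hr
      rw [block_sub, sub_eq_zero] at h2
      rw [h2] at hne
      obtain ⟨s, hs', hne'⟩ := Finset.exists_ne_zero_of_sum_ne_zero hne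
      have h3 := hc'2 (r * l q + s) fun h0 => hne' (by rw [h0]; simp)
      rw [(nf_index r s (Finset.mem_range.1 hs') (R q)).1] at h3
      exact h3.trans (Int.self_le_toNat _)
  obtain ⟨M, hM⟩ := exists_natCast_mul_bound hB
  -- The window has `(2 * l ^ 2 + 1) * l` indices, at most `l ^ 4` once `3 ≤ l`.
  have hJ : ∀ᶠ q in (D : Filter Nat.Primes),
      ∀ j ∈ (nfIdx (R q) (l q)).filter (fun j => |nfR (R q) (l q) j| ≤ M * l q),
        0 ≤ j ∧ j ≤ l q ^ 4 := by
    filter_upwards [h.eventually_natCast_le 3] with q hq j hj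
    have h1 := Finset.mem_Ico.1 (Finset.mem_filter.1 hj).1
    refine ⟨h1.1, h1.2.le.trans ?_⟩
    simp only [hRdef]
    push_cast at hq
    nlinarith [mul_nonneg (sub_nonneg.2 hq) (sq_nonneg (l q)),
      mul_nonneg (mul_nonneg (sub_nonneg.2 hq) (sq_nonneg (l q))) (by linarith : 0 ≤ l q)]
  have hr : ∀ᶠ q in (D : Filter Nat.Primes),
      ∀ j ∈ (nfIdx (R q) (l q)).filter (fun j => |nfR (R q) (l q) j| ≤ M * l q),
        |nfR (R q) (l q) j| ≤ M * l q :=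
    Eventually.of_forall fun q j hj => (Finset.mem_filter.1 hj).2
  have hs : ∀ᶠ q in (D : Filter Nat.Primes),
      ∀ j ∈ (nfIdx (R q) (l q)).filter (fun j => |nfR (R q) (l q) j| ≤ M * l q),
        |nfS (l q) j| ≤ (1 : ℕ) * l q := by
    filter_upwards [hloc] with q hs j _
    rw [nfS, abs_of_nonneg (Int.emod_nonneg _ hs.l_pos.ne'), Nat.cast_one, one_mul]
    exact (Int.emod_lt_of_pos _ hs.l_pos).le
  have h1 : (1 : NS D ℤ) ∈ OFun A l := by simpa using natCast_mem_OFun (A := A) (l := l) 1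
  refine ⟨fun q => (nfIdx (R q) (l q)).filter (fun j => |nfR (R q) (l q) j| ≤ M * l q), c,
    fun q => nfR (R q) (l q), fun q => nfS (l q), fun k hkK => ?_, ?_, ?_⟩
  · refine isExpr_of_eventually hJ hH ?_ hr hs
    filter_upwards [hkK, hc] with q h1 h2 j _
    exact (h2 _ h1).1 j
  · refine isExpr_of_eventually hJ (H := fun q => (l q ^ m + 1) * H q)
      (mul_mem_OFun (add_mem_OFun (pow_mem_OFun hl m) h1) hH) ?_ hr hs
    filter_upwards [hloc, hK.eventually, hc] with q hs hK hc j _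
    have := hs.l_pos
    refine (Finset.abs_sum_le_sum_abs _ _).trans ?_
    refine (Finset.sum_le_card_nsmul _ _ (H q : ℤ) fun n hn => (hc n hn).1 j).trans ?_
    rw [nsmul_eq_mul]
    exact mul_le_mul_of_nonneg_right (card_le_of_forall_mem (by positivity) hK) (by positivity)
  · have hcore := h.eventually_dvd_valZ_nf_iff ht hRO hH hR0
      (Eventually.of_forall fun q => Int.natCast_nonneg _)
    filter_upwards [hloc, hc, hBc, hM, hcore, hR0, ht] with q hs hc hBc hM hcore hR0 ht n hn
    obtain ⟨hc1, hc2⟩ := hc n hn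
    set c' : ℤ → ℤ := fun j => if |nfR (R q) (l q) j| ≤ M * l q then c q n j else 0 with hc'
    have hV : valZ (p q) (e q) (i q) (u q)
        ((nfIdx (R q) (l q)).filter (fun j => |nfR (R q) (l q) j| ≤ M * l q)) (c q n)
        (nfR (R q) (l q)) (nfS (l q)) = V q c' := by
      simp only [V, valZ, Finset.sum_filter, hc', ite_mul, zero_mul]
    rw [hV]
    have hd : p q ∣ V q (c q n) - V q c' := by
      simp only [V]
      rw [← valZ_sub, hcore _ fun j => ?_, valP_nf_eq_zero_iff hs.l_pos ht hR0]
      · intro r hr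
        by_cases hrM : |(r : ℤ) - R q| ≤ M * l q
        · refine Finset.sum_eq_zero fun s hs' => ?_
          simp only [hc', (nf_index r s (Finset.mem_range.1 hs') (R q)).1, if_pos hrM, sub_self]
          simp
        · have h0 : block (l q) (c q n) r = 0 := by
            by_contra hne
            exact hrM ((hBc n hn r hr hne).trans hM)
          rw [block_sub, h0, zero_sub, neg_eq_zero]
          refine Finset.sum_eq_zero fun s hs' => ?_
          simp only [hc', (nf_index r s (Finset.mem_range.1 hs') (R q)).1, if_neg hrM]
          simp
      · simp only [hc']
        split_ifs
        · simp
        · simpa using hc1 j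
    have := dvd_add hc2 hd
    rwa [sub_add_sub_cancel] at this

end Expressions

/-! ### Coordinates in `U(l)` and their partial sums -/

section LinearPart

variable {p e i l u : Nat.Primes → ℤ}

/-- After division by `u`, the number `α + i * β` is a multiple of `i * l ^ 2`. So `i` divides `α`,
which forces `α = 0`, and then `l ^ 2` divides `β`. -/
theorem LocalScale.comb_unique {p e i l u : ℤ} (hs : LocalScale p e i l u) {α β : ℤ}
    (hα : |α| < i) (hβ : |β| < l ^ 2) (h : (p - 1) * l ∣ α * u + β * (i * u)) :
    α = 0 ∧ β = 0 := by
  have hi := hs.i_pos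
  rw [← hs.unit, show i * l * u * l = u * (i * l ^ 2) by ring,
    show α * u + β * (i * u) = u * (α + i * β) by ring] at h
  have h1 := Int.dvd_of_mul_dvd_mul_left hs.u_pos.ne' h
  have h2 : i ∣ α := (dvd_add_left (dvd_mul_right i β)).1 ((dvd_mul_right i _).trans h1)
  have hα0 : α = 0 := Int.eq_zero_of_abs_lt_dvd h2 hα
  rw [hα0, zero_add] at h1
  exact ⟨hα0, Int.eq_zero_of_abs_lt_dvd (Int.dvd_of_mul_dvd_mul_left hi.ne' h1) hβ⟩

theorem combU_coe (α β : Nat.Primes → ℤ) :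
    combU (p : NS D ℤ) i l u α β = cls (((fun q => (p q - 1) * l q : Nat.Primes → ℤ) : NS D ℤ))
      ((fun q => α q * u q + β q * (i q * u q) : Nat.Primes → ℤ) : NS D ℤ) := rfl

theorem combU_eq_cls_iff {α β X : Nat.Primes → ℤ} :
    combU (p : NS D ℤ) i l u α β =
      cls (((fun q => (p q - 1) * l q : Nat.Primes → ℤ) : NS D ℤ)) (X : NS D ℤ) ↔
      ∀ᶠ q in (D : Filter Nat.Primes),
        (p q - 1) * l q ∣ α q * u q + β q * (i q * u q) - X q := by
  rw [combU_coe]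
  exact cls_eq_cls_iff

/-- The first pair need only be below `l ^ 2 / 2`, so that the result applies to partial sums not
yet known to be of order `l`. -/
theorem IsScale.combU_injective (h : IsScale (p : NS D ℤ) e i l u) {α β α' β' : Nat.Primes → ℤ}
    (hα : ∀ᶠ q in (D : Filter Nat.Primes), 2 * |α q| ≤ l q ^ 2)
    (hβ : ∀ᶠ q in (D : Filter Nat.Primes), 2 * |β q| ≤ l q ^ 2)
    (hα' : (α' : NS D ℤ) ∈ OLin (l : NS D ℤ)) (hβ' : (β' : NS D ℤ) ∈ OLin (l : NS D ℤ))
    (heq : combU (p : NS D ℤ) i l u α β = combU (p : NS D ℤ) i l u α' β') :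
    (α : NS D ℤ) = α' ∧ (β : NS D ℤ) = β' := by
  obtain ⟨M, hM⟩ := coe_mem_OLin_iff.1 hα'
  obtain ⟨M', hM'⟩ := coe_mem_OLin_iff.1 hβ'
  rw [combU_coe α' β', combU_eq_cls_iff] at heq
  have key : ∀ᶠ q in (D : Filter Nat.Primes), α q - α' q = 0 ∧ β q - β' q = 0 := by
    filter_upwards [h.eventually_localScale, hα, hβ, hM, hM', heq,
      h.eventually_natCast_le (2 * M + 1), h.eventually_natCast_le (2 * M' + 1),
      h.eventually_mul_sq_lt 1] with q hs hα hβ hM hM' heq h1 h2 h3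
    have hl := hs.l_pos
    push_cast at h1 h2 h3
    have e1 : |α q - α' q| < l q ^ 2 := by
      refine (abs_sub _ _).trans_lt ?_
      nlinarith
    have e2 : |β q - β' q| < l q ^ 2 := by
      refine (abs_sub _ _).trans_lt ?_
      nlinarith
    refine hs.comb_unique (by linarith) e2 ?_
    rwa [show (α q - α' q) * u q + (β q - β' q) * (i q * u q) =
      α q * u q + β q * (i q * u q) - (α' q * u q + β' q * (i q * u q)) by ring]
  exact ⟨Germ.coe_eq.2 (key.mono fun q hq => sub_eq_zero.1 hq.1),
    Germ.coe_eq.2 (key.mono fun q hq => sub_eq_zero.1 hq.2)⟩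

theorem IsScale.two_mul_abs_le (h : IsScale (p : NS D ℤ) e i l u) {α : Nat.Primes → ℤ}
    (hα : (α : NS D ℤ) ∈ OLin (l : NS D ℤ)) :
    ∀ᶠ q in (D : Filter Nat.Primes), 2 * |α q| ≤ l q ^ 2 := by
  obtain ⟨M, hM⟩ := coe_mem_OLin_iff.1 hα
  filter_upwards [h.eventually_localScale, hM, h.eventually_natCast_le (2 * M)] with q hs h1 h2
  have := hs.l_pos
  push_cast at h2
  nlinarith

/-- The complex number attached to the coordinates `α`, `β`. -/
def linC (l : ℤ) (t : ℝ) (α β : ℤ) : ℂ := α * (2 * t / l) + β * (2 * Real.pi * Complex.I / l)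

theorem linC_coe (t : Nat.Primes → ℝ) (α β : Nat.Primes → ℤ) :
    toC (α : NS D ℤ) * periodRe (l : NS D ℤ) (t : NS D ℝ) +
      toC (β : NS D ℤ) * periodIm (l : NS D ℤ) =
      ((fun q => linC (l q) (t q) (α q) (β q) : Nat.Primes → ℂ) : NS D ℂ) := rfl

theorem linC_injective {l : ℤ} (hl : 0 < l) {t : ℝ} (ht : Transcendental ℚ (Real.exp t))
    {α β α' β' : ℤ} (h : linC l t α β = linC l t α' β') : α = α' ∧ β = β' := by
  -- Otherwise the real part would not see `α`; `exp 0 = 1` is algebraic.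
  have ht0 : t ≠ 0 := by
    rintro rfl
    rw [Real.exp_zero] at ht
    exact ht isAlgebraic_one
  have hl' : (l : ℂ) ≠ 0 := by exact_mod_cast hl.ne'
  have h1 : ((α : ℝ) * t : ℂ) + (β * Real.pi : ℝ) * Complex.I =
      ((α' : ℝ) * t : ℂ) + (β' * Real.pi : ℝ) * Complex.I := by
    simp only [linC] at h
    field_simp at h
    push_cast
    linear_combination h
  have hre := congrArg Complex.re h1
  have him := congrArg Complex.im h1
  simp at hre him
  exact ⟨hre.resolve_right ht0, him⟩

theorem linC_coe_injective (h : IsScale (p : NS D ℤ) e i l u) {t : Nat.Primes → ℝ}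
    (ht : ∀ᶠ q in (D : Filter Nat.Primes), Transcendental ℚ (Real.exp (t q)))
    {α β α' β' : Nat.Primes → ℤ}
    (heq : ((fun q => linC (l q) (t q) (α q) (β q) : Nat.Primes → ℂ) : NS D ℂ) =
      ((fun q => linC (l q) (t q) (α' q) (β' q) : Nat.Primes → ℂ) : NS D ℂ)) :
    (α : NS D ℤ) = α' ∧ (β : NS D ℤ) = β' := by
  have key : ∀ᶠ q in (D : Filter Nat.Primes), α q = α' q ∧ β q = β' q := by
    filter_upwards [h.eventually_localScale, ht, Germ.coe_eq.1 heq] with q h1 h2 h3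
    exact linC_injective h1.l_pos h2 h3
  exact ⟨Germ.coe_eq.2 (key.mono fun q hq => hq.1), Germ.coe_eq.2 (key.mono fun q hq => hq.2)⟩

theorem neg_linC (l : ℤ) (t : ℝ) (α β : ℤ) : -linC l t α β = linC l t (-α) (-β) := by
  simp only [linC]
  push_cast
  ring

theorem sum_linC (l : ℤ) (t : ℝ) (K : Finset ℤ) (α β : ℤ → ℤ) :
    ∑ n ∈ K, linC l t (α n) (β n) = linC l t (∑ n ∈ K, α n) (∑ n ∈ K, β n) := by
  simp only [linC, Finset.sum_add_distrib, ← Finset.sum_mul, Int.cast_sum]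

theorem neg_mem_OLin {l a : NS D ℤ} (ha : a ∈ OLin l) : -a ∈ OLin l := by
  obtain ⟨m, h1, h2⟩ := ha
  exact ⟨m, by linarith, by linarith⟩

theorem sum_filter_le_step (K : Finset ℤ) (f : ℤ → ℤ) (j : ℤ) :
    ∑ n ∈ K with n ≤ j, f n =
      ∑ n ∈ K with n ≤ j - 1, f n + if j ∈ K then f j else 0 := by
  rw [Finset.sum_filter, Finset.sum_filter, ← Finset.sum_ite_eq' K j f, ← Finset.sum_add_distrib]
  refine Finset.sum_congr rfl fun n _ => ?_
  split_ifs <;> omega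

/-- If some partial sum is large, then there is a moderately large one. -/
theorem exists_moderate_partial_sum {K : Finset ℤ} {α β : ℤ → ℤ} {B T : ℤ} (hT : 0 ≤ T)
    (hB : 0 ≤ B)
    (hK : ∀ n ∈ K, 0 ≤ n) (hα : ∀ n ∈ K, |α n| ≤ B) (hβ : ∀ n ∈ K, |β n| ≤ B)
    (hbad : ∃ j, ¬ (|∑ n ∈ K with n ≤ j, α n| ≤ T ∧ |∑ n ∈ K with n ≤ j, β n| ≤ T)) :
    ∃ j, ¬ (|∑ n ∈ K with n ≤ j, α n| ≤ T ∧ |∑ n ∈ K with n ≤ j, β n| ≤ T) ∧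
      |∑ n ∈ K with n ≤ j, α n| ≤ T + B ∧ |∑ n ∈ K with n ≤ j, β n| ≤ T + B := by
  classical
  -- Sums up to a negative index are empty, so there is a first bad index; its sums exceed the
  -- preceding ones by one summand each.
  have hneg : ∀ j < 0, |∑ n ∈ K with n ≤ j, α n| ≤ T ∧ |∑ n ∈ K with n ≤ j, β n| ≤ T := by
    intro j hj
    have : K.filter (fun n => n ≤ j) = ∅ :=
      Finset.filter_eq_empty_iff.2 fun n hn => by have := hK n hn; omega
    rw [this]
    simpa using hT
  have hnat : ∃ j : ℕ, ¬ (|∑ n ∈ K with n ≤ (j : ℤ), α n| ≤ T ∧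
      |∑ n ∈ K with n ≤ (j : ℤ), β n| ≤ T) := by
    obtain ⟨j, hj⟩ := hbad
    have hj0 : 0 ≤ j := by
      by_contra hcon
      exact hj (hneg j (by omega))
    lift j to ℕ using hj0
    exact ⟨j, hj⟩
  have hprev : |∑ n ∈ K with n ≤ ((Nat.find hnat : ℕ) : ℤ) - 1, α n| ≤ T ∧
      |∑ n ∈ K with n ≤ ((Nat.find hnat : ℕ) : ℤ) - 1, β n| ≤ T := by
    rcases Nat.eq_zero_or_pos (Nat.find hnat) with h0 | h0
    · exact hneg _ (by omega)
    · have := Nat.find_min hnat (m := Nat.find hnat - 1) (by omega)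
      rw [not_not, Nat.cast_sub h0, Nat.cast_one] at this
      exact this
  refine ⟨Nat.find hnat, Nat.find_spec hnat, ?_, ?_⟩
  · rw [sum_filter_le_step]
    refine (abs_add_le _ _).trans (add_le_add hprev.1 ?_)
    split_ifs with hj
    · exact hα _ hj
    · simpa using hB
  · rw [sum_filter_le_step]
    refine (abs_add_le _ _).trans (add_le_add hprev.2 ?_)
    split_ifs with hj
    · exact hβ _ hj
    · simpa using hB

/-- `O(l)` is external, so a uniform bound comes first; below it, coordinates can be chosen index by
index. -/
theorem IsScale.exists_internal_coordinates (h : IsScale (p : NS D ℤ) e i l u)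
    {K : Nat.Primes → Finset ℤ} {X : Nat.Primes → ℤ → ℤ}
    (hX : ∀ k : Nat.Primes → ℤ, (∀ᶠ q in (D : Filter Nat.Primes), k q ∈ K q) →
      cls (((fun q => (p q - 1) * l q : Nat.Primes → ℤ) : NS D ℤ))
        ((fun q => X q (k q) : Nat.Primes → ℤ) : NS D ℤ) ∈ UL (p : NS D ℤ) i l u) :
    ∃ (α β : Nat.Primes → ℤ → ℤ) (M : ℕ), ∀ᶠ q in (D : Filter Nat.Primes), ∀ n ∈ K q,
      |α q n| ≤ M * l q ∧ |β q n| ≤ M * l q ∧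
        (p q - 1) * l q ∣ α q n * u q + β q n * (i q * u q) - X q n := by
  classical
  obtain ⟨B, hB, hBX⟩ := exists_uniform_bound (D := D) (S := OLin (l : NS D ℤ)) (K := K)
    (P := fun q n B => ∃ α β : ℤ, |α| ≤ B ∧ |β| ≤ B ∧
      (p q - 1) * l q ∣ α * u q + β * (i q * u q) - X q n)
    zero_mem_OLin (fun a b => mem_OLin_of_nonneg_of_le)
    (fun q n a b hab ⟨α, β, h1, h2, h3⟩ => ⟨α, β, h1.trans (by exact_mod_cast hab),
      h2.trans (by exact_mod_cast hab), h3⟩) fun k hk => by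
      obtain ⟨α, hα, β, hβ, heq⟩ := hX k hk
      induction α using Germ.inductionOn with | _ α
      induction β using Germ.inductionOn with | _ β
      have heq := combU_eq_cls_iff.1 heq.symm
      obtain ⟨M, hM⟩ := coe_mem_OLin_iff.1 hα
      obtain ⟨M', hM'⟩ := coe_mem_OLin_iff.1 hβ
      refine ⟨fun q => ((M + M' : ℕ) * l q).toNat, coe_mem_OLin_iff.2 ⟨M + M', ?_⟩, ?_⟩
      · filter_upwards [h.eventually_localScale] with q hs
        have := hs.l_pos
        rw [Int.toNat_of_nonneg (by positivity), abs_of_nonneg (by positivity)]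
      · filter_upwards [h.eventually_localScale, heq, hM, hM'] with q hs h1 h2 h3
        have := hs.l_pos
        refine ⟨α q, β q, ?_, ?_, h1⟩ <;> rw [Int.toNat_of_nonneg (by positivity)] <;>
          push_cast <;> nlinarith
  obtain ⟨M, hM⟩ := exists_natCast_mul_bound hB
  have hex : ∀ q n, ∃ αβ : ℤ × ℤ, (∃ α β : ℤ, |α| ≤ B q ∧ |β| ≤ B q ∧
      (p q - 1) * l q ∣ α * u q + β * (i q * u q) - X q n) → |αβ.1| ≤ B q ∧ |αβ.2| ≤ B q ∧
      (p q - 1) * l q ∣ αβ.1 * u q + αβ.2 * (i q * u q) - X q n := by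
    intro q n
    by_cases hq : ∃ α β : ℤ, |α| ≤ B q ∧ |β| ≤ B q ∧
      (p q - 1) * l q ∣ α * u q + β * (i q * u q) - X q n
    · obtain ⟨α, β, hαβ⟩ := hq
      exact ⟨(α, β), fun _ => hαβ⟩
    · exact ⟨(0, 0), fun h => absurd h hq⟩
  choose αβ hαβ using hex
  refine ⟨fun q n => (αβ q n).1, fun q n => (αβ q n).2, M, ?_⟩
  filter_upwards [hBX, hM] with q h1 h2 n hn
  obtain ⟨h3, h4, h5⟩ := hαβ q n (h1 n hn)
  exact ⟨h3.trans h2, h4.trans h2, h5⟩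

/-- If a partial sum exceeded `l ^ 2 / 4`, the first such would be at most `l ^ 2 / 4 + M * l`,
within the range of uniqueness. Membership in `U(l)` would then make it at most `N * l` with `N`
standard, hence below `l ^ 2 / 4`. -/
theorem IsScale.sums_mem_OLin_of_partial_sums (h : IsScale (p : NS D ℤ) e i l u) {m : ℕ}
    {K : Nat.Primes → Finset ℤ} (hK : IsIndexSet (l : NS D ℤ) m (K : NS D (Finset ℤ)))
    {α β : Nat.Primes → ℤ → ℤ} {M : ℕ}
    (hαβ : ∀ᶠ q in (D : Filter Nat.Primes), ∀ n ∈ K q, |α q n| ≤ M * l q ∧ |β q n| ≤ M * l q)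
    (hpart : ∀ j : Nat.Primes → ℤ, combU (p : NS D ℤ) i l u
      ((fun q => ∑ n ∈ K q with n ≤ j q, α q n : Nat.Primes → ℤ) : NS D ℤ)
      ((fun q => ∑ n ∈ K q with n ≤ j q, β q n : Nat.Primes → ℤ) : NS D ℤ) ∈
        UL (p : NS D ℤ) i l u) :
    ((fun q => ∑ n ∈ K q, α q n : Nat.Primes → ℤ) : NS D ℤ) ∈ OLin (l : NS D ℤ) ∧
      ((fun q => ∑ n ∈ K q, β q n : Nat.Primes → ℤ) : NS D ℤ) ∈ OLin (l : NS D ℤ) := by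
  have hmod : ∀ j : Nat.Primes → ℤ,
      (∀ᶠ q in (D : Filter Nat.Primes), 2 * |∑ n ∈ K q with n ≤ j q, α q n| ≤ l q ^ 2) →
      (∀ᶠ q in (D : Filter Nat.Primes), 2 * |∑ n ∈ K q with n ≤ j q, β q n| ≤ l q ^ 2) →
      ((fun q => ∑ n ∈ K q with n ≤ j q, α q n : Nat.Primes → ℤ) : NS D ℤ) ∈ OLin (l : NS D ℤ) ∧
      ((fun q => ∑ n ∈ K q with n ≤ j q, β q n : Nat.Primes → ℤ) : NS D ℤ) ∈
        OLin (l : NS D ℤ) := by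
    intro j h1 h2
    obtain ⟨α', hα', β', hβ', heq⟩ := hpart j
    induction α' using Germ.inductionOn with | _ α'
    induction β' using Germ.inductionOn with | _ β'
    obtain ⟨e1, e2⟩ := h.combU_injective h1 h2 hα' hβ' heq
    rw [e1, e2]
    exact ⟨hα', hβ'⟩
  have hgood : ∀ᶠ q in (D : Filter Nat.Primes), ∀ j,
      |∑ n ∈ K q with n ≤ j, α q n| ≤ l q ^ 2 / 4 ∧
      |∑ n ∈ K q with n ≤ j, β q n| ≤ l q ^ 2 / 4 := by
    by_contra hcon
    have hcon := Ultrafilter.eventually_not.2 hcon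
    have hex : ∀ᶠ q in (D : Filter Nat.Primes), ∃ j,
        ¬ (|∑ n ∈ K q with n ≤ j, α q n| ≤ l q ^ 2 / 4 ∧
          |∑ n ∈ K q with n ≤ j, β q n| ≤ l q ^ 2 / 4) ∧
        |∑ n ∈ K q with n ≤ j, α q n| ≤ l q ^ 2 / 4 + M * l q ∧
        |∑ n ∈ K q with n ≤ j, β q n| ≤ l q ^ 2 / 4 + M * l q := by
      filter_upwards [hcon, h.eventually_localScale, hK.eventually, hαβ] with q h1 hs h2 h3
      have := hs.l_pos
      exact exists_moderate_partial_sum (by positivity) (by positivity) (fun n hn => (h2 n hn).1)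
        (fun n hn => (h3 n hn).1) (fun n hn => (h3 n hn).2) (not_forall.1 h1)
    obtain ⟨j, hj⟩ := hex.choice
    have hdiv : ∀ q, 4 * (l q ^ 2 / 4) ≤ l q ^ 2 := fun q => Int.mul_ediv_self_le (by norm_num)
    have hsmall := h.eventually_natCast_le (4 * M)
    obtain ⟨h1, h2⟩ := hmod j
      (by
        filter_upwards [hj, hsmall, h.eventually_localScale] with q h1 h2 hs
        have := hs.l_pos
        have := hdiv q
        push_cast at h2
        nlinarith [h1.2.1])
      (by
        filter_upwards [hj, hsmall, h.eventually_localScale] with q h1 h2 hs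
        have := hs.l_pos
        have := hdiv q
        push_cast at h2
        nlinarith [h1.2.2])
    obtain ⟨N, hN⟩ := coe_mem_OLin_iff.1 h1
    obtain ⟨N', hN'⟩ := coe_mem_OLin_iff.1 h2
    obtain ⟨q, h1, h2, h3, h4, h5, hs⟩ := (hj.and (hN.and (hN'.and
      ((h.eventually_natCast_le (4 * N)).and ((h.eventually_natCast_le (4 * N')).and
        h.eventually_localScale))))).exists
    have := hs.l_pos
    push_cast at h4 h5
    refine h1.1 ⟨?_, ?_⟩
    · refine h2.trans ((Int.le_ediv_iff_mul_le (by norm_num)).2 ?_)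
      nlinarith
    · refine h3.trans ((Int.le_ediv_iff_mul_le (by norm_num)).2 ?_)
      nlinarith
  have hfull : ∀ᶠ q in (D : Filter Nat.Primes), (K q).filter (fun n => n ≤ l q ^ m) = K q :=
    hK.eventually.mono fun q hq => Finset.filter_true_of_mem fun n hn => (hq n hn).2
  have hdiv : ∀ q, 4 * (l q ^ 2 / 4) ≤ l q ^ 2 := fun q => Int.mul_ediv_self_le (by norm_num)
  -- The partial sum up to `l ^ m` is the whole sum.
  obtain ⟨h1, h2⟩ := hmod (fun q => l q ^ m)
    (hgood.mono fun q hq => by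
      have := (hq (l q ^ m)).1
      have := hdiv q
      have := abs_nonneg (∑ n ∈ K q with n ≤ l q ^ m, α q n)
      linarith)
    (hgood.mono fun q hq => by
      have := (hq (l q ^ m)).2
      have := hdiv q
      have := abs_nonneg (∑ n ∈ K q with n ≤ l q ^ m, β q n)
      linarith)
  have e1 : ((fun q => ∑ n ∈ K q with n ≤ l q ^ m, α q n : Nat.Primes → ℤ) : NS D ℤ) =
      ((fun q => ∑ n ∈ K q, α q n : Nat.Primes → ℤ) : NS D ℤ) :=
    Germ.coe_eq.2 (hfull.mono fun q hq => by simp only [hq])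
  have e2 : ((fun q => ∑ n ∈ K q with n ≤ l q ^ m, β q n : Nat.Primes → ℤ) : NS D ℤ) =
      ((fun q => ∑ n ∈ K q, β q n : Nat.Primes → ℤ) : NS D ℤ) :=
    Germ.coe_eq.2 (hfull.mono fun q hq => by simp only [hq])
  rw [e1] at h1
  rw [e2] at h2
  exact ⟨h1, h2⟩

end LinearPart

/-! ### Construction of the two maps -/

section Isomorphisms

variable {p e i l u : Nat.Primes → ℤ} {t : Nat.Primes → ℝ}

theorem IsScale.exists_linear_map (h : IsScale (p : NS D ℤ) e i l u)
    (ht : ∀ᶠ q in (D : Filter Nat.Primes), Transcendental ℚ (Real.exp (t q))) :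
    ∃ IU : Quo (((p : NS D ℤ) - 1) * (l : NS D ℤ)) → NS D ℂ,
      (∀ α ∈ OLin (l : NS D ℤ), ∀ β ∈ OLin (l : NS D ℤ), IU (combU (p : NS D ℤ) i l u α β) =
        -(toC α * periodRe (l : NS D ℤ) (t : NS D ℝ) + toC β * periodIm (l : NS D ℤ))) ∧
      Set.BijOn IU (UL (p : NS D ℤ) i l u) (CL (l : NS D ℤ) (t : NS D ℝ)) ∧
      ∀ (m : ℕ) (K : NS D (Finset ℤ)) (x : NS D ℤ → Quo (((p : NS D ℤ) - 1) * (l : NS D ℤ))) (y),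
        IsIndexSet (l : NS D ℤ) m K → (∀ k, IMem k K → x k ∈ UL (p : NS D ℤ) i l u) →
        HasSumMod K x y →
        ∃ z, HasSumC K (fun k => IU (x k)) z ∧
          ((z ∈ CL (l : NS D ℤ) (t : NS D ℝ) ∨
              ∀ j w, HasSumMod (initial K j) x w → w ∈ UL (p : NS D ℤ) i l u) →
            y ∈ UL (p : NS D ℤ) i l u ∧ IU y = z) := by
  classical
  -- The value `0` outside `U(l)` is arbitrary; inside, uniqueness of coordinates makes the choice
  -- immaterial.
  let IU : Quo (((p : NS D ℤ) - 1) * (l : NS D ℤ)) → NS D ℂ := fun x =>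
    if hx : ∃ αβ : NS D ℤ × NS D ℤ, αβ.1 ∈ OLin (l : NS D ℤ) ∧ αβ.2 ∈ OLin (l : NS D ℤ) ∧
        x = combU (p : NS D ℤ) i l u αβ.1 αβ.2 then
      -(toC hx.choose.1 * periodRe (l : NS D ℤ) (t : NS D ℝ) +
        toC hx.choose.2 * periodIm (l : NS D ℤ))
    else 0
  have hIU : ∀ α ∈ OLin (l : NS D ℤ), ∀ β ∈ OLin (l : NS D ℤ),
      IU (combU (p : NS D ℤ) i l u α β) =
        -(toC α * periodRe (l : NS D ℤ) (t : NS D ℝ) + toC β * periodIm (l : NS D ℤ)) := by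
    intro α hα β hβ
    have hx : ∃ αβ : NS D ℤ × NS D ℤ, αβ.1 ∈ OLin (l : NS D ℤ) ∧ αβ.2 ∈ OLin (l : NS D ℤ) ∧
        combU (p : NS D ℤ) i l u α β = combU (p : NS D ℤ) i l u αβ.1 αβ.2 :=
      ⟨(α, β), hα, hβ, rfl⟩
    simp only [IU, dif_pos hx]
    obtain ⟨h1, h2, h3⟩ := hx.choose_spec
    generalize hx.choose = αβ at h1 h2 h3 ⊢
    obtain ⟨α', β'⟩ := αβ
    dsimp only at h1 h2 h3 ⊢
    induction α using Germ.inductionOn with | _ α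
    induction β using Germ.inductionOn with | _ β
    induction α' using Germ.inductionOn with | _ α'
    induction β' using Germ.inductionOn with | _ β'
    obtain ⟨e1, e2⟩ := h.combU_injective (h.two_mul_abs_le hα) (h.two_mul_abs_le hβ) h1 h2 h3
    rw [e1, e2]
  have hIU' : ∀ α β : Nat.Primes → ℤ, (α : NS D ℤ) ∈ OLin (l : NS D ℤ) →
      (β : NS D ℤ) ∈ OLin (l : NS D ℤ) → IU (combU (p : NS D ℤ) i l u α β) =
        ((fun q => linC (l q) (t q) (-α q) (-β q) : Nat.Primes → ℂ) : NS D ℂ) := by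
    intro α β hα hβ
    rw [hIU _ hα _ hβ, linC_coe]
    exact congrArg Germ.ofFun (funext fun q => neg_linC _ _ _ _)
  refine ⟨IU, hIU, ⟨?_, ?_, ?_⟩, ?_⟩
  · rintro x ⟨α, hα, β, hβ, rfl⟩
    induction α using Germ.inductionOn with | _ α
    induction β using Germ.inductionOn with | _ β
    rw [hIU' α β hα hβ]
    exact ⟨_, neg_mem_OLin hα, _, neg_mem_OLin hβ, rfl⟩
  · rintro x ⟨α, hα, β, hβ, rfl⟩ x' ⟨α', hα', β', hβ', rfl⟩ heq
    induction α using Germ.inductionOn with | _ α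
    induction β using Germ.inductionOn with | _ β
    induction α' using Germ.inductionOn with | _ α'
    induction β' using Germ.inductionOn with | _ β'
    rw [hIU' α β hα hβ, hIU' α' β' hα' hβ'] at heq
    obtain ⟨e1, e2⟩ := linC_coe_injective h ht heq
    have e1' : (α : NS D ℤ) = α' := neg_injective e1
    have e2' : (β : NS D ℤ) = β' := neg_injective e2
    rw [e1', e2']
  · rintro z ⟨α, hα, β, hβ, rfl⟩
    induction α using Germ.inductionOn with | _ α
    induction β using Germ.inductionOn with | _ β
    refine ⟨_, ⟨_, neg_mem_OLin hα, _, neg_mem_OLin hβ, rfl⟩, ?_⟩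
    rw [linC_coe]
    refine (hIU' (fun q => -α q) (fun q => -β q) (neg_mem_OLin hα) (neg_mem_OLin hβ)).trans ?_
    simp only [neg_neg]
  · intro m K x y hK hx hsum
    induction K using Germ.inductionOn with | _ K
    obtain ⟨X, hX, hXy⟩ := hsum
    induction X using Germ.inductionOn with | _ X
    have hX' : ∀ k : Nat.Primes → ℤ, (∀ᶠ q in (D : Filter Nat.Primes), k q ∈ K q) →
        x k = cls (((fun q => (p q - 1) * l q : Nat.Primes → ℤ) : NS D ℤ))
          ((fun q => X q (k q) : Nat.Primes → ℤ) : NS D ℤ) := fun k hk => (hX k hk).symm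
    obtain ⟨α, β, M, hαβ⟩ := h.exists_internal_coordinates (K := K) (X := X) fun k hk => by
      rw [← hX' k hk]
      exact hx k hk
    have hcomb : ∀ k : Nat.Primes → ℤ, (∀ᶠ q in (D : Filter Nat.Primes), k q ∈ K q) →
        IU (x k) = ((fun q => linC (l q) (t q) (-α q (k q)) (-β q (k q)) :
          Nat.Primes → ℂ) : NS D ℂ) := by
      intro k hk
      have hk' := hk.mp (hαβ.mono fun q h1 h2 => h1 _ h2)
      have h1 : x k = combU (p : NS D ℤ) i l u ((fun q => α q (k q) : Nat.Primes → ℤ) : NS D ℤ)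
          ((fun q => β q (k q) : Nat.Primes → ℤ) : NS D ℤ) := by
        rw [hX' k hk]
        exact (combU_eq_cls_iff.2 (hk'.mono fun q hq => hq.2.2)).symm
      rw [h1]
      exact hIU' _ _ (coe_mem_OLin_iff.2 ⟨M, hk'.mono fun q hq => hq.1⟩)
        (coe_mem_OLin_iff.2 ⟨M, hk'.mono fun q hq => hq.2.1⟩)
    have hpart : ∀ K' : Nat.Primes → Finset ℤ, (∀ q, K' q ⊆ K q) →
        combU (p : NS D ℤ) i l u ((fun q => ∑ n ∈ K' q, α q n : Nat.Primes → ℤ) : NS D ℤ)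
          ((fun q => ∑ n ∈ K' q, β q n : Nat.Primes → ℤ) : NS D ℤ) =
        cls (((fun q => (p q - 1) * l q : Nat.Primes → ℤ) : NS D ℤ))
          ((fun q => ∑ n ∈ K' q, X q n : Nat.Primes → ℤ) : NS D ℤ) := by
      intro K' hK'
      refine combU_eq_cls_iff.2 (hαβ.mono fun q hq => ?_)
      rw [Finset.sum_mul, Finset.sum_mul, ← Finset.sum_add_distrib, ← Finset.sum_sub_distrib]
      exact Finset.dvd_sum fun n hn => (hq n (hK' q hn)).2.2
    have hy : y = combU (p : NS D ℤ) i l u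
        ((fun q => ∑ n ∈ K q, α q n : Nat.Primes → ℤ) : NS D ℤ)
          ((fun q => ∑ n ∈ K q, β q n : Nat.Primes → ℤ) : NS D ℤ) := by
      rw [hpart K fun q => subset_rfl]
      exact hXy.symm
    refine ⟨((fun q => ∑ n ∈ K q, linC (l q) (t q) (-α q n) (-β q n) : Nat.Primes → ℂ) : NS D ℂ),
      (hasSumC_iff (fun q n => linC (l q) (t q) (-α q n) (-β q n)) hcomb).2 rfl, fun hor => ?_⟩
    have hmem : ((fun q => ∑ n ∈ K q, α q n : Nat.Primes → ℤ) : NS D ℤ) ∈ OLin (l : NS D ℤ) ∧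
        ((fun q => ∑ n ∈ K q, β q n : Nat.Primes → ℤ) : NS D ℤ) ∈ OLin (l : NS D ℤ) := by
      rcases hor with ⟨α', hα', β', hβ', hz⟩ | hor
      · induction α' using Germ.inductionOn with | _ α'
        induction β' using Germ.inductionOn with | _ β'
        simp only [sum_linC, Finset.sum_neg_distrib] at hz
        rw [linC_coe] at hz
        obtain ⟨e1, e2⟩ := linC_coe_injective h ht hz
        rw [← e1] at hα'
        rw [← e2] at hβ'
        have h1 := neg_mem_OLin hα'
        have h2 := neg_mem_OLin hβ'
        rw [← Germ.coe_neg] at h1 h2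
        simpa only [Pi.neg_def, neg_neg] using And.intro h1 h2
      · refine h.sums_mem_OLin_of_partial_sums hK
          (hαβ.mono fun q hq n hn => ⟨(hq n hn).1, (hq n hn).2.1⟩) fun j => ?_
        rw [hpart (fun q => (K q).filter (fun n => n ≤ j q)) fun q => Finset.filter_subset _ _]
        refine hor j _ ⟨(X : NS D (ℤ → ℤ)), fun k hk => hX k ?_, rfl⟩
        induction k using Germ.inductionOn with | _ k
        have hk' : ∀ᶠ q in (D : Filter Nat.Primes), k q ∈ (K q).filter (fun n => n ≤ j q) := hk
        exact hk'.mono fun q hq => (Finset.mem_filter.1 hq).1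
    rw [hy]
    refine ⟨⟨_, hmem.1, _, hmem.2, rfl⟩, ?_⟩
    rw [hIU' _ _ hmem.1 hmem.2]
    simp only [sum_linC, Finset.sum_neg_distrib]

theorem IsScale.exists_field_map (h : IsScale (p : NS D ℤ) e i l u)
    (ht : ∀ᶠ q in (D : Filter Nat.Primes), Transcendental ℚ (Real.exp (t q))) :
    ∃ IF : Quo (p : NS D ℤ) → NS D ℂ,
      (∀ K a r s y z, IsExpr (params p e i) (l : NS D ℤ) K a r s →
        ValF (p : NS D ℤ) e i l u K a r s y → ValC (l : NS D ℤ) (t : NS D ℝ) K a r s z →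
          IF y = z) ∧
      Set.BijOn IF (OF (p : NS D ℤ) e i l u) (OC (p : NS D ℤ) e i l (t : NS D ℝ)) ∧
      ∀ (m : ℕ) (K : NS D (Finset ℤ)) (x : NS D ℤ → Quo (p : NS D ℤ)) (y),
        IsIndexSet (l : NS D ℤ) m K → (∀ k, IMem k K → x k ∈ OF (p : NS D ℤ) e i l u) →
        HasSumMod K x y →
        y ∈ OF (p : NS D ℤ) e i l u ∧ HasSumC K (fun k => IF (x k)) (IF y) := by
  classical
  -- Read from left to right this is well-definedness, from right to left injectivity.
  have hiff : ∀ {K a r s y z K' a' r' s' y' z'}, IsExpr (params p e i) (l : NS D ℤ) K a r s →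
      ValF (p : NS D ℤ) e i l u K a r s y → ValC (l : NS D ℤ) (t : NS D ℝ) K a r s z →
      IsExpr (params p e i) (l : NS D ℤ) K' a' r' s' →
      ValF (p : NS D ℤ) e i l u K' a' r' s' y' → ValC (l : NS D ℤ) (t : NS D ℝ) K' a' r' s' z' →
      (y = y' ↔ z = z') := by
    intro K a r s y z K' a' r' s' y' z' hE hy hz hE' hy' hz'
    induction K using Germ.inductionOn with | _ K
    induction a using Germ.inductionOn with | _ a
    induction r using Germ.inductionOn with | _ r
    induction s using Germ.inductionOn with | _ s
    induction K' using Germ.inductionOn with | _ K'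
    induction a' using Germ.inductionOn with | _ a'
    induction r' using Germ.inductionOn with | _ r'
    induction s' using Germ.inductionOn with | _ s'
    rw [h.valF_iff] at hy hy'
    rw [valC_iff] at hz hz'
    rw [hy, hy', hz, hz', cls_eq_cls_iff, Germ.coe_eq]
    exact eventually_congr (h.valZ_congr_iff ht hE hE')
  have hexF : ∀ K a r s, ∃ y, ValF (p : NS D ℤ) e i l u K a r s y := by
    intro K a r s
    induction K using Germ.inductionOn with | _ K
    induction a using Germ.inductionOn with | _ a
    induction r using Germ.inductionOn with | _ r
    induction s using Germ.inductionOn with | _ s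
    exact ⟨_, (h.valF_iff K a r s _).2 rfl⟩
  have hexC : ∀ K a r s, ∃ z, ValC (l : NS D ℤ) (t : NS D ℝ) K a r s z := by
    intro K a r s
    induction K using Germ.inductionOn with | _ K
    induction a using Germ.inductionOn with | _ a
    induction r using Germ.inductionOn with | _ r
    induction s using Germ.inductionOn with | _ s
    exact ⟨_, (valC_iff t K a r s _).2 rfl⟩
  let IF : Quo (p : NS D ℤ) → NS D ℂ := fun y =>
    if hy : ∃ z K a r s, IsExpr (params p e i) (l : NS D ℤ) K a r s ∧
        ValF (p : NS D ℤ) e i l u K a r s y ∧ ValC (l : NS D ℤ) (t : NS D ℝ) K a r s z then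
      hy.choose
    else 0
  have hIF : ∀ K a r s y z, IsExpr (params p e i) (l : NS D ℤ) K a r s →
      ValF (p : NS D ℤ) e i l u K a r s y → ValC (l : NS D ℤ) (t : NS D ℝ) K a r s z →
        IF y = z := by
    intro K a r s y z hE hy hz
    have hex : ∃ z K a r s, IsExpr (params p e i) (l : NS D ℤ) K a r s ∧
        ValF (p : NS D ℤ) e i l u K a r s y ∧ ValC (l : NS D ℤ) (t : NS D ℝ) K a r s z :=
      ⟨z, K, a, r, s, hE, hy, hz⟩
    simp only [IF, dif_pos hex]
    obtain ⟨K', a', r', s', hE', hy', hz'⟩ := hex.choose_spec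
    exact (hiff hE' hy' hz' hE hy hz).1 rfl
  refine ⟨IF, hIF, ⟨?_, ?_, ?_⟩, ?_⟩
  · rintro y ⟨K, a, r, s, hE, hy⟩
    obtain ⟨z, hz⟩ := hexC K a r s
    rw [hIF _ _ _ _ _ _ hE hy hz]
    exact ⟨K, a, r, s, hE, hz⟩
  · rintro y ⟨K, a, r, s, hE, hy⟩ y' ⟨K', a', r', s', hE', hy'⟩ heq
    obtain ⟨z, hz⟩ := hexC K a r s
    obtain ⟨z', hz'⟩ := hexC K' a' r' s'
    rw [hIF _ _ _ _ _ _ hE hy hz, hIF _ _ _ _ _ _ hE' hy' hz'] at heq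
    exact (hiff hE hy hz hE' hy' hz').2 heq
  · rintro z ⟨K, a, r, s, hE, hz⟩
    obtain ⟨y, hy⟩ := hexF K a r s
    exact ⟨y, ⟨K, a, r, s, hE, hy⟩, hIF _ _ _ _ _ _ hE hy hz⟩
  · intro m K x y hK hx hsum
    induction K using Germ.inductionOn with | _ K
    obtain ⟨X, hX, hXy⟩ := hsum
    induction X using Germ.inductionOn with | _ X
    have hX' : ∀ k : Nat.Primes → ℤ, (∀ᶠ q in (D : Filter Nat.Primes), k q ∈ K q) →
        x k = cls (p : NS D ℤ) ((fun q => X q (k q) : Nat.Primes → ℤ) : NS D ℤ) :=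
      fun k hk => (hX k hk).symm
    -- All members now share `J`, `r` and `s`, so both values are additive in the coefficients.
    obtain ⟨J, c, r, s, hE, hEsum, hdvd⟩ := h.exists_uniform_expr ht hK (X := X) fun k hk => by
      rw [← hX' k hk]
      exact hx k hk
    have hy : ValF (p : NS D ℤ) e i l u J
        ((fun q j => ∑ n ∈ K q, c q n j : Nat.Primes → ℤ → ℤ) : NS D (ℤ → ℤ))
        (r : NS D (ℤ → ℤ)) (s : NS D (ℤ → ℤ)) y := by
      rw [h.valF_iff, ← hXy]
      refine cls_eq_cls_iff.2 (hdvd.mono fun q hq => ?_)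
      rw [valZ_sum, ← Finset.sum_sub_distrib]
      exact Finset.dvd_sum hq
    refine ⟨⟨_, _, _, _, hEsum, hy⟩, ?_⟩
    rw [hIF _ _ _ _ _ _ hEsum hy ((valC_iff t J _ r s _).2 rfl)]
    simp only [valP_sum]
    refine (hasSumC_iff (fun q n => valP (l q) (t q) (J q) (c q n) (r q) (s q))
      fun k hk => ?_).2 rfl
    refine hIF _ _ _ _ _ _ (hE k hk) ?_ ((valC_iff t J (fun q => c q (k q)) r s _).2 rfl)
    rw [h.valF_iff, hX' k hk]
    exact cls_eq_cls_iff.2 (hk.mp (hdvd.mono fun q h1 h2 => h1 _ h2))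

/-- A single exponential is an admissible expression. -/
theorem isExpr_single (A : Set (NS D ℤ)) {α β : Nat.Primes → ℤ}
    (hα : (α : NS D ℤ) ∈ OLin (l : NS D ℤ)) (hβ : (β : NS D ℤ) ∈ OLin (l : NS D ℤ)) :
    IsExpr A (l : NS D ℤ) ((fun _ => {0} : Nat.Primes → Finset ℤ) : NS D (Finset ℤ))
      ((fun _ _ => 1 : Nat.Primes → ℤ → ℤ) : NS D (ℤ → ℤ))
      ((fun q _ => α q : Nat.Primes → ℤ → ℤ) : NS D (ℤ → ℤ))
      ((fun q _ => β q : Nat.Primes → ℤ → ℤ) : NS D (ℤ → ℤ)) := by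
  obtain ⟨M, hM⟩ := coe_mem_OLin_iff.1 hα
  obtain ⟨M', hM'⟩ := coe_mem_OLin_iff.1 hβ
  refine isExpr_of_eventually (m := 0) (H := fun _ => 1) (M := M) (M' := M') ?_ ?_ ?_ ?_ ?_
  · exact Eventually.of_forall fun q n hn => by
      rw [Finset.mem_singleton] at hn
      simp [hn]
  · exact (by simpa using natCast_mem_OFun (A := A) (l := l) 1 : (1 : NS D ℤ) ∈ OFun A l)
  · exact Eventually.of_forall fun q n hn => by simp
  · exact hM.mono fun q hq n _ => hq
  · exact hM'.mono fun q hq n _ => hq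

theorem IsScale.valF_single (h : IsScale (p : NS D ℤ) e i l u) (α β : Nat.Primes → ℤ) :
    ValF (p : NS D ℤ) e i l u ((fun _ => {0} : Nat.Primes → Finset ℤ) : NS D (Finset ℤ))
      ((fun _ _ => 1 : Nat.Primes → ℤ → ℤ) : NS D (ℤ → ℤ))
      ((fun q _ => α q : Nat.Primes → ℤ → ℤ) : NS D (ℤ → ℤ))
      ((fun q _ => β q : Nat.Primes → ℤ → ℤ) : NS D (ℤ → ℤ))
      (expF (p : NS D ℤ) e l (combU (p : NS D ℤ) i l u α β)) := by
  rw [h.valF_iff, combU, expF_cls h]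
  refine (h.zpowF_coe (fun q => α q * u q + β q * (i q * u q))).trans ?_
  simp only [valZ, Finset.sum_singleton, one_mul]

theorem valC_single (α β : Nat.Primes → ℤ) :
    ValC (l : NS D ℤ) (t : NS D ℝ) ((fun _ => {0} : Nat.Primes → Finset ℤ) : NS D (Finset ℤ))
      ((fun _ _ => 1 : Nat.Primes → ℤ → ℤ) : NS D (ℤ → ℤ))
      ((fun q _ => α q : Nat.Primes → ℤ → ℤ) : NS D (ℤ → ℤ))
      ((fun q _ => β q : Nat.Primes → ℤ → ℤ) : NS D (ℤ → ℤ))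
      (expC (-(toC (α : NS D ℤ) * periodRe (l : NS D ℤ) (t : NS D ℝ) +
        toC (β : NS D ℤ) * periodIm (l : NS D ℤ)))) := by
  rw [valC_iff, linC_coe]
  refine congrArg Germ.ofFun (funext fun q => ?_)
  simp only [valP, Finset.sum_singleton, Int.cast_one, one_mul, ← Complex.exp_add]
  change Complex.exp (-linC (l q) (t q) (α q) (β q)) = _
  congr 1
  simp only [linC]
  ring

end Isomorphisms

end PseudoFinite

end

/-! ### Assembly, with single exponentials as one-term expressions -/

theorem mainTheorem2 (D : Ultrafilter Nat.Primes) (hD : (D : Filter Nat.Primes) ≤ Filter.cofinite)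
    (p e i l u : PseudoFinite.NS D ℤ) (h : PseudoFinite.IsScale p e i l u)
    (π' : PseudoFinite.NS D ℝ)
    (hπ : Filter.Germ.LiftPred (fun t : ℝ => Transcendental ℚ (Real.exp t)) π') :
    ∃ (IU : PseudoFinite.Quo ((p - 1) * l) → PseudoFinite.NS D ℂ)
      (IF : PseudoFinite.Quo p → PseudoFinite.NS D ℂ),
      (∀ α ∈ PseudoFinite.OLin l, ∀ β ∈ PseudoFinite.OLin l,
        IU (PseudoFinite.combU p i l u α β) =
          -(PseudoFinite.toC α * PseudoFinite.periodRe l π' +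
            PseudoFinite.toC β * PseudoFinite.periodIm l)) ∧
      (∀ K a r s y z, PseudoFinite.IsExpr {p, e, i} l K a r s →
        PseudoFinite.ValF p e i l u K a r s y → PseudoFinite.ValC l π' K a r s z → IF y = z) ∧
      Set.BijOn IU (PseudoFinite.UL p i l u) (PseudoFinite.CL l π') ∧
      Set.BijOn IF (PseudoFinite.OF p e i l u) (PseudoFinite.OC p e i l π') ∧
      (∀ (m : ℕ) (K : PseudoFinite.NS D (Finset ℤ))
        (x : PseudoFinite.NS D ℤ → PseudoFinite.Quo ((p - 1) * l)) (y),
        PseudoFinite.IsIndexSet l m K →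
        (∀ k, PseudoFinite.IMem k K → x k ∈ PseudoFinite.UL p i l u) →
        PseudoFinite.HasSumMod K x y →
        ∃ z, PseudoFinite.HasSumC K (fun k => IU (x k)) z ∧
          ((z ∈ PseudoFinite.CL l π' ∨
              ∀ j w, PseudoFinite.HasSumMod (PseudoFinite.initial K j) x w →
                w ∈ PseudoFinite.UL p i l u) →
            y ∈ PseudoFinite.UL p i l u ∧ IU y = z)) ∧
      (∀ (m : ℕ) (K : PseudoFinite.NS D (Finset ℤ))
        (x : PseudoFinite.NS D ℤ → PseudoFinite.Quo p) (y),
        PseudoFinite.IsIndexSet l m K →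
        (∀ k, PseudoFinite.IMem k K → x k ∈ PseudoFinite.OF p e i l u) →
        PseudoFinite.HasSumMod K x y →
        y ∈ PseudoFinite.OF p e i l u ∧ PseudoFinite.HasSumC K (fun k => IF (x k)) (IF y)) ∧
      Set.MapsTo (PseudoFinite.expF p e l) (PseudoFinite.UL p i l u)
        (PseudoFinite.OF p e i l u) ∧
      Set.MapsTo PseudoFinite.expC (PseudoFinite.CL l π') (PseudoFinite.OC p e i l π') ∧
      ∀ x ∈ PseudoFinite.UL p i l u,
        IF (PseudoFinite.expF p e l x) = PseudoFinite.expC (IU x) := by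
  induction p using Filter.Germ.inductionOn with | _ p
  induction e using Filter.Germ.inductionOn with | _ e
  induction i using Filter.Germ.inductionOn with | _ i
  induction l using Filter.Germ.inductionOn with | _ l
  induction u using Filter.Germ.inductionOn with | _ u
  induction π' using Filter.Germ.inductionOn with | _ t
  obtain ⟨IU, hU, hUbij, hUsum⟩ := h.exists_linear_map hπ
  obtain ⟨IF, hF, hFbij, hFsum⟩ := h.exists_field_map hπ
  refine ⟨IU, IF, hU, hF, hUbij, hFbij, hUsum, hFsum, ?_, ?_, ?_⟩
  · rintro x ⟨α, hα, β, hβ, rfl⟩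
    induction α using Filter.Germ.inductionOn with | _ α
    induction β using Filter.Germ.inductionOn with | _ β
    exact ⟨_, _, _, _, PseudoFinite.isExpr_single _ hα hβ, h.valF_single α β⟩
  · rintro z ⟨α, hα, β, hβ, rfl⟩
    induction α using Filter.Germ.inductionOn with | _ α
    induction β using Filter.Germ.inductionOn with | _ β
    -- The exponents in `termC` carry a minus sign, so the coordinates of `z` are negated.
    refine ⟨_, _, _, _, PseudoFinite.isExpr_single _ (α := -α) (β := -β)
      (PseudoFinite.neg_mem_OLin hα) (PseudoFinite.neg_mem_OLin hβ), ?_⟩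
    have hz := PseudoFinite.valC_single (D := D) (l := l) (t := t) (-α) (-β)
    rw [PseudoFinite.linC_coe] at hz ⊢
    convert hz using 2
    refine congrArg Filter.Germ.ofFun (funext fun q => ?_)
    change PseudoFinite.linC (l q) (t q) (α q) (β q) =
      -PseudoFinite.linC (l q) (t q) (-α q) (-β q)
    rw [PseudoFinite.neg_linC, neg_neg, neg_neg]
  · rintro x ⟨α, hα, β, hβ, rfl⟩
    rw [hU α hα β hβ]
    induction α using Filter.Germ.inductionOn with | _ α
    induction β using Filter.Germ.inductionOn with | _ β
    exact hF _ _ _ _ _ _ (PseudoFinite.isExpr_single _ hα hβ) (h.valF_single α β)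
      (PseudoFinite.valC_single α β)
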